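/- **Setting.** Let $\mathcal H_S=\{x^2+y^2-z^2=-1,\ z<0\}$ be the hyperboloid model of the hyperbolic plane with the metric induced from $dx^2+dy^2-dz^2$, let $\mathcal S_{SH}=\{x^2+y^2+z^2=1,\ z<0\}$ be the open southern hemisphere with its round metric, and let $O=(0,0,-1)$ be the south pole. Write $\theta$ for the distance to $O$ on either surface. All systems below are natural mechanical systems $\nabla_{\dot q}\dot q=\nabla U(q)$ with energy $\frac12|\dot q|^2-U(q)$, considered away from $O$, with elastic reflection at the walls. For $m,f\in\mathbb R$: - the hyperbolic Kepler problem is $(\mathcal H_S\setminus\{O\},\ U=m\coth\theta)$; - the Hooke problems are $(\mathcal S_{SH}\setminus\{O\},\ U=f\tan^2\theta)$ and $(\mathcal H_S\setminus\{O\},\ U=f\tanh^2\theta)$. Let $M$ be $\mathcal S_{SH}$ (put $\varepsilon=+1$) or $\mathcal H_S$ (put $\varepsilon=-1$). Stereographic projection from $(0,0,1)$ identifies $M$ and $\mathcal H_S$ with the unit disc in $\mathbb C$; let $\Phi:M\setminus\{O\}\to\mathcal H_S\setminus\{O\}$ be the map that reads $\zeta\mapsto\zeta^2$ in these charts. Fix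 a point $Z\in\mathcal H_S$ and let $\mathcal W$ be a finite set of branches of confocal conic sections of $\mathcal H_S$ with foci $O$ and $Z$: ellipses $d(q,O)+d(q,Z)=k$ with $k>d(O,Z)$, and branches of hyperbolas $d(q,O)-d(q,Z)=k$ with $|k|<d(O,Z)$ (for $k=0$ the perpendicular bisector; for $Z=O$ only circles occur). Let $\Phi^{-1}\mathcal W=\{\Phi^{-1}(C): C\in\mathcal W\}$. **Proposition.** 1. There is a point $P\in M$ such that $Z$ is the image of $P$ under the complex square mapping, and every curve of $\Phi^{-1}\mathcal W$ is a conic section of $M$ with foci $P$ and $P'$, where $P'$ is the image of $P$ under the rotation by $\pi$ about $O$: an ellipse $d(q,P)+d(q,P')=k'$ with $k'>d(P,P')$, or a hyperbola $|d(q,P)-d(q,P')|=k'$ with $0<k'<d(P,P')$. Thus $\Phi^{-1}\mathcal W$ is a combination of confocal conic sections centred at $O$. 2. For all $m,E\in\mathbb R$, the map $\Phi$ conformally transforms the Hooke billiard on $M$ with factor $f=E+\varepsilon m$ and walls $\Phi^{-1}\mathcal W$ at energy $2m$ into the hyperbolic Kepler billiard with mass factor $m$ and walls $\mathcal W$ at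 energy $E$. That is: $\Phi$ is a smooth, surjective, conformal map $M\setminus\{O\}\to\mathcal H_S\setminus\{O\}$; the laws of reflection at $\Phi^{-1}(C)$ and at $C$ correspond under $d\Phi$; and there is a smooth positive function $\rho$ on $M\setminus\{O\}$ such that, with the change of time $d\tau=\rho(q)\,dt$, $\Phi$ maps every billiard trajectory of the Hooke billiard of energy $2m$ to a billiard trajectory of the Kepler billiard of energy $E$, and every billiard trajectory of the Kepler billiard of energy $E$ lifts in this way to a billiard trajectory of the Hooke billiard of energy $2m$, through any prescribed preimage of any of its points. (A billiard trajectory meets the walls at isolated times and never at a common point of two walls.) 3. Consequently their integrabilities are equivalent: for every set $T\subseteq\mathbb R^2$ of parameters $(m,E)$, the Kepler billiards (mass factor $m$, walls $\mathcal W$, energy $E$), $(m,E)\in T$, are integrable if and only if the Hooke billiards (factor $E+\varepsilon m$, walls $\Phi^{-1}\mathcal W$, energy $2m$), $(m,E)\in T$, are integrable. Here integrable means that there is a function $F$, smooth on the energy hypersurfaces and in the parameters $(m,E)\in T$, that is a first integral of the underlying mechanical systems, is invariant under the reflections at the walls, and is independent of the energy, i.e. the restriction of $F$ to the energy hypersurface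 has nonzero differential at a dense set of points $(m,E,q,\dot q)$. For a one-point set $T$ this is integrability on a single energy hypersurface; for $T=\{m\}\times\mathbb R$ it is, on the Kepler side, integrability of the Kepler billiard with mass factor $m$ on its whole phase space; for $T=\{(m,E):E+\varepsilon m=f\}$ it is, on the Hooke side, integrability of the Hooke billiard with factor $f$ on its whole phase space. -/

import Mathlib

open scoped Topology ContDiff

noncomputable section

namespace ConicBilliards

/-- The ambient space `ℝ³` (Euclidean space or Minkowski space, see `form`). -/
abbrev V3 : Type := ℝ × ℝ × ℝ

/-- The two curved geometries. -/
inductive Geom where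
  | spherical
  | hyperbolic

/-- `+1` for the sphere and `-1` for the hyperbolic plane. -/
def Geom.sign : Geom → ℝ
  | .spherical => 1
  | .hyperbolic => -1

/-- `dx² + dy² + dz²` in the spherical case, `dx² + dy² - dz²` in the hyperbolic case. -/
def Geom.form (g : Geom) (u v : V3) : ℝ :=
  u.1 * v.1 + u.2.1 * v.2.1 + g.sign * (u.2.2 * v.2.2)

/-- The open southern hemisphere `x² + y² + z² = 1, z < 0`, respectively the lower sheet
`x² + y² - z² = -1, z < 0` of the hyperboloid. The Riemannian metric on it is the restriction
of `Geom.form`. -/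
def Geom.surface (g : Geom) : Set V3 := {q | g.form q q = g.sign ∧ q.2.2 < 0}

/-- The tangent plane of `Geom.surface` at `q`. -/
def Geom.tangent (g : Geom) (q : V3) : Set V3 := {v | g.form q v = 0}

/-- The south pole, which lies on both surfaces. -/
def southPole : V3 := (0, 0, -1)

/-- The central (hyperbolic) angle between two points. On the surface it is the Riemannian
distance; it is extended to a neighbourhood of the surface by homogeneity of degree `0`. -/
def Geom.angle (g : Geom) (p q : V3) : ℝ :=
  match g with
  | .spherical =>
      Real.arccos (Geom.spherical.form p q /
        √(Geom.spherical.form p p * Geom.spherical.form q q))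
  | .hyperbolic =>
      Real.arcosh (-Geom.hyperbolic.form p q /
        √(Geom.hyperbolic.form p p * Geom.hyperbolic.form q q))

/-! ## Mechanical billiards -/

/-- A mechanical billiard on (an open subset `domain` of) one of the two surfaces, with a force
function and a set of reflection walls, each of which is a curve. Only the values of the force
function along the surface matter; it is given near the surface in order to differentiate it. -/
structure Billiard where
  geom : Geom
  domain : Set V3
  force : V3 → ℝ
  walls : Set (Set V3)

/-- The velocities at `q` of the curves that run in `C`: the tangent space of `C` at `q`. -/
def velocities (C : Set V3) (q : V3) : Set V3 :=
  {v | ∃ c : ℝ → V3, c 0 = q ∧ (∀ᶠ t in 𝓝 (0 : ℝ), c t ∈ C) ∧ HasDerivAt c v 0}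

/-- Elastic reflection at the point `q` of the curve `C`: the tangential component of the
velocity is kept, the normal component changes its sign. -/
def Geom.Reflects (g : Geom) (C : Set V3) (q v w : V3) : Prop :=
  ∃ s ∈ velocities C q, ∃ n ∈ g.tangent q,
    (∀ u ∈ velocities C q, g.form n u = 0) ∧ v = s + n ∧ w = s - n

namespace Billiard

variable (S : Billiard)

/-- Kinetic energy minus force function. -/
def energy (q v : V3) : ℝ := S.geom.form v v / 2 - S.force q

/-- The energy hypersurface in the phase space. -/
def level (e : ℝ) : Set (V3 × V3) :=
  {x | x.1 ∈ S.domain ∧ x.2 ∈ S.geom.tangent x.1 ∧ S.energy x.1 x.2 = e}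

/-- The curve `γ` is twice differentiable at time `t` and satisfies `∇_{γ'} γ' = ∇ U(γ)` there.
The covariant derivative on the surface is the tangential part of the acceleration, so that both
sides are compared by pairing them with the tangent vectors `u`. -/
def NewtonAt (γ : ℝ → V3) (t : ℝ) : Prop :=
  (∀ᶠ s in 𝓝 t, DifferentiableAt ℝ γ s) ∧ DifferentiableAt ℝ (deriv γ) t ∧
    ∀ u ∈ S.geom.tangent (γ t),
      S.geom.form (deriv (deriv γ) t) u = fderiv ℝ S.force (γ t) u

/-- A motion of the underlying mechanical system (the walls play no role) with energy `e` on
the open interval `I`. -/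
def IsMotion (e : ℝ) (I : Set ℝ) (γ : ℝ → V3) : Prop :=
  IsOpen I ∧ I.OrdConnected ∧
    ∀ t ∈ I, γ t ∈ S.domain ∧ S.NewtonAt γ t ∧ S.energy (γ t) (deriv γ t) = e

/-- A billiard trajectory with energy `e` on the open interval `I`: a continuous curve that
satisfies the equation of motion while it is not on a wall, that meets the walls at isolated
times only, never at a common point of two walls, and that is reflected elastically then. -/
def IsTrajectory (e : ℝ) (I : Set ℝ) (γ : ℝ → V3) : Prop :=
  IsOpen I ∧ I.OrdConnected ∧ ContinuousOn γ I ∧ (∀ t ∈ I, γ t ∈ S.domain) ∧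
  (∀ t ∈ I, (∀ C ∈ S.walls, γ t ∉ C) →
    S.NewtonAt γ t ∧ S.energy (γ t) (deriv γ t) = e) ∧
  (∀ t ∈ I, ∀ C ∈ S.walls, γ t ∈ C →
    (∀ C' ∈ S.walls, γ t ∈ C' → C' = C) ∧
    (∀ᶠ s in 𝓝[≠] t, ∀ C' ∈ S.walls, γ s ∉ C') ∧
    ∃ v w : V3, HasDerivWithinAt γ v (Set.Iic t) t ∧ HasDerivWithinAt γ w (Set.Ici t) t ∧
      S.geom.Reflects C (γ t) v w)

end Billiard

/-! ## Conformal transformations -/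

/-- `Φ` carries the curve `γ` on `I` to the curve `Γ` on `J` after the change of time `τ`, whose
speed is the value of `ρ` at the position. -/
def Carries (Φ : V3 → V3) (ρ : V3 → ℝ) (τ : ℝ → ℝ) (I : Set ℝ) (γ : ℝ → V3)
    (J : Set ℝ) (Γ : ℝ → V3) : Prop :=
  Set.BijOn τ I J ∧ (∀ t ∈ I, HasDerivAt τ (ρ (γ t)) t) ∧ ∀ t ∈ I, Γ (τ t) = Φ (γ t)

/-- The billiard `S` at energy `e` is conformally transformed by `Φ` into the billiard `S'` at
energy `e'`: `Φ` is a smooth conformal map of the domain of `S` onto the domain of `S'`, the walls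
and the laws of reflection correspond, and, up to a change of time that depends on the position
only, `Φ` maps billiard trajectories to billiard trajectories and every billiard trajectory of
`S'` lifts to one of `S` through every point above a given point of it. -/
def IsConformalTransformation (Φ : V3 → V3) (S S' : Billiard) (e e' : ℝ) : Prop :=
  Set.MapsTo Φ S.domain S'.domain ∧ Set.SurjOn Φ S.domain S'.domain ∧
  (∀ q ∈ S.domain, ContDiffAt ℝ ∞ Φ q ∧
    (∀ u ∈ S.geom.tangent q, fderiv ℝ Φ q u ∈ S'.geom.tangent (Φ q)) ∧
    ∃ l : ℝ, 0 < l ∧ ∀ u ∈ S.geom.tangent q, ∀ v ∈ S.geom.tangent q,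
      S'.geom.form (fderiv ℝ Φ q u) (fderiv ℝ Φ q v) = l * S.geom.form u v) ∧
  S.walls = (fun C => S.domain ∩ Φ ⁻¹' C) '' S'.walls ∧
  (∀ C ∈ S'.walls, ∀ q ∈ S.domain, Φ q ∈ C →
    ∀ v ∈ S.geom.tangent q, ∀ w ∈ S.geom.tangent q,
      (S.geom.Reflects (S.domain ∩ Φ ⁻¹' C) q v w ↔
        S'.geom.Reflects C (Φ q) (fderiv ℝ Φ q v) (fderiv ℝ Φ q w))) ∧
  ∃ ρ : V3 → ℝ, ContDiffOn ℝ ∞ ρ S.domain ∧ (∀ q ∈ S.domain, 0 < ρ q) ∧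
    (∀ (I : Set ℝ) (γ : ℝ → V3), S.IsTrajectory e I γ →
      ∃ (J : Set ℝ) (Γ : ℝ → V3) (τ : ℝ → ℝ),
        S'.IsTrajectory e' J Γ ∧ Carries Φ ρ τ I γ J Γ) ∧
    (∀ (J : Set ℝ) (Γ : ℝ → V3), S'.IsTrajectory e' J Γ →
      ∀ t₀ ∈ J, ∀ q₀ ∈ S.domain, Φ q₀ = Γ t₀ →
        ∃ (I : Set ℝ) (γ : ℝ → V3) (τ : ℝ → ℝ), S.IsTrajectory e I γ ∧
          Carries Φ ρ τ I γ J Γ ∧ ∃ s₀ ∈ I, γ s₀ = q₀ ∧ τ s₀ = t₀)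

/-! ## Integrability -/

/-- The union over the parameters `p ∈ T` of the energy hypersurfaces with energy `e p` of the
billiards `S p`. -/
def familyLevel (T : Set (ℝ × ℝ)) (S : ℝ × ℝ → Billiard) (e : ℝ × ℝ → ℝ) :
    Set ((ℝ × ℝ) × V3 × V3) :=
  {x | x.1 ∈ T ∧ x.2 ∈ (S x.1).level (e x.1)}

/-- The restriction of `F` to the set `X` has a nonzero differential at `x`. -/
def RegularAt (F : V3 × V3 → ℝ) (X : Set (V3 × V3)) (x : V3 × V3) : Prop :=
  ∃ c : ℝ → V3 × V3, c 0 = x ∧ (∀ᶠ t in 𝓝 (0 : ℝ), c t ∈ X) ∧ DifferentiableAt ℝ c 0 ∧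
    deriv (fun t => F (c t)) 0 ≠ 0

/-- The billiards `S p` at the energies `e p`, for `p ∈ T`, are integrable: there is a function
`F`, smooth on the phase space and in the parameter, that is constant along the motions of the
mechanical systems, invariant under the reflections at the walls, and independent of the energy:
on a dense set of points, the restriction of `F` to the energy hypersurface has a nonzero
differential.

If `T` is a point, this is integrability of one billiard on one energy hypersurface. If `T` is a
line on which `S` is constant and `e` is affine and injective, then `F` amounts to a function on
the whole phase space of one billiard, and this is integrability of that billiard. -/
def IsIntegrable (T : Set (ℝ × ℝ)) (S : ℝ × ℝ → Billiard) (e : ℝ × ℝ → ℝ) : Prop :=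
  ∃ F : (ℝ × ℝ) × V3 × V3 → ℝ,
    ContDiffOn ℝ ∞ F (familyLevel T S e) ∧
    (∀ p ∈ T, ∀ (I : Set ℝ) (γ : ℝ → V3), (S p).IsMotion (e p) I γ →
      ∀ s ∈ I, ∀ t ∈ I, F (p, γ s, deriv γ s) = F (p, γ t, deriv γ t)) ∧
    (∀ p ∈ T, ∀ C ∈ (S p).walls, ∀ q ∈ C, ∀ v w : V3, (q, v) ∈ (S p).level (e p) →
      (S p).geom.Reflects C q v w → F (p, q, v) = F (p, q, w)) ∧
    familyLevel T S e ⊆ closure {x | x ∈ familyLevel T S e ∧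
      RegularAt (fun y => F (x.1, y)) ((S x.1).level (e x.1)) x.2}

/-! ## Kepler and Hooke billiards -/

/-- A surface without the south pole. -/
def Geom.punctured (g : Geom) : Set V3 := {q | q ∈ g.surface ∧ q ≠ southPole}

/-- The force function `m coth θ`, where `θ` is the hyperbolic angle to the south pole. -/
def keplerForce (m : ℝ) (q : V3) : ℝ :=
  m * (Real.cosh (Geom.hyperbolic.angle q southPole) /
    Real.sinh (Geom.hyperbolic.angle q southPole))

/-- The force function `f tan² θ`, respectively `f tanh² θ`, where `θ` is the angle to the
south pole. -/
def hookeForce (g : Geom) (f : ℝ) (q : V3) : ℝ :=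
  match g with
  | .spherical => f * Real.tan (Geom.spherical.angle q southPole) ^ 2
  | .hyperbolic => f * Real.tanh (Geom.hyperbolic.angle q southPole) ^ 2

/-- The hyperbolic Kepler billiard centred at the south pole. -/
def keplerBilliard (m : ℝ) (W : Set (Set V3)) : Billiard where
  geom := .hyperbolic
  domain := Geom.hyperbolic.punctured
  force := keplerForce m
  walls := W

/-- The hemispherical or hyperbolic Hooke billiard centred at the south pole, away from its
centre. -/
def hookeBilliard (g : Geom) (f : ℝ) (W : Set (Set V3)) : Billiard where
  geom := g
  domain := g.punctured
  force := hookeForce g f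
  walls := W

/-! ## Confocal conic sections -/

/-- `C` is an ellipse in the hyperbolic plane with foci at the south pole and at `Z` (a circle if
`Z` is the south pole), or a branch of a hyperbola with these foci. The sign of `k` tells the two
branches of a hyperbola apart, and `k = 0` is the perpendicular bisector, the common limit of
both branches. -/
def IsFocusedBranch (Z : V3) (C : Set V3) : Prop :=
  (∃ k : ℝ, Geom.hyperbolic.angle southPole Z < k ∧
    C = {q | q ∈ Geom.hyperbolic.surface ∧
      Geom.hyperbolic.angle q southPole + Geom.hyperbolic.angle q Z = k}) ∨
  (∃ k : ℝ, |k| < Geom.hyperbolic.angle southPole Z ∧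
    C = {q | q ∈ Geom.hyperbolic.surface ∧
      Geom.hyperbolic.angle q southPole - Geom.hyperbolic.angle q Z = k})

/-- The rotation by `π` about the vertical axis, that is, the point reflection of either surface
in the south pole. -/
def halfTurn (q : V3) : V3 := (-q.1, -q.2.1, q.2.2)

/-- `K` is an ellipse with foci `P` and `halfTurn P`, hence centred at the south pole (a circle
if `P` is the south pole), or a hyperbola (both branches) with these foci. -/
def Geom.IsCentredConic (g : Geom) (P : V3) (K : Set V3) : Prop :=
  (∃ k : ℝ, g.angle P (halfTurn P) < k ∧
    K = {q | q ∈ g.surface ∧ g.angle q P + g.angle q (halfTurn P) = k}) ∨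
  (∃ k : ℝ, 0 < k ∧ k < g.angle P (halfTurn P) ∧
    K = {q | q ∈ g.surface ∧ |g.angle q P - g.angle q (halfTurn P)| = k})

/-! ## The complex square mapping -/

/-- The stereographic projection from the north pole `(0, 0, 1)` to the plane `z = 0`, identified
with `ℂ`. It maps the southern hemisphere, and the lower sheet of the hyperboloid (this is the
Poincaré disc model), onto the unit disc. -/
def stereo (q : V3) : ℂ := ⟨q.1 / (1 - q.2.2), q.2.1 / (1 - q.2.2)⟩

/-- The inverse of the stereographic projection of the lower sheet of the hyperboloid. -/
def poincareInv (ζ : ℂ) : V3 :=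
  (2 * ζ.re / (1 - Complex.normSq ζ), 2 * ζ.im / (1 - Complex.normSq ζ),
    -(1 + Complex.normSq ζ) / (1 - Complex.normSq ζ))

/-- The complex square mapping `ζ ↦ ζ²` of the unit disc, as a map from the southern hemisphere or
the lower sheet of the hyperboloid to the lower sheet of the hyperboloid. -/
def squareMap (q : V3) : V3 := poincareInv (stereo q ^ 2)

/-- The preimages under the complex square mapping of the curves in `W`. -/
def Geom.squareRootWalls (g : Geom) (W : Set (Set V3)) : Set (Set V3) :=
  (fun C => g.punctured ∩ squareMap ⁻¹' C) '' W

end ConicBilliards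

end

open ConicBilliards

/-!
Everything is computed in the stereographic chart, where `M` and the hyperbolic plane are the unit
disc with the metric `4 |dζ|² / (1 + ε|ζ|²)²` and the map is `w = ζ²`.

*Trajectories.* The square mapping multiplies the metric by `λ = 4|ζ|² / (1 - ε|ζ|²)²`, which is
`tan² θ` on the sphere and `tanh² θ` on the hyperbolic plane, that is, the Hooke force function
itself, and the Kepler force function `U` satisfies `λ · U(ζ²) = 2m + ε m λ`
(`form_fderiv_squareMap`, `factor_mul_keplerForce`). Hence `λ (U + E) = (E + εm) λ + 2m`: the
Jacobi metrics of the Hooke problem with factor `E + εm` at energy `2m` and of the Kepler problem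
at energy `E` coincide. The correspondence of the motions is verified directly: with the change of
time of speed `λ`, the energy relations and the second-order equations in the chart turn into each
other (`chart_energy_iff`, `chart_newton_iff`). Since `ζ ↦ ζ²` is a double covering of the
punctured disc, curves also lift through a given point (`exists_lift`). A conformal local
diffeomorphism preserves the law of reflection (`reflects_squareMap_iff`).

*Integrability.* A first integral of the Kepler billiards pulls back. Conversely, a first integral
`F` of the Hooke billiards descends if it is invariant under the half turn `R`, which generates the
deck transformations. The symmetrization `A = F + F ∘ R` is invariant but may depend on the energy
only; the antisymmetric `B = F - F ∘ R` has an invariant square. Where `A + c B²` is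
locally constant on an energy hypersurface for two values of `c`, so are `A` and `B`, and hence
`F`. A countable dense set of points therefore excludes only countably many `c`, and for some `c`
the combination `A + c B²` is not locally constant at a dense set of points
(`exists_add_mul_sq_not_locallyConstantAt`). To pass from there to regular points one needs that
the energy hypersurfaces are retracts (`hooke_exists_retraction`); this works where the velocity is
not zero, and points of rest are limits of moving points of the same energy, unless all points of
the hypersurface are at rest (`hooke_exists_moving`).

*Conic sections.* Let `u`, `v` be the distances of `q` from `P` and from its opposite point `P'`,
let `x`, `y` be the distances of the image of `q` from `O` and from the image `Z` of `P`, and let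
`c` be the distance from `O` to `Z`. In the hyperbolic case
`exp ((x + c + y) / 2) = cosh ((u + v) / 2)` and `exp ((x + c - y) / 2) = cosh ((u - v) / 2)`; on
the sphere the secant takes the place of `cosh` (`excess_angle`). Thus `x + y` is constant iff
`u + v` is, and `x - y` is constant iff `|u - v|` is; the bounds on the constants correspond by
monotonicity, since `q = P` gives `exp c = cosh (d(P, P') / 2)`.
-/

open scoped Topology ContDiff

noncomputable section

namespace ConicBilliards

/-! ### The stereographic chart -/

theorem Geom.sign_mul_self (g : Geom) : g.sign * g.sign = 1 := by cases g <;> norm_num [Geom.sign]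

theorem Geom.sign_sq (g : Geom) : g.sign ^ 2 = 1 := by cases g <;> norm_num [Geom.sign]

/-- The factor `2 / (1 + ε|ζ|²)` by which lengths at `ζ` in the disc are multiplied in the
surface. -/
def Geom.scale (g : Geom) (ζ : ℂ) : ℝ := 2 / (1 + g.sign * Complex.normSq ζ)

/-- The inverse of the stereographic projection, from the unit disc to the surface. -/
def Geom.chart (g : Geom) (ζ : ℂ) : V3 :=
  (2 * ζ.re / (1 + g.sign * Complex.normSq ζ), 2 * ζ.im / (1 + g.sign * Complex.normSq ζ),
    -(1 - g.sign * Complex.normSq ζ) / (1 + g.sign * Complex.normSq ζ))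

theorem poincareInv_eq_chart : poincareInv = Geom.hyperbolic.chart := by
  funext ζ
  simp only [poincareInv, Geom.chart, Geom.sign]
  congr 3 <;> ring

theorem Geom.one_add_pos (g : Geom) {ζ : ℂ} (h : Complex.normSq ζ < 1) :
    0 < 1 + g.sign * Complex.normSq ζ := by
  have := Complex.normSq_nonneg ζ
  cases g <;> simp only [Geom.sign] <;> linarith

theorem Geom.one_sub_pos (g : Geom) {ζ : ℂ} (h : Complex.normSq ζ < 1) :
    0 < 1 - g.sign * Complex.normSq ζ := by
  have := Complex.normSq_nonneg ζ
  cases g <;> simp only [Geom.sign] <;> linarith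

theorem Geom.scale_pos (g : Geom) {ζ : ℂ} (h : Complex.normSq ζ < 1) : 0 < g.scale ζ :=
  div_pos two_pos (g.one_add_pos h)

theorem Geom.chart_mem_surface (g : Geom) {ζ : ℂ} (h : Complex.normSq ζ < 1) :
    g.chart ζ ∈ g.surface := by
  have h1 := g.one_add_pos h
  have h2 := g.one_sub_pos h
  have h3 := g.sign_mul_self
  refine ⟨?_, div_neg_of_neg_of_pos (by linarith) h1⟩
  simp only [Geom.chart, Geom.form]
  field_simp
  rw [Complex.normSq_apply] at *
  linear_combination (-4) * (ζ.re * ζ.re + ζ.im * ζ.im) * h3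

theorem stereo_chart (g : Geom) {ζ : ℂ} (h : Complex.normSq ζ < 1) : stereo (g.chart ζ) = ζ := by
  have h1 := g.one_add_pos h
  apply Complex.ext <;> simp only [stereo, Geom.chart] <;> field_simp <;> ring

theorem one_sub_height_pos {g : Geom} {q : V3} (hq : q ∈ g.surface) : 0 < 1 - q.2.2 := by
  linarith [hq.2]

theorem sign_mul_normSq_stereo {g : Geom} {q : V3} (hq : q ∈ g.surface) :
    g.sign * Complex.normSq (stereo q) = (1 + q.2.2) / (1 - q.2.2) := by
  have h1 := one_sub_height_pos hq
  have h2 := hq.1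
  have h3 := g.sign_mul_self
  simp only [stereo, Complex.normSq_apply, Geom.form] at *
  field_simp
  linear_combination g.sign * h2 + (1 - q.2.2 ^ 2) * h3

theorem normSq_stereo_lt_one {g : Geom} {q : V3} (hq : q ∈ g.surface) :
    Complex.normSq (stereo q) < 1 := by
  have h1 := one_sub_height_pos hq
  have h2 := sign_mul_normSq_stereo hq
  have h3 := hq.2
  cases g <;> simp only [Geom.sign, one_mul, neg_mul] at h2
  · rw [h2, div_lt_one h1]; linarith
  · rw [neg_eq_iff_eq_neg] at h2
    rw [h2, ← neg_div, div_lt_one h1]; linarith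

theorem chart_stereo {g : Geom} {q : V3} (hq : q ∈ g.surface) : g.chart (stereo q) = q := by
  have h1 := one_sub_height_pos hq
  have h2 := sign_mul_normSq_stereo hq
  have h4 : 1 - q.2.2 + (1 + q.2.2) ≠ 0 := by ring_nf; norm_num
  simp only [Geom.chart, h2]
  refine Prod.ext ?_ (Prod.ext ?_ ?_) <;> simp only [stereo] <;> field_simp <;> ring

theorem Geom.chart_zero (g : Geom) : g.chart 0 = southPole := by
  simp [Geom.chart, southPole]

theorem stereo_southPole : stereo southPole = 0 := by
  apply Complex.ext <;> simp [stereo, southPole]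

theorem Geom.chart_mem_punctured (g : Geom) {ζ : ℂ} (h : Complex.normSq ζ < 1) (h0 : ζ ≠ 0) :
    g.chart ζ ∈ g.punctured :=
  ⟨g.chart_mem_surface h, fun h1 => h0 (by rw [← stereo_chart g h, h1, stereo_southPole])⟩

theorem stereo_ne_zero {g : Geom} {q : V3} (hq : q ∈ g.punctured) : stereo q ≠ 0 := fun h =>
  hq.2 (by rw [← chart_stereo hq.1, h, g.chart_zero])

theorem Geom.contDiffAt_chart (g : Geom) {ζ : ℂ} (h : Complex.normSq ζ < 1) :
    ContDiffAt ℝ ∞ g.chart ζ := by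
  have h1 := (g.one_add_pos h).ne'
  have hre : ContDiffAt ℝ ∞ (fun z : ℂ => z.re) ζ := Complex.reCLM.contDiff.contDiffAt
  have him : ContDiffAt ℝ ∞ (fun z : ℂ => z.im) ζ := Complex.imCLM.contDiff.contDiffAt
  have hn : ContDiffAt ℝ ∞ (fun z : ℂ => Complex.normSq z) ζ := by
    simp only [Complex.normSq_apply]
    exact (hre.mul hre).add (him.mul him)
  unfold Geom.chart
  exact ((contDiffAt_const.mul hre).div (contDiffAt_const.add (contDiffAt_const.mul hn)) h1).prodMk
    (((contDiffAt_const.mul him).div (contDiffAt_const.add (contDiffAt_const.mul hn)) h1).prodMk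
    ((contDiffAt_const.sub (contDiffAt_const.mul hn)).neg.div
      (contDiffAt_const.add (contDiffAt_const.mul hn)) h1))

theorem contDiffAt_stereo {q : V3} (h : 1 - q.2.2 ≠ 0) : ContDiffAt ℝ ∞ stereo q := by
  have h1 : ContDiffAt ℝ ∞ (fun q : V3 => q.1 / (1 - q.2.2)) q :=
    contDiffAt_fst.div (contDiffAt_const.sub (contDiffAt_snd.comp q contDiffAt_snd)) h
  have h2 : ContDiffAt ℝ ∞ (fun q : V3 => q.2.1 / (1 - q.2.2)) q :=
    (contDiffAt_fst.comp q contDiffAt_snd).div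
      (contDiffAt_const.sub (contDiffAt_snd.comp q contDiffAt_snd)) h
  exact (Complex.equivRealProdCLM.symm.contDiff.contDiffAt (x := _)).comp q (h1.prodMk h2)

theorem Geom.differentiableAt_chart (g : Geom) {ζ : ℂ} (h : Complex.normSq ζ < 1) :
    DifferentiableAt ℝ g.chart ζ := (g.contDiffAt_chart h).differentiableAt (by simp)

theorem contDiffAt_stereo_of_mem {g : Geom} {q : V3} (hq : q ∈ g.surface) :
    ContDiffAt ℝ ∞ stereo q := contDiffAt_stereo (one_sub_height_pos hq).ne'

theorem differentiableAt_stereo {g : Geom} {q : V3} (hq : q ∈ g.surface) :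
    DifferentiableAt ℝ stereo q := (contDiffAt_stereo_of_mem hq).differentiableAt (by simp)

/-- The inner product of two complex numbers as vectors of the plane. -/
def dot (ζ ξ : ℂ) : ℝ := ζ.re * ξ.re + ζ.im * ξ.im

theorem normSq_eq_dot (ζ : ℂ) : Complex.normSq ζ = dot ζ ζ := Complex.normSq_apply ζ

theorem eventually_normSq_lt {ζ : ℂ} (h : Complex.normSq ζ < 1) :
    ∀ᶠ z in 𝓝 ζ, Complex.normSq z < 1 :=
  Complex.continuous_normSq.continuousAt.eventually (gt_mem_nhds h)

theorem hasDerivAt_re {z : ℝ → ℂ} {z' : ℂ} {t : ℝ} (h : HasDerivAt z z' t) :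
    HasDerivAt (fun t => (z t).re) z'.re t :=
  (Complex.reCLM.hasFDerivAt.comp_hasDerivAt t h)

theorem hasDerivAt_im {z : ℝ → ℂ} {z' : ℂ} {t : ℝ} (h : HasDerivAt z z' t) :
    HasDerivAt (fun t => (z t).im) z'.im t :=
  (Complex.imCLM.hasFDerivAt.comp_hasDerivAt t h)

theorem hasDerivAt_normSq {z : ℝ → ℂ} {z' : ℂ} {t : ℝ} (h : HasDerivAt z z' t) :
    HasDerivAt (fun t => Complex.normSq (z t)) (2 * dot (z t) z') t := by
  simp only [Complex.normSq_apply, dot]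
  have h1 := hasDerivAt_re h
  have h2 := hasDerivAt_im h
  exact ((h1.mul h1).add (h2.mul h2)).congr_deriv (by ring)

theorem Geom.hasDerivAt_scale (g : Geom) {z : ℝ → ℂ} {z' : ℂ} {t : ℝ} (h : HasDerivAt z z' t)
    (h1 : Complex.normSq (z t) < 1) :
    HasDerivAt (fun t => g.scale (z t)) (-g.sign * g.scale (z t) ^ 2 * dot (z t) z') t := by
  have h2 := (g.one_add_pos h1).ne'
  unfold Geom.scale
  refine ((hasDerivAt_const t (2 : ℝ)).div
    (((hasDerivAt_normSq h).const_mul g.sign).const_add 1) h2).congr_deriv ?_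
  field_simp
  ring

/-- The differential of `Geom.chart` at `ζ` in the direction `ξ`, in coordinates. -/
def Geom.chartDeriv (g : Geom) (ζ ξ : ℂ) : V3 :=
  (g.scale ζ * ξ.re - g.sign * g.scale ζ ^ 2 * dot ζ ξ * ζ.re,
    g.scale ζ * ξ.im - g.sign * g.scale ζ ^ 2 * dot ζ ξ * ζ.im,
    g.sign * g.scale ζ ^ 2 * dot ζ ξ)

theorem Geom.chart_eq_scale (g : Geom) {ζ : ℂ} (h : Complex.normSq ζ < 1) :
    g.chart ζ = (g.scale ζ * ζ.re, g.scale ζ * ζ.im, 1 - g.scale ζ) := by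
  have h1 := g.one_add_pos h
  simp only [Geom.chart, Geom.scale]
  refine Prod.ext ?_ (Prod.ext ?_ ?_) <;> simp only <;> field_simp
  ring

theorem Geom.hasDerivAt_chart (g : Geom) {z : ℝ → ℂ} {z' : ℂ} {t : ℝ} (h : HasDerivAt z z' t)
    (h1 : Complex.normSq (z t) < 1) :
    HasDerivAt (fun t => g.chart (z t)) (g.chartDeriv (z t) z') t := by
  have hs := g.hasDerivAt_scale h h1
  have h2 : (fun t => g.chart (z t)) =ᶠ[𝓝 t]
      fun t => (g.scale (z t) * (z t).re, g.scale (z t) * (z t).im, 1 - g.scale (z t)) := by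
    filter_upwards [h.continuousAt.eventually (eventually_normSq_lt h1)] with u hu
    exact g.chart_eq_scale hu
  refine HasDerivAt.congr_of_eventuallyEq ?_ h2
  refine ((hs.mul (hasDerivAt_re h)).prodMk
    ((hs.mul (hasDerivAt_im h)).prodMk (hs.const_sub 1))).congr_deriv ?_
  unfold Geom.chartDeriv
  refine Prod.ext ?_ (Prod.ext ?_ ?_) <;> simp only <;> ring

theorem hasDerivAt_line {E : Type*} [NormedAddCommGroup E] [NormedSpace ℝ E] (a b : E) (t : ℝ) :
    HasDerivAt (fun s : ℝ => a + s • b) b t := by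
  simpa using ((hasDerivAt_id t).smul_const b).const_add a

theorem hasDerivAt_comp_curve {E F : Type*} [NormedAddCommGroup E] [NormedSpace ℝ E]
    [NormedAddCommGroup F] [NormedSpace ℝ F] {f : E → F} {c : ℝ → E} {v : E} {t : ℝ}
    (hf : DifferentiableAt ℝ f (c t)) (hc : HasDerivAt c v t) :
    HasDerivAt (fun s => f (c s)) (fderiv ℝ f (c t) v) t :=
  hf.hasFDerivAt.comp_hasDerivAt t hc

theorem Geom.fderiv_chart (g : Geom) {ζ : ℂ} (h : Complex.normSq ζ < 1) (ξ : ℂ) :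
    fderiv ℝ g.chart ζ ξ = g.chartDeriv ζ ξ := by
  have h1 := hasDerivAt_line ζ ξ 0
  have h2 := g.hasDerivAt_chart h1 (by simpa using h)
  have h3 := hasDerivAt_comp_curve (f := g.chart) (c := fun s : ℝ => ζ + s • ξ)
    (by simpa using g.differentiableAt_chart h) h1
  simpa using h3.unique h2

theorem form_chartDeriv (g : Geom) {ζ : ℂ} (h : Complex.normSq ζ < 1) (ξ η : ℂ) :
    g.form (g.chartDeriv ζ ξ) (g.chartDeriv ζ η) = g.scale ζ ^ 2 * dot ξ η := by
  have h1 := (g.one_add_pos h).ne'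
  have h2 : g.scale ζ * (1 + g.sign * dot ζ ζ) = 2 := by
    rw [← normSq_eq_dot]; unfold Geom.scale; field_simp
  have h3 := g.sign_mul_self
  simp only [Geom.form, Geom.chartDeriv]
  generalize g.scale ζ = s at *
  generalize g.sign = e at *
  simp only [dot] at *
  linear_combination (e * s ^ 3 * (ζ.re * ξ.re + ζ.im * ξ.im) * (ζ.re * η.re + ζ.im * η.im)) * h2 +
    ((s^4 * (ζ.re * ξ.re + ζ.im * ξ.im) * (ζ.re * η.re + ζ.im * η.im)) *
      e) * h3

theorem chartDeriv_mem_tangent (g : Geom) {ζ : ℂ} (h : Complex.normSq ζ < 1) (ξ : ℂ) :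
    g.chartDeriv ζ ξ ∈ g.tangent (g.chart ζ) := by
  have h1 := (g.one_add_pos h).ne'
  have h2 : g.scale ζ * (1 + g.sign * dot ζ ζ) = 2 := by
    rw [← normSq_eq_dot]; unfold Geom.scale; field_simp
  have h3 := g.sign_mul_self
  simp only [Geom.tangent, Set.mem_ofPred_eq, g.chart_eq_scale h, Geom.form, Geom.chartDeriv]
  generalize g.scale ζ = s at *
  generalize g.sign = e at *
  simp only [dot] at *
  linear_combination (- s ^ 2 * (ζ.re * ξ.re + ζ.im * ξ.im)) * h2 +
    (s^2 * (1 - s) * (ζ.re * ξ.re + ζ.im * ξ.im)) * h3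

theorem exists_chartDeriv_eq (g : Geom) {ζ : ℂ} (h : Complex.normSq ζ < 1) {u : V3}
    (hu : u ∈ g.tangent (g.chart ζ)) : ∃ ξ, g.chartDeriv ζ ξ = u := by
  have h0 := (g.one_add_pos h).ne'
  have h1 := (g.scale_pos h).ne'
  have h2 : g.scale ζ * (1 + g.sign * dot ζ ζ) = 2 := by
    rw [← normSq_eq_dot]; unfold Geom.scale; field_simp
  have h3 := g.sign_mul_self
  simp only [Geom.tangent, Set.mem_ofPred_eq, g.chart_eq_scale h, Geom.form] at hu
  refine ⟨⟨(u.1 + ζ.re * u.2.2) / g.scale ζ, (u.2.1 + ζ.im * u.2.2) / g.scale ζ⟩, ?_⟩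
  have key : g.sign * g.scale ζ ^ 2 * dot ζ ⟨(u.1 + ζ.re * u.2.2) / g.scale ζ,
      (u.2.1 + ζ.im * u.2.2) / g.scale ζ⟩ = u.2.2 := by
    simp only [dot] at *
    generalize g.scale ζ = s at *
    generalize g.sign = e at *
    field_simp
    linear_combination e * hu + u.2.2 * h2 - u.2.2 * (1 - s) * h3
  unfold Geom.chartDeriv
  rw [key]
  refine Prod.ext ?_ (Prod.ext ?_ ?_) <;> simp only <;> field_simp <;> ring

/-! ### The complex square mapping -/

theorem normSq_sq (ζ : ℂ) : Complex.normSq (ζ ^ 2) = Complex.normSq ζ ^ 2 := map_pow _ _ _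

theorem normSq_sq_lt_one {ζ : ℂ} (h : Complex.normSq ζ < 1) : Complex.normSq (ζ ^ 2) < 1 := by
  rw [normSq_sq]
  exact pow_lt_one₀ (Complex.normSq_nonneg _) h two_ne_zero

theorem squareMap_chart {g : Geom} {ζ : ℂ} (h : Complex.normSq ζ < 1) :
    squareMap (g.chart ζ) = Geom.hyperbolic.chart (ζ ^ 2) := by
  rw [squareMap, stereo_chart g h, poincareInv_eq_chart]

theorem squareMap_eq (q : V3) : squareMap q = Geom.hyperbolic.chart (stereo q ^ 2) := by
  rw [squareMap, poincareInv_eq_chart]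

theorem stereo_squareMap {g : Geom} {q : V3} (hq : q ∈ g.surface) :
    stereo (squareMap q) = stereo q ^ 2 := by
  rw [squareMap_eq, stereo_chart _ (normSq_sq_lt_one (normSq_stereo_lt_one hq))]

theorem squareMap_mem_surface {g : Geom} {q : V3} (hq : q ∈ g.surface) :
    squareMap q ∈ Geom.hyperbolic.surface := by
  rw [squareMap_eq]
  exact Geom.chart_mem_surface _ (normSq_sq_lt_one (normSq_stereo_lt_one hq))

theorem squareMap_mem_punctured {g : Geom} {q : V3} (hq : q ∈ g.punctured) :
    squareMap q ∈ Geom.hyperbolic.punctured := by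
  rw [squareMap_eq]
  exact Geom.chart_mem_punctured _ (normSq_sq_lt_one (normSq_stereo_lt_one hq.1))
    (pow_ne_zero 2 (stereo_ne_zero hq))

theorem contDiffAt_squareMap {g : Geom} {q : V3} (hq : q ∈ g.surface) :
    ContDiffAt ℝ ∞ squareMap q := by
  have h1 := (contDiffAt_stereo_of_mem hq).pow 2
  have h2 := Geom.hyperbolic.contDiffAt_chart (normSq_sq_lt_one (normSq_stereo_lt_one hq))
  rw [show squareMap = fun q => Geom.hyperbolic.chart (stereo q ^ 2) from funext squareMap_eq]
  exact h2.comp q h1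

theorem differentiableAt_squareMap {g : Geom} {q : V3} (hq : q ∈ g.surface) :
    DifferentiableAt ℝ squareMap q := (contDiffAt_squareMap hq).differentiableAt (by simp)

theorem hasDerivAt_squareMap_comp {g : Geom} {c : ℝ → V3} {v : V3} {t : ℝ}
    (h : c t ∈ g.surface) (hc : HasDerivAt c v t) :
    HasDerivAt (fun s => squareMap (c s)) (fderiv ℝ squareMap (c t) v) t :=
  hasDerivAt_comp_curve (differentiableAt_squareMap h) hc

theorem fderiv_squareMap {g : Geom} {ζ : ℂ} (h : Complex.normSq ζ < 1) (ξ : ℂ) :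
    fderiv ℝ squareMap (g.chart ζ) (g.chartDeriv ζ ξ) =
      Geom.hyperbolic.chartDeriv (ζ ^ 2) (2 * ζ * ξ) := by
  have h1 := hasDerivAt_line ζ ξ 0
  have h0 : ζ + (0 : ℝ) • ξ = ζ := by simp
  have h2 := g.hasDerivAt_chart h1 (by simpa using h)
  have h3 := hasDerivAt_squareMap_comp (g := g) (by
    rw [h0]; exact g.chart_mem_surface h) h2
  have h4 := Geom.hyperbolic.hasDerivAt_chart (h1.pow 2) (by
    simpa only [Pi.pow_apply, h0] using normSq_sq_lt_one h)
  have h5 : (fun s : ℝ => squareMap (g.chart (ζ + s • ξ))) =ᶠ[𝓝 0]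
      fun s => Geom.hyperbolic.chart (((fun s : ℝ => ζ + s • ξ) ^ 2) s) := by
    filter_upwards [h1.continuousAt.eventually (eventually_normSq_lt (by simpa using h))] with s hs
    exact squareMap_chart hs
  have h6 := h3.unique (h4.congr_of_eventuallyEq h5)
  simpa using h6

/-- The factor by which the square mapping multiplies the metric: `tan² θ` on the sphere,
`tanh² θ` on the hyperbolic plane. It is also the speed of the change of time. -/
def Geom.factor (g : Geom) (q : V3) : ℝ :=
  4 * Complex.normSq (stereo q) / (1 - g.sign * Complex.normSq (stereo q)) ^ 2

theorem Geom.factor_pos {g : Geom} {q : V3} (hq : q ∈ g.punctured) : 0 < g.factor q := by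
  have h1 := g.one_sub_pos (normSq_stereo_lt_one hq.1)
  have h2 := Complex.normSq_pos.2 (stereo_ne_zero hq)
  unfold Geom.factor
  positivity

theorem Geom.contDiffAt_factor {g : Geom} {q : V3} (hq : q ∈ g.surface) :
    ContDiffAt ℝ ∞ g.factor q := by
  have h1 := g.one_sub_pos (normSq_stereo_lt_one hq)
  have h2 := contDiffAt_stereo_of_mem hq
  have hn : ContDiffAt ℝ ∞ (fun q => Complex.normSq (stereo q)) q := by
    simp only [Complex.normSq_apply]
    have hre : ContDiffAt ℝ ∞ (fun q => (stereo q).re) q :=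
      (Complex.reCLM.contDiff.contDiffAt).comp q h2
    have him : ContDiffAt ℝ ∞ (fun q => (stereo q).im) q :=
      (Complex.imCLM.contDiff.contDiffAt).comp q h2
    exact (hre.mul hre).add (him.mul him)
  unfold Geom.factor
  exact (contDiffAt_const.mul hn).div ((contDiffAt_const.sub (contDiffAt_const.mul hn)).pow 2)
    (pow_ne_zero 2 h1.ne')

theorem mem_tangent_iff {g : Geom} {q v : V3} (hq : q ∈ g.surface) :
    v ∈ g.tangent q ↔ ∃ ξ, g.chartDeriv (stereo q) ξ = v := by
  have h1 := normSq_stereo_lt_one hq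
  constructor
  · intro h
    rw [← chart_stereo hq] at h
    exact exists_chartDeriv_eq g h1 h
  · rintro ⟨ξ, rfl⟩
    have := chartDeriv_mem_tangent g h1 ξ
    rwa [chart_stereo hq] at this

/-- The square mapping is conformal. -/
theorem form_fderiv_squareMap {g : Geom} {q u v : V3} (hq : q ∈ g.surface)
    (hu : u ∈ g.tangent q) (hv : v ∈ g.tangent q) :
    Geom.hyperbolic.form (fderiv ℝ squareMap q u) (fderiv ℝ squareMap q v) =
      g.factor q * g.form u v := by
  have h1 := normSq_stereo_lt_one hq
  obtain ⟨ξ, rfl⟩ := (mem_tangent_iff hq).1 hu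
  obtain ⟨η, rfl⟩ := (mem_tangent_iff hq).1 hv
  have h2 := fderiv_squareMap (g := g) h1
  rw [chart_stereo hq] at h2
  rw [h2, h2, form_chartDeriv _ (normSq_sq_lt_one h1), form_chartDeriv _ h1]
  unfold Geom.factor Geom.scale
  generalize stereo q = ζ at *
  have h3 := (g.one_add_pos h1).ne'
  have h4 := (g.one_sub_pos h1).ne'
  have h5 := g.sign_sq
  have h6 : 1 + Geom.hyperbolic.sign * Complex.normSq (ζ ^ 2) =
      (1 + g.sign * Complex.normSq ζ) * (1 - g.sign * Complex.normSq ζ) := by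
    rw [normSq_sq]
    rw [show Geom.hyperbolic.sign = -1 from rfl]
    linear_combination (Complex.normSq ζ ^ 2) * h5
  have h7 : dot (2 * ζ * ξ) (2 * ζ * η) = 4 * Complex.normSq ζ * dot ξ η := by
    simp [dot, Complex.normSq_apply]
    ring
  rw [h6, h7]
  field_simp

/-! ### Velocities of curves in a surface -/

theorem smul_mem_velocities {C : Set V3} {q v : V3} (h : v ∈ velocities C q) (a : ℝ) :
    a • v ∈ velocities C q := by
  obtain ⟨c, h0, hc, hd⟩ := h
  have h1 : HasDerivAt (fun t : ℝ => a * t) a 0 := by simpa using (hasDerivAt_id (0 : ℝ)).const_mul a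
  refine ⟨fun t => c (a * t), by simpa using h0, ?_, ?_⟩
  · have := h1.continuousAt.eventually (p := fun t => c t ∈ C) (by simpa using hc)
    exact this
  · exact HasDerivAt.scomp (0 : ℝ) (by simpa using hd) h1

theorem hasDerivAt_fst {E F : Type*} [NormedAddCommGroup E] [NormedSpace ℝ E]
    [NormedAddCommGroup F] [NormedSpace ℝ F] {c : ℝ → E × F} {v : E × F} {t : ℝ}
    (h : HasDerivAt c v t) : HasDerivAt (fun s => (c s).1) v.1 t :=
  (ContinuousLinearMap.fst ℝ E F).hasFDerivAt.comp_hasDerivAt t h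

theorem hasDerivAt_snd {E F : Type*} [NormedAddCommGroup E] [NormedSpace ℝ E]
    [NormedAddCommGroup F] [NormedSpace ℝ F] {c : ℝ → E × F} {v : E × F} {t : ℝ}
    (h : HasDerivAt c v t) : HasDerivAt (fun s => (c s).2) v.2 t :=
  (ContinuousLinearMap.snd ℝ E F).hasFDerivAt.comp_hasDerivAt t h

theorem form_hasDerivAt {g : Geom} {c d : ℝ → V3} {v w : V3} {t : ℝ}
    (hc : HasDerivAt c v t) (hd : HasDerivAt d w t) :
    HasDerivAt (fun s => g.form (c s) (d s)) (g.form v (d t) + g.form (c t) w) t := by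
  have c1 : HasDerivAt (fun s => (c s).1) v.1 t := hasDerivAt_fst hc
  have c2 : HasDerivAt (fun s => (c s).2) v.2 t := hasDerivAt_snd hc
  have c3 : HasDerivAt (fun s => (c s).2.1) v.2.1 t := hasDerivAt_fst c2
  have c4 : HasDerivAt (fun s => (c s).2.2) v.2.2 t := hasDerivAt_snd c2
  have d1 : HasDerivAt (fun s => (d s).1) w.1 t := hasDerivAt_fst hd
  have d2 : HasDerivAt (fun s => (d s).2) w.2 t := hasDerivAt_snd hd
  have d3 : HasDerivAt (fun s => (d s).2.1) w.2.1 t := hasDerivAt_fst d2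
  have d4 : HasDerivAt (fun s => (d s).2.2) w.2.2 t := hasDerivAt_snd d2
  unfold Geom.form
  exact (((c1.mul d1).add (c3.mul d3)).add ((c4.mul d4).const_mul g.sign)).congr_deriv (by ring)

theorem form_comm (g : Geom) (u v : V3) : g.form u v = g.form v u := by
  simp only [Geom.form]; ring

theorem form_add (g : Geom) (u v w : V3) : g.form u (v + w) = g.form u v + g.form u w := by
  simp only [Geom.form, Prod.fst_add, Prod.snd_add]; ring

theorem form_smul (g : Geom) (a : ℝ) (u v : V3) : g.form u (a • v) = a * g.form u v := by
  simp only [Geom.form, Prod.smul_fst, Prod.smul_snd, smul_eq_mul]; ring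

theorem smul_form (g : Geom) (a : ℝ) (u v : V3) : g.form (a • u) v = a * g.form u v := by
  rw [form_comm, form_smul, form_comm]

theorem add_mem_tangent {g : Geom} {q u v : V3} (hu : u ∈ g.tangent q) (hv : v ∈ g.tangent q) :
    u + v ∈ g.tangent q := by
  have hu' : g.form q u = 0 := hu
  have hv' : g.form q v = 0 := hv
  simp [Geom.tangent, form_add, hu', hv']

theorem smul_mem_tangent {g : Geom} {q u : V3} (hu : u ∈ g.tangent q) (a : ℝ) :
    a • u ∈ g.tangent q := by
  have hu' : g.form q u = 0 := hu
  simp [Geom.tangent, form_smul, hu']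

theorem sub_mem_tangent {g : Geom} {q u v : V3} (hu : u ∈ g.tangent q) (hv : v ∈ g.tangent q) :
    u - v ∈ g.tangent q := by
  have := add_mem_tangent hu (smul_mem_tangent hv (-1))
  simpa [sub_eq_add_neg] using this

theorem mem_tangent_of_hasDerivAt {g : Geom} {c : ℝ → V3} {v : V3} {t : ℝ}
    (hc : HasDerivAt c v t) (h : ∀ᶠ s in 𝓝 t, c s ∈ g.surface) : v ∈ g.tangent (c t) := by
  have h1 := form_hasDerivAt (g := g) hc hc
  have h2 : (fun s => g.form (c s) (c s)) =ᶠ[𝓝 t] fun _ => g.sign := by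
    filter_upwards [h] with s hs using hs.1
  have h3 := h1.unique ((hasDerivAt_const t g.sign).congr_of_eventuallyEq h2)
  rw [form_comm] at h3
  show g.form (c t) v = 0
  linarith

theorem velocities_subset_tangent {g : Geom} {C : Set V3} (hC : C ⊆ g.surface) (q : V3) :
    velocities C q ⊆ g.tangent q := by
  rintro v ⟨c, rfl, hc, hd⟩
  exact mem_tangent_of_hasDerivAt hd (hc.mono fun _ h => hC h)

theorem velocities_punctured {g : Geom} {q : V3} (hq : q ∈ g.punctured) :
    velocities g.punctured q = g.tangent q := by
  refine Set.Subset.antisymm (velocities_subset_tangent (fun _ h => h.1) q) fun v hv => ?_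
  obtain ⟨ξ, rfl⟩ := (mem_tangent_iff hq.1).1 hv
  have h1 := normSq_stereo_lt_one hq.1
  have h2 := hasDerivAt_line (stereo q) ξ 0
  refine ⟨fun t => g.chart (stereo q + t • ξ), by simpa using chart_stereo hq.1, ?_, ?_⟩
  · have h3 : ∀ᶠ z in 𝓝 (stereo q + (0 : ℝ) • ξ), Complex.normSq z < 1 ∧ z ≠ 0 :=
      (eventually_normSq_lt (by simpa using h1)).and
        (eventually_ne_nhds (by simpa using stereo_ne_zero hq))
    filter_upwards [h2.continuousAt.eventually h3] with t ht
    exact g.chart_mem_punctured ht.1 ht.2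
  · simpa using g.hasDerivAt_chart h2 (by simpa using h1)

theorem fderiv_squareMap_mem_tangent {g : Geom} {q v : V3} (hq : q ∈ g.surface)
    (hv : v ∈ g.tangent q) : fderiv ℝ squareMap q v ∈ Geom.hyperbolic.tangent (squareMap q) := by
  obtain ⟨ξ, rfl⟩ := (mem_tangent_iff hq).1 hv
  have h1 := normSq_stereo_lt_one hq
  have h2 := fderiv_squareMap (g := g) h1 ξ
  rw [chart_stereo hq] at h2
  rw [h2, squareMap_eq]
  exact chartDeriv_mem_tangent _ (normSq_sq_lt_one h1) _

/-! ### Local sections of the square mapping -/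

/-- A local inverse of `z ↦ z²` near `ζ ≠ 0`. -/
theorem exists_sqrt_branch {ζ : ℂ} (h : ζ ≠ 0) :
    ∃ b : ℂ → ℂ, ContDiffAt ℝ ∞ b (ζ ^ 2) ∧ (∀ w, w ≠ 0 → b w ^ 2 = w) ∧
      (∀ᶠ z in 𝓝 ζ, b (z ^ 2) = z) := by
  have hb : ContDiffAt ℝ ∞ (fun w : ℂ => ζ * Complex.exp (Complex.log (w / ζ ^ 2) / 2)) (ζ ^ 2) := by
    have h1 : ContDiffAt ℂ ∞ (fun w : ℂ => w / ζ ^ 2) (ζ ^ 2) := contDiffAt_id.div_const _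
    have h2 : ContDiffAt ℂ ∞ (fun w : ℂ => Complex.log (w / ζ ^ 2)) (ζ ^ 2) :=
      (Complex.contDiffAt_log (by simp [h])).comp _ h1
    exact ((contDiffAt_const.mul (h2.div_const 2).cexp)).restrict_scalars ℝ
  have hsq : ∀ w : ℂ, w ≠ 0 → (ζ * Complex.exp (Complex.log (w / ζ ^ 2) / 2)) ^ 2 = w := by
    intro w hw
    rw [mul_pow, ← Complex.exp_nat_mul, show ((2 : ℕ) : ℂ) * (Complex.log (w / ζ ^ 2) / 2) =
      Complex.log (w / ζ ^ 2) by push_cast; ring, Complex.exp_log (by positivity)]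
    field_simp
  refine ⟨_, hb, hsq, ?_⟩
  have hcont : ContinuousAt (fun z : ℂ => ζ * Complex.exp (Complex.log (z ^ 2 / ζ ^ 2) / 2) + z) ζ :=
    (ContinuousAt.comp (g := fun w : ℂ => ζ * Complex.exp (Complex.log (w / ζ ^ 2) / 2))
      (f := fun z : ℂ => z ^ 2) hb.continuousAt
      (continuous_pow 2).continuousAt).add continuousAt_id
  -- the other root `-z` is excluded by continuity, since the sum is `2ζ ≠ 0` at `ζ`
  have hne : ζ * Complex.exp (Complex.log (ζ ^ 2 / ζ ^ 2) / 2) + ζ ≠ 0 := by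
    rw [div_self (pow_ne_zero 2 h)]
    simpa [← two_mul] using h
  filter_upwards [hcont.eventually_ne hne, eventually_ne_nhds h] with z hz hz0
  rcases sq_eq_sq_iff_eq_or_eq_neg.1 (hsq _ (pow_ne_zero 2 hz0)) with h1 | h1
  · exact h1
  · exact absurd (by rw [h1]; ring) hz

/-- `ψ` is a smooth local section of the square mapping near `squareMap q` which maps
`squareMap q` to `q`. -/
structure IsSection (g : Geom) (q : V3) (ψ : V3 → V3) : Prop where
  contDiffAt : ContDiffAt ℝ ∞ ψ (squareMap q)
  apply_eq : ψ (squareMap q) = q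
  right_inv : ∀ᶠ Q in 𝓝 (squareMap q), Q ∈ Geom.hyperbolic.punctured →
    ψ Q ∈ g.punctured ∧ squareMap (ψ Q) = Q
  left_inv : ∀ᶠ q' in 𝓝 q, q' ∈ g.punctured → ψ (squareMap q') = q'

theorem exists_isSection {g : Geom} {q : V3} (hq : q ∈ g.punctured) : ∃ ψ, IsSection g q ψ := by
  have h1 := normSq_stereo_lt_one hq.1
  have h0 := stereo_ne_zero hq
  obtain ⟨b, hb, hb2, hb3⟩ := exists_sqrt_branch h0
  have hst : ContDiffAt ℝ ∞ stereo (squareMap q) :=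
    contDiffAt_stereo_of_mem (squareMap_mem_surface hq.1)
  have hbs : ContDiffAt ℝ ∞ (fun Q => b (stereo Q)) (squareMap q) :=
    ContDiffAt.comp _ (by rwa [stereo_squareMap hq.1]) hst
  have hbq : b (stereo (squareMap q)) = stereo q := by
    rw [stereo_squareMap hq.1, hb3.self_of_nhds]
  refine ⟨fun Q => g.chart (b (stereo Q)), ?_, ?_, ?_, ?_⟩
  · exact ContDiffAt.comp (g := g.chart) _ (by rw [hbq]; exact g.contDiffAt_chart h1) hbs
  · simp only [hbq, chart_stereo hq.1]
  · refine Filter.Eventually.of_forall fun Q hQ => ?_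
    have hw := stereo_ne_zero hQ
    have hb4 := hb2 _ hw
    have hlt : Complex.normSq (b (stereo Q)) < 1 := by
      have h5 := normSq_stereo_lt_one hQ.1
      rw [← hb4, normSq_sq] at h5
      by_contra hcon
      exact absurd h5 (not_lt.2 (one_le_pow₀ (not_lt.1 hcon)))
    refine ⟨g.chart_mem_punctured hlt ?_, ?_⟩
    · intro h
      rw [h] at hb4
      exact hw (by rw [← hb4]; simp)
    · rw [squareMap_chart hlt, hb4, chart_stereo hQ.1]
  · filter_upwards [(differentiableAt_stereo hq.1).continuousAt.eventually hb3] with q' hq' hmem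
    rw [stereo_squareMap hmem.1, hq', chart_stereo hmem.1]

namespace IsSection

variable {g : Geom} {q : V3} {ψ : V3 → V3}

theorem differentiableAt (h : IsSection g q ψ) : DifferentiableAt ℝ ψ (squareMap q) :=
  h.contDiffAt.differentiableAt (by simp)

/-- On tangent vectors, the differentials of the square mapping and of a section are inverse to
each other, not only at the base point but near it. -/
theorem eventually_fderiv (h : IsSection g q ψ) :
    ∀ᶠ Q in 𝓝 (squareMap q), Q ∈ Geom.hyperbolic.punctured →
      ∀ V ∈ Geom.hyperbolic.tangent Q, fderiv ℝ ψ Q V ∈ g.tangent (ψ Q) ∧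
        fderiv ℝ squareMap (ψ Q) (fderiv ℝ ψ Q V) = V := by
  have h1 : ∀ᶠ Q in 𝓝 (squareMap q), ContDiffAt ℝ 1 ψ Q :=
    (h.contDiffAt.of_le (by norm_cast)).eventually (by simp)
  filter_upwards [h1, h.right_inv.eventually_nhds] with Q hQ1 hQ2 hQ V hV
  rw [← velocities_punctured hQ] at hV
  obtain ⟨c, rfl, hc, hd⟩ := hV
  have h2 := hasDerivAt_comp_curve (hQ1.differentiableAt (by simp)) hd
  have h3 : ∀ᶠ t in 𝓝 (0 : ℝ), ψ (c t) ∈ g.punctured ∧ squareMap (ψ (c t)) = c t := by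
    filter_upwards [hc, hd.continuousAt.eventually hQ2] with t ht1 ht2 using ht2 ht1
  have h4 := hasDerivAt_squareMap_comp (g := g) h3.self_of_nhds.1.1 h2
  exact ⟨mem_tangent_of_hasDerivAt h2 (h3.mono fun _ h => h.1.1),
    h4.unique (hd.congr_of_eventuallyEq (h3.mono fun _ h => h.2))⟩

theorem fderiv_left_inv (h : IsSection g q ψ) (hq : q ∈ g.punctured) {v : V3}
    (hv : v ∈ g.tangent q) : fderiv ℝ ψ (squareMap q) (fderiv ℝ squareMap q v) = v := by
  rw [← velocities_punctured hq] at hv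
  obtain ⟨c, h0, hc, hd⟩ := hv
  have hd' := hasDerivAt_squareMap_comp (g := g) (by rw [h0]; exact hq.1) hd
  rw [h0] at hd'
  have h2 : HasDerivAt (fun t => ψ (squareMap (c t))) _ 0 :=
    hasDerivAt_comp_curve (by rw [h0]; exact h.differentiableAt) hd'
  rw [h0] at h2
  refine h2.unique (hd.congr_of_eventuallyEq ?_)
  filter_upwards [hc, hd.continuousAt.eventually (by rw [h0]; exact h.left_inv)] with t h1 h2
    using h2 h1

end IsSection

theorem fderiv_squareMap_injOn {g : Geom} {q : V3} (hq : q ∈ g.punctured) :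
    Set.InjOn (fderiv ℝ squareMap q) (g.tangent q) := by
  obtain ⟨ψ, hψ⟩ := exists_isSection hq
  intro u hu v hv h
  rw [← hψ.fderiv_left_inv hq hu, h, hψ.fderiv_left_inv hq hv]

theorem fderiv_squareMap_surjOn {g : Geom} {q : V3} (hq : q ∈ g.punctured) :
    Set.SurjOn (fderiv ℝ squareMap q) (g.tangent q) (Geom.hyperbolic.tangent (squareMap q)) := by
  obtain ⟨ψ, hψ⟩ := exists_isSection hq
  intro V hV
  have := hψ.eventually_fderiv.self_of_nhds (squareMap_mem_punctured hq) V hV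
  rw [hψ.apply_eq] at this
  exact ⟨_, this⟩

theorem squareMap_surjOn (g : Geom) :
    Set.SurjOn squareMap g.punctured Geom.hyperbolic.punctured := by
  intro Q hQ
  obtain ⟨ζ, hζ⟩ := IsAlgClosed.exists_pow_nat_eq (stereo Q) two_pos
  have h1 := normSq_stereo_lt_one hQ.1
  have h0 := stereo_ne_zero hQ
  rw [← hζ] at h1 h0
  have hlt : Complex.normSq ζ < 1 := by
    rw [normSq_sq] at h1
    by_contra hcon
    exact absurd h1 (not_lt.2 (one_le_pow₀ (not_lt.1 hcon)))
  refine ⟨g.chart ζ, g.chart_mem_punctured hlt fun h => h0 (by simp [h]), ?_⟩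
  rw [squareMap_chart hlt, hζ, chart_stereo hQ.1]

/-! ### Correspondence of the laws of reflection -/

theorem fderiv_mem_velocities {g : Geom} {C : Set V3} {q v : V3} (hq : q ∈ g.surface)
    (hv : v ∈ velocities (g.punctured ∩ squareMap ⁻¹' C) q) :
    fderiv ℝ squareMap q v ∈ velocities C (squareMap q) := by
  obtain ⟨c, rfl, hc, hd⟩ := hv
  exact ⟨fun t => squareMap (c t), rfl, hc.mono fun t ht => ht.2, hasDerivAt_squareMap_comp hq hd⟩

theorem exists_velocities_lift {g : Geom} {C : Set V3} (hC : C ⊆ Geom.hyperbolic.punctured)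
    {q V : V3} (hq : q ∈ g.punctured) (hV : V ∈ velocities C (squareMap q)) :
    ∃ v ∈ velocities (g.punctured ∩ squareMap ⁻¹' C) q, fderiv ℝ squareMap q v = V := by
  obtain ⟨ψ, hψ⟩ := exists_isSection hq
  have h1 := hψ.eventually_fderiv.self_of_nhds (squareMap_mem_punctured hq) V
    (velocities_subset_tangent (fun _ h => (hC h).1) _ hV)
  obtain ⟨c, h0, hc, hd⟩ := hV
  rw [hψ.apply_eq] at h1
  refine ⟨_, ⟨fun t => ψ (c t), by simp only [h0, hψ.apply_eq], ?_, ?_⟩, h1.2⟩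
  · filter_upwards [hc, hd.continuousAt.eventually (by rw [h0]; exact hψ.right_inv)] with t h1 h2
    have h3 := h2 (hC h1)
    exact ⟨h3.1, by simpa [h3.2] using h1⟩
  · rw [← h0]
    exact hasDerivAt_comp_curve (by rw [h0]; exact hψ.differentiableAt) hd

/-- The tangent spaces of a curve and of its preimage correspond, and orthogonality is kept since
the square mapping is conformal. -/
theorem reflects_squareMap_iff {g : Geom} {C : Set V3} (hC : C ⊆ Geom.hyperbolic.punctured)
    {q v w : V3} (hq : q ∈ g.punctured) (hv : v ∈ g.tangent q) (hw : w ∈ g.tangent q) :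
    g.Reflects (g.punctured ∩ squareMap ⁻¹' C) q v w ↔
      Geom.hyperbolic.Reflects C (squareMap q) (fderiv ℝ squareMap q v)
        (fderiv ℝ squareMap q w) := by
  have hsub : velocities (g.punctured ∩ squareMap ⁻¹' C) q ⊆ g.tangent q :=
    velocities_subset_tangent (fun _ h => h.1.1) q
  have hl := (Geom.factor_pos hq).ne'
  constructor
  · rintro ⟨s, hs, n, hn, horth, rfl, rfl⟩
    refine ⟨_, fderiv_mem_velocities hq.1 hs, _, fderiv_squareMap_mem_tangent hq.1 hn, ?_,
      map_add _ _ _, map_sub _ _ _⟩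
    intro U hU
    obtain ⟨u, hu, rfl⟩ := exists_velocities_lift hC hq hU
    rw [form_fderiv_squareMap hq.1 hn (hsub hu), horth u hu, mul_zero]
  · rintro ⟨s', hs', n', hn', horth, h1, h2⟩
    obtain ⟨s, hs, rfl⟩ := exists_velocities_lift hC hq hs'
    obtain ⟨n, hn, rfl⟩ := fderiv_squareMap_surjOn hq hn'
    have hs2 := hsub hs
    refine ⟨s, hs, n, hn, ?_, ?_, ?_⟩
    · intro u hu
      have h3 := horth _ (fderiv_mem_velocities hq.1 hu)
      rw [form_fderiv_squareMap hq.1 hn (hsub hu)] at h3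
      exact (mul_eq_zero.1 h3).resolve_left hl
    · exact fderiv_squareMap_injOn hq hv (add_mem_tangent hs2 hn) (by rw [h1, map_add])
    · exact fderiv_squareMap_injOn hq hw (sub_mem_tangent hs2 hn) (by rw [h2, map_sub])

theorem Geom.Reflects.smul {g : Geom} {C : Set V3} {q v w : V3} (h : g.Reflects C q v w) (a : ℝ) :
    g.Reflects C q (a • v) (a • w) := by
  obtain ⟨s, hs, n, hn, horth, rfl, rfl⟩ := h
  refine ⟨a • s, smul_mem_velocities hs a, a • n, smul_mem_tangent hn a, fun u hu => ?_,
    smul_add _ _ _, smul_sub _ _ _⟩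
  rw [smul_form, horth u hu, mul_zero]

/-! ### The force functions on the surfaces -/

theorem height_lt_neg_one {q : V3} (hq : q ∈ Geom.hyperbolic.punctured) : q.2.2 < -1 := by
  obtain ⟨⟨h1, h2⟩, h3⟩ := hq
  simp only [Geom.form, Geom.sign] at h1
  by_contra hcon
  have h4 : q.2.2 ^ 2 ≤ 1 := by nlinarith
  have h5 : q.1 = 0 := by nlinarith [sq_nonneg q.1, sq_nonneg q.2.1]
  have h6 : q.2.1 = 0 := by nlinarith [sq_nonneg q.1, sq_nonneg q.2.1]
  have h7 : q.2.2 = -1 := by nlinarith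
  exact h3 (Prod.ext h5 (Prod.ext h6 h7))

theorem neg_one_lt_height {q : V3} (hq : q ∈ Geom.spherical.punctured) : -1 < q.2.2 := by
  obtain ⟨⟨h1, h2⟩, h3⟩ := hq
  simp only [Geom.form, Geom.sign] at h1
  by_contra hcon
  have h4 : 1 ≤ q.2.2 ^ 2 := by nlinarith
  have h5 : q.1 = 0 := by nlinarith [sq_nonneg q.1, sq_nonneg q.2.1]
  have h6 : q.2.1 = 0 := by nlinarith [sq_nonneg q.1, sq_nonneg q.2.1]
  have h7 : q.2.2 = -1 := by nlinarith
  exact h3 (Prod.ext h5 (Prod.ext h6 h7))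

theorem spherical_angle_southPole (q : V3) :
    Geom.spherical.angle q southPole = Real.arccos (-q.2.2 / √(Geom.spherical.form q q)) := by
  simp [Geom.angle, Geom.form, southPole, Geom.sign]

theorem hyperbolic_angle_southPole (q : V3) :
    Geom.hyperbolic.angle q southPole =
      Real.arcosh (-q.2.2 / √(-Geom.hyperbolic.form q q)) := by
  simp [Geom.angle, Geom.form, southPole, Geom.sign]

theorem contDiff_form_self (g : Geom) : ContDiff ℝ ∞ fun q : V3 => g.form q q := by
  unfold Geom.form
  fun_prop

theorem differentiableAt_spherical_arg {q : V3} (hq : q ∈ Geom.spherical.surface) :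
    DifferentiableAt ℝ (fun q : V3 => -q.2.2 / √(Geom.spherical.form q q)) q := by
  have h1 : Geom.spherical.form q q = 1 := hq.1
  have h2 := (contDiff_form_self Geom.spherical).contDiffAt (x := q)
  have h3 := h2.differentiableAt (by simp)
  simp only [div_eq_mul_inv]
  exact (differentiableAt_snd.snd.fun_neg).fun_mul ((h3.sqrt (by simp [h1])).fun_inv (by simp [h1]))

theorem differentiableAt_hyperbolic_arg {q : V3} (hq : q ∈ Geom.hyperbolic.surface) :
    DifferentiableAt ℝ (fun q : V3 => -q.2.2 / √(-Geom.hyperbolic.form q q)) q := by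
  have h1 : Geom.hyperbolic.form q q = -1 := hq.1
  have h2 := (contDiff_form_self Geom.hyperbolic).contDiffAt (x := q)
  have h3 := (h2.differentiableAt (by simp)).fun_neg
  simp only [div_eq_mul_inv]
  exact (differentiableAt_snd.snd.fun_neg).fun_mul ((h3.sqrt (by simp [h1])).fun_inv (by simp [h1]))

theorem differentiableAt_hyperbolic_angle {q : V3} (hq : q ∈ Geom.hyperbolic.punctured) :
    DifferentiableAt ℝ (fun q => Geom.hyperbolic.angle q southPole) q := by
  have h1 : Geom.hyperbolic.form q q = -1 := hq.1.1
  simp only [hyperbolic_angle_southPole]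
  refine DifferentiableAt.comp (g := Real.arcosh) q (Real.differentiableAt_arcosh ?_)
    (differentiableAt_hyperbolic_arg hq.1)
  have := height_lt_neg_one hq
  simp only [h1, neg_neg, Real.sqrt_one, div_one, Set.mem_Ioi]
  linarith

theorem differentiableAt_spherical_angle {q : V3} (hq : q ∈ Geom.spherical.punctured) :
    DifferentiableAt ℝ (fun q => Geom.spherical.angle q southPole) q := by
  have h1 : Geom.spherical.form q q = 1 := hq.1.1
  have h2 := neg_one_lt_height hq
  have h3 := hq.1.2
  simp only [spherical_angle_southPole]
  refine DifferentiableAt.comp (g := Real.arccos) q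
    (Real.differentiableAt_arccos.2 ⟨?_, ?_⟩) (differentiableAt_spherical_arg hq.1) <;>
  simp only [h1, Real.sqrt_one, div_one] <;> intro h <;> linarith

theorem hyperbolic_angle_of_mem {q : V3} (hq : q ∈ Geom.hyperbolic.surface) :
    Geom.hyperbolic.angle q southPole = Real.arcosh (-q.2.2) := by
  have h1 : Geom.hyperbolic.form q q = -1 := hq.1
  simp [hyperbolic_angle_southPole, h1]

theorem spherical_angle_of_mem {q : V3} (hq : q ∈ Geom.spherical.surface) :
    Geom.spherical.angle q southPole = Real.arccos (-q.2.2) := by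
  have h1 : Geom.spherical.form q q = 1 := hq.1
  simp [spherical_angle_southPole, h1]

theorem hookeForce_eq (g : Geom) (f : ℝ) {q : V3} (hq : q ∈ g.punctured) :
    hookeForce g f q = f * g.factor q := by
  have h1 := sign_mul_normSq_stereo hq.1
  have h2 := one_sub_height_pos hq.1
  have h3 := hq.1.2
  cases g
  · simp only [Geom.sign, one_mul] at h1
    have h4 := neg_one_lt_height hq
    have h5 : (0 : ℝ) ≤ 1 - (-q.2.2) ^ 2 := by nlinarith
    simp only [hookeForce, Geom.factor, spherical_angle_of_mem hq.1, Real.tan_arccos, Geom.sign,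
      one_mul, h1, div_pow, Real.sq_sqrt h5]
    have h6 : 1 - (1 + q.2.2) / (1 - q.2.2) = -2 * q.2.2 / (1 - q.2.2) := by
      field_simp; ring
    rw [h6]
    have h7 := h3.ne
    field_simp
    ring
  · simp only [Geom.sign, neg_mul, one_mul, neg_eq_iff_eq_neg] at h1
    have h4 := height_lt_neg_one hq
    have h5 : (0 : ℝ) ≤ (-q.2.2) ^ 2 - 1 := by nlinarith
    simp only [hookeForce, Geom.factor, hyperbolic_angle_of_mem hq.1,
      Real.tanh_arcosh (show 1 ≤ -q.2.2 by linarith), Geom.sign,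
      one_mul, neg_mul, h1, div_pow, Real.sq_sqrt h5]
    have h6 : 1 - - -((1 + q.2.2) / (1 - q.2.2)) = -2 * q.2.2 / (1 - q.2.2) := by
      field_simp; ring
    rw [h6]
    have h7 := h3.ne
    field_simp
    ring

theorem keplerForce_eq (m : ℝ) {q : V3} (hq : q ∈ Geom.hyperbolic.punctured) :
    keplerForce m q = m * ((1 + Complex.normSq (stereo q)) / (2 * ‖stereo q‖)) := by
  have h1 := sign_mul_normSq_stereo hq.1
  have h2 := one_sub_height_pos hq.1
  simp only [Geom.sign, neg_mul, one_mul, neg_eq_iff_eq_neg] at h1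
  have h4 := height_lt_neg_one hq
  have h5 : (0 : ℝ) < (-q.2.2) ^ 2 - 1 := by nlinarith
  have h6 : ‖stereo q‖ = √((-q.2.2) ^ 2 - 1) / (1 - q.2.2) := by
    have h7 : ‖stereo q‖ ^ 2 = (√((-q.2.2) ^ 2 - 1) / (1 - q.2.2)) ^ 2 := by
      rw [← Complex.normSq_eq_norm_sq, h1, div_pow, Real.sq_sqrt h5.le]
      field_simp
      ring
    exact (pow_left_inj₀ (norm_nonneg _) (by positivity) two_ne_zero).1 h7
  have h8 := Real.sqrt_pos.2 h5
  rw [keplerForce, hyperbolic_angle_of_mem hq.1, Real.cosh_arcosh (by linarith),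
    Real.sinh_arcosh (by linarith), h6, h1]
  field_simp
  ring

theorem differentiableAt_hookeForce (g : Geom) (f : ℝ) {q : V3} (hq : q ∈ g.punctured) :
    DifferentiableAt ℝ (hookeForce g f) q := by
  have h3 := hq.1.2
  cases g
  · have h4 := neg_one_lt_height hq
    unfold hookeForce
    refine (DifferentiableAt.pow (DifferentiableAt.comp (g := Real.tan) q
      (Real.differentiableAt_tan.2 ?_) (differentiableAt_spherical_angle hq)) 2).const_mul f
    rw [spherical_angle_of_mem hq.1, Real.cos_arccos (by linarith) (by linarith)]
    linarith
  · unfold hookeForce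
    refine (DifferentiableAt.pow (DifferentiableAt.comp (g := Real.tanh) q
      ?_ (differentiableAt_hyperbolic_angle hq)) 2).const_mul f
    rw [show Real.tanh = fun x => Real.sinh x / Real.cosh x from
      funext fun x => Real.tanh_eq_sinh_div_cosh x]
    exact Real.differentiable_sinh.differentiableAt.div Real.differentiable_cosh.differentiableAt
      (Real.cosh_pos _).ne'

theorem differentiableAt_keplerForce (m : ℝ) {q : V3} (hq : q ∈ Geom.hyperbolic.punctured) :
    DifferentiableAt ℝ (keplerForce m) q := by
  have h1 := differentiableAt_hyperbolic_angle hq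
  have h4 := height_lt_neg_one hq
  unfold keplerForce
  simp only [div_eq_mul_inv]
  refine DifferentiableAt.const_mul (DifferentiableAt.fun_mul
    (Real.differentiable_cosh.differentiableAt.comp q h1)
    (DifferentiableAt.fun_inv (Real.differentiable_sinh.differentiableAt.comp q h1) ?_)) m
  rw [Function.comp_apply, Real.sinh_ne_zero, hyperbolic_angle_of_mem hq.1]
  exact (Real.arcosh_pos (by linarith)).ne'

/-- The derivative of a function along the surface, computed in the chart. -/
theorem fderiv_chartDeriv_eq {g : Geom} {U : V3 → ℝ} {V : ℂ → ℝ} {ζ η : ℂ} {a : ℝ}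
    (h : Complex.normSq ζ < 1) (h0 : ζ ≠ 0) (hU : DifferentiableAt ℝ U (g.chart ζ))
    (hUV : ∀ q ∈ g.punctured, U q = V (stereo q))
    (hV : HasDerivAt (fun t : ℝ => V (ζ + t • η)) a 0) :
    fderiv ℝ U (g.chart ζ) (g.chartDeriv ζ η) = a := by
  have h1 := hasDerivAt_line ζ η 0
  have h2 : ζ + (0 : ℝ) • η = ζ := by simp
  have h3 := g.hasDerivAt_chart h1 (by rwa [h2])
  have h4 := hasDerivAt_comp_curve (f := U) (by rwa [h2]) h3
  rw [h2] at h4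
  refine h4.unique (hV.congr_of_eventuallyEq ?_)
  have h5 : ∀ᶠ z in 𝓝 (ζ + (0 : ℝ) • η), Complex.normSq z < 1 ∧ z ≠ 0 := by
    rw [h2]; exact (eventually_normSq_lt h).and (eventually_ne_nhds h0)
  filter_upwards [h1.continuousAt.eventually h5] with t ht
  rw [hUV _ (g.chart_mem_punctured ht.1 ht.2), stereo_chart g ht.1]

/-- The radial coefficient of the gradient of the Hooke force function in the chart. -/
def Geom.hookeCoeff (g : Geom) (f : ℝ) (ζ : ℂ) : ℝ :=
  8 * f * (1 + g.sign * Complex.normSq ζ) / (1 - g.sign * Complex.normSq ζ) ^ 3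

/-- The radial coefficient of the gradient of the Kepler force function in the chart. -/
def keplerCoeff (m : ℝ) (ζ : ℂ) : ℝ := -m * (1 - Complex.normSq ζ) / (2 * ‖ζ‖ ^ 3)

theorem fderiv_hookeForce (g : Geom) (f : ℝ) {ζ : ℂ} (h : Complex.normSq ζ < 1) (h0 : ζ ≠ 0)
    (η : ℂ) : fderiv ℝ (hookeForce g f) (g.chart ζ) (g.chartDeriv ζ η) =
      g.hookeCoeff f ζ * dot ζ η := by
  have h1 := hasDerivAt_normSq (hasDerivAt_line ζ η 0)
  have h2 : ζ + (0 : ℝ) • η = ζ := by simp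
  have h3 := (g.one_sub_pos h).ne'
  refine fderiv_chartDeriv_eq (V := fun z => f * (4 * Complex.normSq z /
    (1 - g.sign * Complex.normSq z) ^ 2)) h h0
    (differentiableAt_hookeForce g f (g.chart_mem_punctured h h0))
    (fun q hq => hookeForce_eq g f hq) ?_
  refine (((h1.const_mul 4).div (((h1.const_mul g.sign).const_sub 1).pow 2)
    (by simpa only [Pi.pow_apply, h2] using pow_ne_zero 2 h3)).const_mul f).congr_deriv ?_
  simp only [Pi.pow_apply, h2, Geom.hookeCoeff]
  field_simp
  push_cast
  ring

theorem fderiv_keplerForce (m : ℝ) {ζ : ℂ} (h : Complex.normSq ζ < 1) (h0 : ζ ≠ 0)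
    (η : ℂ) : fderiv ℝ (keplerForce m) (Geom.hyperbolic.chart ζ)
      (Geom.hyperbolic.chartDeriv ζ η) = keplerCoeff m ζ * dot ζ η := by
  have h1 := hasDerivAt_normSq (hasDerivAt_line ζ η 0)
  have h2 : ζ + (0 : ℝ) • η = ζ := by simp
  have h3 := norm_pos_iff.2 h0
  have h4 : HasDerivAt (fun t : ℝ => ‖ζ + t • η‖) (dot ζ η / ‖ζ‖) 0 := by
    have h5 := h1.sqrt (by rw [h2]; exact (Complex.normSq_pos.2 h0).ne')
    rw [h2] at h5
    simp only [Complex.norm_def]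
    convert h5 using 1
    field_simp
  refine fderiv_chartDeriv_eq (V := fun z => m * ((1 + Complex.normSq z) / (2 * ‖z‖))) h h0
    (differentiableAt_keplerForce m (Geom.chart_mem_punctured _ h h0))
    (fun q hq => keplerForce_eq m hq) ?_
  refine (((h1.const_add 1).div (h4.const_mul 2) (by
    rw [h2]; positivity)).const_mul m).congr_deriv ?_
  simp only [h2, keplerCoeff, Complex.normSq_eq_norm_sq]
  field_simp
  ring

/-! ### The equation of motion in the chart -/

/-- The equation of motion in the chart of the curve `z`, for a radial force function whose
gradient in the plane at `ζ` is `c ζ • ζ`. -/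
def Geom.ChartNewtonAt (g : Geom) (c : ℂ → ℝ) (z : ℝ → ℂ) (t : ℝ) : Prop :=
  (∀ᶠ s in 𝓝 t, DifferentiableAt ℝ z s) ∧ DifferentiableAt ℝ (deriv z) t ∧
    (g.scale (z t) ^ 2 : ℂ) * (deriv (deriv z) t -
      g.sign * g.scale (z t) * (starRingEnd ℂ (z t) * deriv z t ^ 2)) = c (z t) * z t

theorem hasDerivAt_dot {z w : ℝ → ℂ} {z' w' : ℂ} {t : ℝ} (hz : HasDerivAt z z' t)
    (hw : HasDerivAt w w' t) :
    HasDerivAt (fun t => dot (z t) (w t)) (dot z' (w t) + dot (z t) w') t := by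
  unfold dot
  exact (((hasDerivAt_re hz).mul (hasDerivAt_re hw)).add
    ((hasDerivAt_im hz).mul (hasDerivAt_im hw))).congr_deriv (by ring)

/-- The second derivative of a curve in the surface, paired with a tangent vector, is the
covariant derivative of the curve in the chart. -/
theorem exists_hasDerivAt_chartDeriv (g : Geom) {z p : ℝ → ℂ} {a : ℂ} {t : ℝ}
    (h : Complex.normSq (z t) < 1) (hz : HasDerivAt z (p t) t) (hp : HasDerivAt p a t) :
    ∃ A : V3, HasDerivAt (fun s => g.chartDeriv (z s) (p s)) A t ∧
      ∀ η, g.form A (g.chartDeriv (z t) η) = g.scale (z t) ^ 2 *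
        dot (a - g.sign * g.scale (z t) * (starRingEnd ℂ (z t) * p t ^ 2)) η := by
  have hs := g.hasDerivAt_scale hz h
  have hT := ((hs.pow 2).const_mul g.sign).mul (hasDerivAt_dot hz hp)
  refine ⟨_, (((hs.mul (hasDerivAt_re hp)).sub (hT.mul (hasDerivAt_re hz))).prodMk
    (((hs.mul (hasDerivAt_im hp)).sub (hT.mul (hasDerivAt_im hz))).prodMk hT)), fun η => ?_⟩
  have h1 := (g.one_add_pos h).ne'
  have h2 : g.scale (z t) * (1 + g.sign * dot (z t) (z t)) = 2 := by
    rw [← normSq_eq_dot]; unfold Geom.scale; field_simp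
  have h3 := g.sign_mul_self
  simp only [Geom.form, Geom.chartDeriv, Pi.mul_apply, Pi.pow_apply]
  generalize g.scale (z t) = s at *
  generalize g.sign = e at *
  generalize z t = z at *
  generalize p t = p at *
  simp only [dot, Complex.sub_re, Complex.sub_im, Complex.mul_re, Complex.mul_im,
    Complex.ofReal_re, Complex.ofReal_im, Complex.conj_re, Complex.conj_im, pow_two] at *
  linear_combination (e * (2 * s * (-e * s ^ 2 * (z.re * p.re + z.im * p.im)) *
    (z.re * p.re + z.im * p.im) + s ^ 2 * (p.re * p.re + p.im * p.im + (z.re * a.re + z.im * a.im)))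
    * s * (z.re * η.re + z.im * η.im)) * (h2 + s * h3)

theorem dot_ext {a b : ℂ} (h : ∀ η, dot a η = dot b η) : a = b := by
  have h1 := h 1
  have h2 := h Complex.I
  simp only [dot, Complex.one_re, Complex.one_im, Complex.I_re, Complex.I_im] at h1 h2
  apply Complex.ext <;> linarith

theorem ofReal_mul_dot (r : ℝ) (a η : ℂ) : dot (r * a) η = r * dot a η := by
  simp only [dot, Complex.re_ofReal_mul, Complex.im_ofReal_mul]; ring

theorem Geom.eventually_eq_chart {g : Geom} {γ : ℝ → V3} {t : ℝ}
    (hγ : ∀ᶠ s in 𝓝 t, γ s ∈ g.surface) : γ =ᶠ[𝓝 t] fun s => g.chart (stereo (γ s)) :=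
  hγ.mono fun _ hs => (chart_stereo hs).symm

/-- The velocity of a curve in the surface, from its velocity in the chart. -/
theorem deriv_eq_chartDeriv {g : Geom} {γ : ℝ → V3} {t : ℝ}
    (hγ : ∀ᶠ s in 𝓝 t, γ s ∈ g.surface) (h : DifferentiableAt ℝ (fun s => stereo (γ s)) t) :
    HasDerivAt γ (g.chartDeriv (stereo (γ t)) (deriv (fun s => stereo (γ s)) t)) t :=
  (g.hasDerivAt_chart h.hasDerivAt (normSq_stereo_lt_one hγ.self_of_nhds)).congr_of_eventuallyEq
    (Geom.eventually_eq_chart hγ)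

theorem newtonAt_iff {S : Billiard} {c : ℂ → ℝ} {γ : ℝ → V3} {t : ℝ}
    (hγ : ∀ᶠ s in 𝓝 t, γ s ∈ S.geom.surface)
    (hc : ∀ η, fderiv ℝ S.force (γ t) (S.geom.chartDeriv (stereo (γ t)) η) =
      c (stereo (γ t)) * dot (stereo (γ t)) η) :
    S.NewtonAt γ t ↔ S.geom.ChartNewtonAt c (fun s => stereo (γ s)) t := by
  have hγt := hγ.self_of_nhds
  have hlt := normSq_stereo_lt_one hγt
  have main : (∀ᶠ s in 𝓝 t, DifferentiableAt ℝ (fun s => stereo (γ s)) s) →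
      DifferentiableAt ℝ (deriv fun s => stereo (γ s)) t →
      DifferentiableAt ℝ (deriv γ) t ∧ ∀ η, S.geom.form (deriv (deriv γ) t)
        (S.geom.chartDeriv (stereo (γ t)) η) = S.geom.scale (stereo (γ t)) ^ 2 *
          dot (deriv (deriv fun s => stereo (γ s)) t - S.geom.sign * S.geom.scale (stereo (γ t)) *
            (starRingEnd ℂ (stereo (γ t)) * deriv (fun s => stereo (γ s)) t ^ 2)) η := by
    intro h1 h2
    have h3 : deriv γ =ᶠ[𝓝 t] fun s => S.geom.chartDeriv (stereo (γ s))
        (deriv (fun s => stereo (γ s)) s) := by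
      filter_upwards [h1, hγ.eventually_nhds] with s hs1 hs2
      exact (deriv_eq_chartDeriv hs2 hs1).deriv
    obtain ⟨A, hA, hA2⟩ := exists_hasDerivAt_chartDeriv S.geom (z := fun s => stereo (γ s))
      (p := deriv fun s => stereo (γ s)) hlt h1.self_of_nhds.hasDerivAt h2.hasDerivAt
    have h4 := hA.congr_of_eventuallyEq h3
    exact ⟨h4.differentiableAt, fun η => by rw [h4.deriv, hA2]⟩
  constructor
  · rintro ⟨h1, h2, h3⟩
    have h4 : ∀ᶠ s in 𝓝 t, DifferentiableAt ℝ (fun s => stereo (γ s)) s := by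
      filter_upwards [h1, hγ] with s hs1 hs2
      exact (hasDerivAt_comp_curve (differentiableAt_stereo hs2) hs1.hasDerivAt).differentiableAt
    have h5 : deriv (fun s => stereo (γ s)) =ᶠ[𝓝 t]
        fun s => fderiv ℝ stereo (γ s) (deriv γ s) := by
      filter_upwards [h1, hγ] with s hs1 hs2
      exact (hasDerivAt_comp_curve (differentiableAt_stereo hs2) hs1.hasDerivAt).deriv
    have h6 : DifferentiableAt ℝ (deriv fun s => stereo (γ s)) t := by
      refine DifferentiableAt.congr_of_eventuallyEq ?_ h5
      have h7 : DifferentiableAt ℝ (fderiv ℝ stereo) (γ t) :=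
        ((contDiffAt_stereo_of_mem hγt).fderiv_right (m := 1) (by norm_cast)).differentiableAt
          (by simp)
      exact (h7.comp t h1.self_of_nhds).clm_apply h2
    refine ⟨h4, h6, dot_ext fun η => ?_⟩
    have h7 := (main h4 h6).2 η
    rw [h3 _ ((mem_tangent_iff hγt).2 ⟨η, rfl⟩), hc] at h7
    rw [ofReal_mul_dot, h7, ← Complex.ofReal_pow, ofReal_mul_dot]
  · rintro ⟨h1, h2, h3⟩
    refine ⟨?_, (main h1 h2).1, fun u hu => ?_⟩
    · filter_upwards [h1, hγ.eventually_nhds] with s hs1 hs2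
      exact (deriv_eq_chartDeriv hs2 hs1).differentiableAt
    · obtain ⟨η, rfl⟩ := (mem_tangent_iff hγt).1 hu
      rw [(main h1 h2).2, hc, ← ofReal_mul_dot, ← ofReal_mul_dot, ← h3, ← Complex.ofReal_pow]

/-! ### Transformation of the equation of motion -/

/-- The covariant acceleration of the image curve under the square mapping, in the new time,
is a multiple of the covariant acceleration of the original curve, up to a radial term. -/
theorem covariant_acceleration_sq {e z zb p pb a n P Q : ℂ} (he : e = 1 ∨ e = -1) (hz : z ≠ 0)
    (hn : n = z * zb) (hzb : zb ≠ 0) (hD : 1 + e * n ≠ 0) (hM : 1 - e * n ≠ 0)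
    (hP : 4 * n / (1 - e * n) ^ 2 * P = 2 * z * p)
    (hQ : 8 * ((z * pb + zb * p) / 2) * (1 + e * n) / (1 - e * n) ^ 3 * P +
      (4 * n / (1 - e * n) ^ 2) ^ 2 * Q = 2 * p ^ 2 + 2 * z * a) :
    (2 / (1 - n ^ 2)) ^ 2 * (Q + 2 / (1 - n ^ 2) * (zb ^ 2 * P ^ 2)) =
      (1 - e * n) ^ 2 / (8 * n * zb) *
        ((2 / (1 + e * n)) ^ 2 * (a - e * (2 / (1 + e * n)) * (zb * p ^ 2))
          - 4 * z * (p * pb) / (n * ((1 + e * n) * (1 - e * n)))) := by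
  have h0 : n ≠ 0 := hn ▸ mul_ne_zero hz hzb
  have h1 : P = (1 - e * n) ^ 2 / (2 * zb) * p := by
    generalize 1 - e * n = M at *
    field_simp at hP ⊢
    refine mul_left_cancel₀ hz ?_
    linear_combination (1 / 2) * hP - 2 * P * hn
  have h2 : Q = (2 * p ^ 2 + 2 * z * a - 8 * ((z * pb + zb * p) / 2) * (1 + e * n) /
      (1 - e * n) ^ 3 * P) * (1 - e * n) ^ 4 / (16 * n ^ 2) := by
    rw [← hQ]
    generalize 1 - e * n = M at *
    field_simp
    ring
  have h3 : 1 - n ^ 2 = (1 - e * n) * (1 + e * n) := by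
    rcases he with rfl | rfl <;> ring
  rw [h2, h1, h3]
  subst hn
  rcases he with rfl | rfl
  · simp only [one_mul] at *
    field_simp
    ring
  · simp only [neg_mul, one_mul, sub_neg_eq_add, ← sub_eq_add_neg] at *
    field_simp
    ring

/-- The expression of `Geom.factor` in the chart. -/
def Geom.planeFactor (g : Geom) (ζ : ℂ) : ℝ :=
  4 * Complex.normSq ζ / (1 - g.sign * Complex.normSq ζ) ^ 2

theorem Geom.hasDerivAt_planeFactor (g : Geom) {z : ℝ → ℂ} {z' : ℂ} {t : ℝ}
    (h : HasDerivAt z z' t) (h1 : Complex.normSq (z t) < 1) :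
    HasDerivAt (fun s => g.planeFactor (z s)) (8 * dot (z t) z' *
      (1 + g.sign * Complex.normSq (z t)) / (1 - g.sign * Complex.normSq (z t)) ^ 3) t := by
  have h2 := hasDerivAt_normSq h
  have h3 := (g.one_sub_pos h1).ne'
  refine ((h2.const_mul 4).div (((h2.const_mul g.sign).const_sub 1).pow 2)
    (pow_ne_zero 2 h3)).congr_deriv ?_
  simp only [Pi.pow_apply]
  field_simp
  push_cast
  ring

/-- The law of conservation of energy in the chart, for the Hooke problem and for its image. -/
theorem chart_energy_iff (g : Geom) {z p P : ℂ} (h : Complex.normSq z < 1) (h0 : z ≠ 0) {m E : ℝ}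
    (hP : (g.planeFactor z : ℂ) * P = 2 * z * p) :
    g.scale z ^ 2 * Complex.normSq p / 2 - (E + g.sign * m) * g.planeFactor z = 2 * m ↔
      Geom.hyperbolic.scale (z ^ 2) ^ 2 * Complex.normSq P / 2 -
        m * ((1 + Complex.normSq (z ^ 2)) / (2 * ‖z ^ 2‖)) = E := by
  have hn := Complex.normSq_pos.2 h0
  have hD := g.one_add_pos h
  have hM := g.one_sub_pos h
  have h1 := congrArg Complex.normSq hP
  rw [Complex.normSq_mul, Complex.normSq_mul, Complex.normSq_mul, Complex.normSq_ofReal,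
    Complex.normSq_ofNat] at h1
  have h2 : ‖z ^ 2‖ = Complex.normSq z := by rw [norm_pow, Complex.normSq_eq_norm_sq]
  rw [h2, normSq_sq]
  have h3 : Geom.hyperbolic.scale (z ^ 2) =
      2 / ((1 + g.sign * Complex.normSq z) * (1 - g.sign * Complex.normSq z)) := by
    rw [Geom.scale, normSq_sq, show Geom.hyperbolic.sign = -1 from rfl]
    congr 1
    linear_combination Complex.normSq z ^ 2 * g.sign_sq
  have h4 : Complex.normSq P = Complex.normSq p * (1 - g.sign * Complex.normSq z) ^ 4 /
      (4 * Complex.normSq z) := by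
    unfold Geom.planeFactor at h1
    generalize 1 - g.sign * Complex.normSq z = M at *
    field_simp at h1 ⊢
    linear_combination h1 / 4
  rw [h3, h4]
  unfold Geom.scale Geom.planeFactor
  have hs := g.sign_sq
  generalize Complex.normSq z = n at *
  generalize Complex.normSq p = x at *
  generalize g.sign = e at *
  have e1 : (2 / (1 + e * n)) ^ 2 * x / 2 - (E + e * m) * (4 * n / (1 - e * n) ^ 2) - 2 * m =
      4 * n / (1 - e * n) ^ 2 * ((2 / ((1 + e * n) * (1 - e * n))) ^ 2 *
        (x * (1 - e * n) ^ 4 / (4 * n)) / 2 - m * ((1 + n ^ 2) / (2 * n)) - E) := by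
    generalize hMd : 1 - e * n = M at *
    generalize 1 + e * n = D at *
    field_simp
    subst hMd
    linear_combination (-m * n ^ 2 * D ^ 2 * 4) * hs
  rw [← sub_eq_zero, e1, mul_eq_zero, sub_eq_zero, or_iff_right (by positivity)]

theorem Geom.sign_cases (g : Geom) : (g.sign : ℂ) = 1 ∨ (g.sign : ℂ) = -1 := by
  cases g <;> simp [Geom.sign]

/-- The equations of motion in the chart at one instant, for the Hooke problem and for its image.
The energy relation is needed, since the square mapping is not an isometry. -/
theorem chart_newton_iff (g : Geom) {z p a P Q : ℂ} (h : Complex.normSq z < 1) (h0 : z ≠ 0)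
    {m E : ℝ} (hP : (g.planeFactor z : ℂ) * P = 2 * z * p)
    (hQ : ((8 * dot z p * (1 + g.sign * Complex.normSq z) /
      (1 - g.sign * Complex.normSq z) ^ 3 : ℝ) : ℂ) * P + (g.planeFactor z : ℂ) ^ 2 * Q =
        2 * p ^ 2 + 2 * z * a)
    (hE : g.scale z ^ 2 * Complex.normSq p / 2 - (E + g.sign * m) * g.planeFactor z = 2 * m) :
    (g.scale z ^ 2 : ℂ) * (a - g.sign * g.scale z * (starRingEnd ℂ z * p ^ 2)) =
        g.hookeCoeff (E + g.sign * m) z * z ↔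
      (Geom.hyperbolic.scale (z ^ 2) ^ 2 : ℂ) * (Q - Geom.hyperbolic.sign *
        Geom.hyperbolic.scale (z ^ 2) * (starRingEnd ℂ (z ^ 2) * P ^ 2)) =
          keplerCoeff m (z ^ 2) * z ^ 2 := by
  have hD := g.one_add_pos h
  have hM := g.one_sub_pos h
  have hn0 := Complex.normSq_pos.2 h0
  have hD' : (1 + g.sign * Complex.normSq z : ℂ) ≠ 0 := by exact_mod_cast hD.ne'
  have hM' : (1 - g.sign * Complex.normSq z : ℂ) ≠ 0 := by exact_mod_cast hM.ne'
  have hn' : (Complex.normSq z : ℂ) ≠ 0 := by exact_mod_cast hn0.ne'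
  have hzb : starRingEnd ℂ z ≠ 0 := by simpa using h0
  have hdot : (dot z p : ℂ) = (z * starRingEnd ℂ p + starRingEnd ℂ z * p) / 2 := by
    apply Complex.ext <;> (simp [dot]; try ring)
  have hn : (Complex.normSq z : ℂ) = z * starRingEnd ℂ z := (Complex.mul_conj z).symm
  have hpp : p * starRingEnd ℂ p = (m + 2 * (E + g.sign * m) * Complex.normSq z /
      (1 - g.sign * Complex.normSq z) ^ 2) * (1 + g.sign * Complex.normSq z) ^ 2 := by
    rw [Complex.mul_conj]
    have : Complex.normSq p = (m + 2 * (E + g.sign * m) * Complex.normSq z /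
      (1 - g.sign * Complex.normSq z) ^ 2) * (1 + g.sign * Complex.normSq z) ^ 2 := by
      unfold Geom.scale Geom.planeFactor at hE
      generalize 1 - g.sign * Complex.normSq z = M at *
      generalize 1 + g.sign * Complex.normSq z = D at *
      field_simp at hE ⊢
      linear_combination hE / 2
    rw [this]
    push_cast
    ring
  have key := covariant_acceleration_sq (e := g.sign) (z := z) (zb := starRingEnd ℂ z) (p := p)
    (pb := starRingEnd ℂ p) (a := a) (n := Complex.normSq z) (P := P) (Q := Q) g.sign_cases h0 hn
    hzb hD' hM' (by rw [← hP]; simp [Geom.planeFactor])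
    (by rw [← hQ, ← hdot]; simp [Geom.planeFactor])
  have hs : (g.scale z : ℂ) = 2 / (1 + g.sign * Complex.normSq z) := by simp [Geom.scale]
  have hS : (Geom.hyperbolic.scale (z ^ 2) : ℂ) = 2 / (1 - (Complex.normSq z : ℂ) ^ 2) := by
    rw [Geom.scale, normSq_sq, show Geom.hyperbolic.sign = -1 from rfl]
    push_cast
    ring
  have hK : (keplerCoeff m (z ^ 2) * z ^ 2 : ℂ) =
      (1 - g.sign * Complex.normSq z) ^ 2 / (8 * Complex.normSq z * starRingEnd ℂ z) *
      (g.hookeCoeff (E + g.sign * m) z * z - 4 * z * (p * starRingEnd ℂ p) /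
        (Complex.normSq z * ((1 + g.sign * Complex.normSq z) * (1 - g.sign * Complex.normSq z)))) := by
    have h2 : ‖z ^ 2‖ = Complex.normSq z := by rw [norm_pow, Complex.normSq_eq_norm_sq]
    rw [hpp, keplerCoeff, Geom.hookeCoeff, h2, normSq_sq]
    have h3 : (1 - (Complex.normSq z : ℂ) ^ 2) =
        (1 - g.sign * Complex.normSq z) * (1 + g.sign * Complex.normSq z) := by
      rcases g.sign_cases with h | h <;> rw [h] <;> ring
    push_cast
    rw [h3]
    generalize (1 - g.sign * Complex.normSq z : ℂ) = M at *
    generalize (1 + g.sign * Complex.normSq z : ℂ) = D at *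
    generalize (Complex.normSq z : ℂ) = n at *
    field_simp
    rw [hn]
    ring
  have hT : (1 - g.sign * Complex.normSq z : ℂ) ^ 2 /
      (8 * Complex.normSq z * starRingEnd ℂ z) ≠ 0 := by
    refine div_ne_zero (pow_ne_zero 2 hM') (mul_ne_zero (mul_ne_zero (by norm_num) hn') hzb)
  rw [hK, hS, hs, map_pow, show Geom.hyperbolic.sign = -1 from rfl,
    show Q - ((-1 : ℝ) : ℂ) * (2 / (1 - (Complex.normSq z : ℂ) ^ 2)) * (starRingEnd ℂ z ^ 2 * P ^ 2) =
      Q + 2 / (1 - (Complex.normSq z : ℂ) ^ 2) * (starRingEnd ℂ z ^ 2 * P ^ 2) by push_cast; ring,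
    key, mul_right_inj' hT, sub_left_inj]

/-! ### Changes of time -/

/-- `τ` is an increasing diffeomorphism between the open sets `I` and `J` of times, with inverse
`σ` and derivative `L`. -/
structure TimeChange (I J : Set ℝ) (L τ σ : ℝ → ℝ) : Prop where
  isOpen_source : IsOpen I
  isOpen_target : IsOpen J
  map_source : ∀ t ∈ I, τ t ∈ J
  map_target : ∀ u ∈ J, σ u ∈ I
  left_inv : ∀ t ∈ I, σ (τ t) = t
  right_inv : ∀ u ∈ J, τ (σ u) = u
  strictMonoOn : StrictMonoOn τ I
  pos : ∀ t ∈ I, 0 < L t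
  hasDerivAt : ∀ t ∈ I, HasDerivAt τ (L t) t
  hasDerivAt_symm : ∀ u ∈ J, HasDerivAt σ (L (σ u))⁻¹ u

/-- A continuous square root of a differentiable function is differentiable where it does not
vanish. -/
theorem differentiableAt_of_sq {z : ℝ → ℂ} {t : ℝ} (hz : ContinuousAt z t) (h0 : z t ≠ 0)
    (h : DifferentiableAt ℝ (fun s => z s ^ 2) t) : DifferentiableAt ℝ z t := by
  obtain ⟨b, hb, -, hb2⟩ := exists_sqrt_branch h0
  have h1 : DifferentiableAt ℝ b (z t ^ 2) := hb.differentiableAt (by simp)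
  have h2 : DifferentiableAt ℝ (fun s => b (z s ^ 2)) t :=
    DifferentiableAt.comp (g := b) (f := fun s => z s ^ 2) t h1 h
  exact h2.congr_of_eventuallyEq ((hz.eventually hb2).mono fun s hs => hs.symm)

section Transform

variable {g : Geom} {I J : Set ℝ} {τ σ : ℝ → ℝ} {z w : ℝ → ℂ}

theorem TimeChange.hasDerivAt_image (hT : TimeChange I J (fun s => g.planeFactor (z s)) τ σ)
    (hw : ∀ t ∈ I, w (τ t) = z t ^ 2) {t : ℝ} (ht : t ∈ I) (hz : DifferentiableAt ℝ z t) :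
    HasDerivAt w ((g.planeFactor (z t) : ℂ)⁻¹ * (2 * z t * deriv z t)) (τ t) := by
  have h1 := hT.hasDerivAt_symm _ (hT.map_source t ht)
  rw [hT.left_inv t ht] at h1
  have h2 : HasDerivAt (fun u => z (σ u) ^ 2)
      ((g.planeFactor (z t))⁻¹ • (2 * z t * deriv z t)) (τ t) := by
    refine HasDerivAt.scomp (h := σ) (g₁ := fun s => z s ^ 2) (τ t) ?_ h1
    rw [hT.left_inv t ht]
    exact (hz.hasDerivAt.fun_pow 2).congr_deriv (by norm_num)
  rw [Complex.real_smul, Complex.ofReal_inv] at h2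
  refine h2.congr_of_eventuallyEq ?_
  filter_upwards [hT.isOpen_target.mem_nhds (hT.map_source t ht)] with u hu
  rw [← hw _ (hT.map_target u hu), hT.right_inv u hu]

theorem TimeChange.differentiableAt_preimage
    (hT : TimeChange I J (fun s => g.planeFactor (z s)) τ σ)
    (hw : ∀ t ∈ I, w (τ t) = z t ^ 2) (hz0 : ∀ t ∈ I, z t ≠ 0) {t : ℝ} (ht : t ∈ I)
    (hz : ContinuousAt z t) (hd : DifferentiableAt ℝ w (τ t)) : DifferentiableAt ℝ z t := by
  refine differentiableAt_of_sq hz (hz0 t ht) ?_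
  have h1 : DifferentiableAt ℝ (fun s => w (τ s)) t :=
    DifferentiableAt.comp t hd (hT.hasDerivAt t ht).differentiableAt
  refine h1.congr_of_eventuallyEq ?_
  filter_upwards [hT.isOpen_source.mem_nhds ht] with s hs using (hw s hs).symm

theorem TimeChange.mul_deriv_image (hT : TimeChange I J (fun s => g.planeFactor (z s)) τ σ)
    (hw : ∀ t ∈ I, w (τ t) = z t ^ 2) {t : ℝ} (ht : t ∈ I)
    (hz : DifferentiableAt ℝ z t) :
    (g.planeFactor (z t) : ℂ) * deriv w (τ t) = 2 * z t * deriv z t := by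
  have h1 := (hT.pos t ht).ne'
  rw [(hT.hasDerivAt_image hw ht hz).deriv, mul_inv_cancel_left₀]
  exact_mod_cast h1

theorem TimeChange.eventually_source (hT : TimeChange I J (fun s => g.planeFactor (z s)) τ σ)
    {t : ℝ} (ht : t ∈ I) {p : ℝ → Prop} (hp : ∀ᶠ u in 𝓝 (τ t), p u) :
    ∀ᶠ s in 𝓝 t, p (τ s) := (hT.hasDerivAt t ht).continuousAt.eventually hp

theorem TimeChange.eventually_target (hT : TimeChange I J (fun s => g.planeFactor (z s)) τ σ)
    {t : ℝ} (ht : t ∈ I) {p : ℝ → Prop} (hp : ∀ᶠ s in 𝓝 t, p s) :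
    ∀ᶠ u in 𝓝 (τ t), p (σ u) ∧ u ∈ J := by
  have h1 := (hT.hasDerivAt_symm _ (hT.map_source t ht)).continuousAt
  rw [ContinuousAt, hT.left_inv t ht] at h1
  exact (h1.eventually hp).and (hT.isOpen_target.mem_nhds (hT.map_source t ht))

/-- A curve is twice differentiable at a time iff its image is at the new time. -/
theorem TimeChange.regular_iff (hT : TimeChange I J (fun s => g.planeFactor (z s)) τ σ)
    (hzc : ContinuousOn z I) (hz0 : ∀ t ∈ I, z t ≠ 0) (hz1 : ∀ t ∈ I, Complex.normSq (z t) < 1)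
    (hw : ∀ t ∈ I, w (τ t) = z t ^ 2) {t : ℝ} (ht : t ∈ I) :
    ((∀ᶠ s in 𝓝 t, DifferentiableAt ℝ z s) ∧ DifferentiableAt ℝ (deriv z) t) ↔
      (∀ᶠ u in 𝓝 (τ t), DifferentiableAt ℝ w u) ∧ DifferentiableAt ℝ (deriv w) (τ t) := by
  have hI := hT.isOpen_source.mem_nhds ht
  have hLne : (g.planeFactor (z t) : ℂ) ≠ 0 := by exact_mod_cast (hT.pos t ht).ne'
  have hL : DifferentiableAt ℝ z t → DifferentiableAt ℝ (fun s => (g.planeFactor (z s) : ℂ)) t :=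
    fun h => (g.hasDerivAt_planeFactor h.hasDerivAt (hz1 t ht)).ofReal_comp.differentiableAt
  constructor
  · rintro ⟨h1, h2⟩
    have h3 := hT.eventually_target ht (h1.and hI)
    refine ⟨?_, ?_⟩
    · filter_upwards [h3] with u hu
      have := (hT.hasDerivAt_image hw hu.1.2 hu.1.1).differentiableAt
      rwa [hT.right_inv u hu.2] at this
    · have h4 : deriv w =ᶠ[𝓝 (τ t)]
          fun u => (fun s => (g.planeFactor (z s) : ℂ)⁻¹ * (2 * z s * deriv z s)) (σ u) := by
        filter_upwards [h3] with u hu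
        have := (hT.hasDerivAt_image hw hu.1.2 hu.1.1).deriv
        rwa [hT.right_inv u hu.2] at this
      refine DifferentiableAt.congr_of_eventuallyEq ?_ h4
      refine DifferentiableAt.comp (g := fun s => (g.planeFactor (z s) : ℂ)⁻¹ * (2 * z s * deriv z s))
        (τ t) ?_ (hT.hasDerivAt_symm _ (hT.map_source t ht)).differentiableAt
      rw [hT.left_inv t ht]
      exact ((hL h1.self_of_nhds).fun_inv hLne).fun_mul
        ((h1.self_of_nhds.const_mul 2).fun_mul h2)
  · rintro ⟨h1, h2⟩
    have h3 : ∀ᶠ s in 𝓝 t, DifferentiableAt ℝ z s := by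
      filter_upwards [hT.eventually_source ht h1, hI] with s hs1 hs2
      exact hT.differentiableAt_preimage hw hz0 hs2
        (hzc.continuousAt (hT.isOpen_source.mem_nhds hs2)) hs1
    refine ⟨h3, ?_⟩
    have h4 : deriv z =ᶠ[𝓝 t]
        fun s => (g.planeFactor (z s) : ℂ) * deriv w (τ s) * (2 * z s)⁻¹ := by
      filter_upwards [h3, hI] with s hs1 hs2
      have := hz0 s hs2
      rw [hT.mul_deriv_image hw hs2 hs1]
      field_simp
    refine DifferentiableAt.congr_of_eventuallyEq ?_ h4
    exact ((hL h3.self_of_nhds).fun_mul (DifferentiableAt.comp (g := deriv w) t h2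
      (hT.hasDerivAt t ht).differentiableAt)).fun_mul
      ((h3.self_of_nhds.const_mul 2).fun_inv (by simpa using hz0 t ht))

theorem TimeChange.second_deriv (hT : TimeChange I J (fun s => g.planeFactor (z s)) τ σ)
    (hz1 : ∀ t ∈ I, Complex.normSq (z t) < 1)
    (hw : ∀ t ∈ I, w (τ t) = z t ^ 2) {t : ℝ} (ht : t ∈ I)
    (h1 : ∀ᶠ s in 𝓝 t, DifferentiableAt ℝ z s) (h2 : DifferentiableAt ℝ (deriv z) t)
    (h3 : DifferentiableAt ℝ (deriv w) (τ t)) :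
    ((8 * dot (z t) (deriv z t) * (1 + g.sign * Complex.normSq (z t)) /
      (1 - g.sign * Complex.normSq (z t)) ^ 3 : ℝ) : ℂ) * deriv w (τ t) +
        (g.planeFactor (z t) : ℂ) ^ 2 * deriv (deriv w) (τ t) =
          2 * deriv z t ^ 2 + 2 * z t * deriv (deriv z) t := by
  have h4 : (fun s => (g.planeFactor (z s) : ℂ) * deriv w (τ s)) =ᶠ[𝓝 t]
      fun s => 2 * z s * deriv z s := by
    filter_upwards [h1, hT.isOpen_source.mem_nhds ht] with s hs1 hs2
    exact hT.mul_deriv_image hw hs2 hs1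
  have h5 := (g.hasDerivAt_planeFactor h1.self_of_nhds.hasDerivAt (hz1 t ht)).ofReal_comp
  have h6 : HasDerivAt (fun s => deriv w (τ s))
      (g.planeFactor (z t) • deriv (deriv w) (τ t)) t :=
    HasDerivAt.scomp t h3.hasDerivAt (hT.hasDerivAt t ht)
  have h7 := (h1.self_of_nhds.hasDerivAt.const_mul 2).mul h2.hasDerivAt
  have h8 := (h5.mul h6).unique (h7.congr_of_eventuallyEq h4)
  rw [Complex.real_smul] at h8
  linear_combination h8

/-- The motions of the Hooke problem at energy `2m` and of the Kepler problem at energy `E`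
correspond, in the chart. -/
theorem TimeChange.chartNewton_iff (hT : TimeChange I J (fun s => g.planeFactor (z s)) τ σ)
    (hzc : ContinuousOn z I) (hz0 : ∀ t ∈ I, z t ≠ 0) (hz1 : ∀ t ∈ I, Complex.normSq (z t) < 1)
    (hw : ∀ t ∈ I, w (τ t) = z t ^ 2) {t : ℝ} (ht : t ∈ I) (m E : ℝ) :
    (g.ChartNewtonAt (g.hookeCoeff (E + g.sign * m)) z t ∧
      g.scale (z t) ^ 2 * Complex.normSq (deriv z t) / 2 -
        (E + g.sign * m) * g.planeFactor (z t) = 2 * m) ↔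
    (Geom.hyperbolic.ChartNewtonAt (keplerCoeff m) w (τ t) ∧
      Geom.hyperbolic.scale (w (τ t)) ^ 2 * Complex.normSq (deriv w (τ t)) / 2 -
        m * ((1 + Complex.normSq (w (τ t))) / (2 * ‖w (τ t)‖)) = E) := by
  have hreg := hT.regular_iff hzc hz0 hz1 hw ht
  unfold Geom.ChartNewtonAt
  constructor
  · rintro ⟨⟨h1, h2, h3⟩, h4⟩
    have h5 := hreg.1 ⟨h1, h2⟩
    have hP := hT.mul_deriv_image hw ht h1.self_of_nhds
    have hQ := hT.second_deriv hz1 hw ht h1 h2 h5.2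
    refine ⟨⟨h5.1, h5.2, ?_⟩, ?_⟩
    · rw [hw t ht]
      exact (chart_newton_iff g (hz1 t ht) (hz0 t ht) hP hQ h4).1 h3
    · rw [hw t ht]
      exact (chart_energy_iff g (hz1 t ht) (hz0 t ht) hP).1 h4
  · rintro ⟨⟨h1, h2, h3⟩, h4⟩
    have h5 := hreg.2 ⟨h1, h2⟩
    have hP := hT.mul_deriv_image hw ht h5.1.self_of_nhds
    have hQ := hT.second_deriv hz1 hw ht h5.1 h5.2 h2
    rw [hw t ht] at h3 h4
    have h6 := (chart_energy_iff g (hz1 t ht) (hz0 t ht) hP).2 h4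
    exact ⟨⟨h5.1, h5.2, (chart_newton_iff g (hz1 t ht) (hz0 t ht) hP hQ h6).2 h3⟩, h6⟩

end Transform

theorem TimeChange.symm {I J : Set ℝ} {L τ σ : ℝ → ℝ} (h : TimeChange I J L τ σ) :
    TimeChange J I (fun u => (L (σ u))⁻¹) σ τ where
  isOpen_source := h.isOpen_target
  isOpen_target := h.isOpen_source
  map_source := h.map_target
  map_target := h.map_source
  left_inv := h.right_inv
  right_inv := h.left_inv
  strictMonoOn := by
    intro u hu v hv huv
    by_contra hcon
    have := h.strictMonoOn.monotoneOn (h.map_target v hv) (h.map_target u hu) (not_lt.1 hcon)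
    rw [h.right_inv v hv, h.right_inv u hu] at this
    exact absurd huv (not_lt.2 this)
  pos u hu := inv_pos.2 (h.pos _ (h.map_target u hu))
  hasDerivAt := h.hasDerivAt_symm
  hasDerivAt_symm t ht := by
    rw [h.left_inv t ht, inv_inv]
    exact h.hasDerivAt t ht

theorem TimeChange.congr {I J : Set ℝ} {L L' τ σ : ℝ → ℝ} (h : TimeChange I J L τ σ)
    (hL : ∀ t ∈ I, L' t = L t) : TimeChange I J L' τ σ :=
  { h with
    pos := fun t ht => by rw [hL t ht]; exact h.pos t ht
    hasDerivAt := fun t ht => by rw [hL t ht]; exact h.hasDerivAt t ht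
    hasDerivAt_symm := fun u hu => by rw [hL _ (h.map_target u hu)]; exact h.hasDerivAt_symm u hu }

/-- A continuous positive function on an interval is the speed of a change of time. -/
theorem exists_timeChange {I : Set ℝ} (hI : IsOpen I) (hI' : I.OrdConnected) {L : ℝ → ℝ}
    (hL : ContinuousOn L I) (hpos : ∀ t ∈ I, 0 < L t) {t₀ : ℝ} (ht₀ : t₀ ∈ I) (u₀ : ℝ) :
    ∃ J τ σ, TimeChange I J L τ σ ∧ J.OrdConnected ∧ τ t₀ = u₀ := by
  let τ : ℝ → ℝ := fun t => u₀ + ∫ x in t₀..t, L x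
  have hd : ∀ t ∈ I, HasDerivAt τ (L t) t := fun t ht =>
    (intervalIntegral.integral_hasDerivAt_right
      ((hL.mono (hI'.uIcc_subset ht₀ ht)).intervalIntegrable)
      (hL.stronglyMeasurableAtFilter hI t ht) (hL.continuousAt (hI.mem_nhds ht))).const_add u₀
  have hmono : StrictMonoOn τ I := strictMonoOn_of_deriv_pos hI'.convex
    (fun t ht => (hd t ht).continuousAt.continuousWithinAt)
    (fun t ht => by
      rw [(hd t (interior_subset ht)).deriv]; exact hpos t (interior_subset ht))
  have hJ' : (τ '' I).OrdConnected :=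
    (hI'.isPreconnected.image τ fun t ht => (hd t ht).continuousAt.continuousWithinAt).ordConnected
  have hJ : IsOpen (τ '' I) := by
    rw [isOpen_iff_mem_nhds]
    rintro _ ⟨t, ht, rfl⟩
    obtain ⟨a, b, hab, h⟩ := mem_nhds_iff_exists_Ioo_subset.1 (hI.mem_nhds ht)
    obtain ⟨a', ha1, ha2⟩ := exists_between hab.1
    obtain ⟨b', hb1, hb2⟩ := exists_between hab.2
    have ha : a' ∈ I := h ⟨ha1, ha2.trans hab.2⟩
    have hb : b' ∈ I := h ⟨hab.1.trans hb1, hb2⟩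
    exact Filter.mem_of_superset (Icc_mem_nhds (hmono ha ht ha2) (hmono ht hb hb1))
      (hJ'.out ⟨a', ha, rfl⟩ ⟨b', hb, rfl⟩)
  let σ := Function.invFunOn τ I
  have hσI : ∀ u ∈ τ '' I, σ u ∈ I := fun u hu => Function.invFunOn_mem hu
  have hτσ : ∀ u ∈ τ '' I, τ (σ u) = u := fun u hu => Function.invFunOn_eq hu
  have hστ : ∀ t ∈ I, σ (τ t) = t := fun t ht =>
    hmono.injOn (hσI _ ⟨t, ht, rfl⟩) ht (hτσ _ ⟨t, ht, rfl⟩)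
  have hσmono : StrictMonoOn σ (τ '' I) := by
    intro u hu v hv huv
    rw [← hmono.lt_iff_lt (hσI u hu) (hσI v hv), hτσ u hu, hτσ v hv]
    exact huv
  have hσimage : σ '' (τ '' I) = I := by
    rw [Set.image_image, Set.image_congr hστ, Set.image_id']
  refine ⟨τ '' I, τ, σ, ⟨hI, hJ, fun t ht => ⟨t, ht, rfl⟩, hσI, hστ, hτσ, hmono, hpos, hd, ?_⟩,
    hJ', by simp [τ]⟩
  intro u hu
  have hc : ContinuousAt σ u := hσmono.continuousAt_of_image_mem_nhds (hJ.mem_nhds hu)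
    (by rw [hσimage]; exact hI.mem_nhds (hσI u hu))
  exact HasDerivAt.of_local_left_inverse hc (hd _ (hσI u hu)) (hpos _ (hσI u hu)).ne'
    (by filter_upwards [hJ.mem_nhds hu] with v hv using hτσ v hv)

/-! ### Curves that correspond under the square mapping -/

/-- The curve `Γ` on the interval `J` is the image under the square mapping of the curve `γ` on the
interval `I`, after the change of time `τ` whose speed is `Geom.factor`. -/
structure Related (g : Geom) (I J : Set ℝ) (γ Γ : ℝ → V3) (τ σ : ℝ → ℝ) : Prop where
  time : TimeChange I J (fun t => g.factor (γ t)) τ σ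
  source_ordConnected : I.OrdConnected
  target_ordConnected : J.OrdConnected
  continuousOn : ContinuousOn γ I
  mem : ∀ t ∈ I, γ t ∈ g.punctured
  apply_eq : ∀ t ∈ I, Γ (τ t) = squareMap (γ t)

theorem exists_related_of_curve {g : Geom} {I : Set ℝ} (hI : IsOpen I) (hI' : I.OrdConnected)
    {γ : ℝ → V3} (hγ : ContinuousOn γ I) (hmem : ∀ t ∈ I, γ t ∈ g.punctured) :
    ∃ J Γ τ σ, Related g I J γ Γ τ σ := by
  rcases I.eq_empty_or_nonempty with rfl | ⟨t₀, ht₀⟩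
  · refine ⟨∅, γ, id, id, ⟨⟨isOpen_empty, isOpen_empty, ?_, ?_, ?_, ?_, ?_, ?_, ?_, ?_⟩,
      Set.ordConnected_empty, Set.ordConnected_empty, hγ, hmem, ?_⟩⟩ <;> simp [StrictMonoOn]
  · obtain ⟨J, τ, σ, h, hJ, -⟩ := exists_timeChange hI hI' (L := fun t => g.factor (γ t))
      (fun t ht => ContinuousAt.comp_continuousWithinAt (g := g.factor)
        (Geom.contDiffAt_factor (hmem t ht).1).continuousAt (hγ t ht))
      (fun t ht => Geom.factor_pos (hmem t ht)) ht₀ 0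
    exact ⟨J, fun u => squareMap (γ (σ u)), τ, σ, h, hI', hJ, hγ, hmem,
      fun t ht => by rw [h.left_inv t ht]⟩

/-- Curves lift along the square mapping, through any point above one of their points. -/
theorem exists_lift {g : Geom} {J : Set ℝ} (hJ : IsOpen J) (hJ' : J.OrdConnected) {Γ : ℝ → V3}
    (hΓ : ContinuousOn Γ J) (hmem : ∀ u ∈ J, Γ u ∈ Geom.hyperbolic.punctured) {u₀ : ℝ}
    (hu₀ : u₀ ∈ J) {q₀ : V3} (hq₀ : q₀ ∈ g.punctured) (h : squareMap q₀ = Γ u₀) :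
    ∃ γ : ℝ → V3, ContinuousOn γ J ∧ (∀ u ∈ J, γ u ∈ g.punctured ∧ squareMap (γ u) = Γ u) ∧
      γ u₀ = q₀ := by
  have hsc : IsSimplyConnected J := by
    have := hJ'.convex.contractibleSpace ⟨u₀, hu₀⟩
    exact (inferInstance : SimplyConnectedSpace J)
  obtain ⟨f, hf, hf2⟩ := Complex.exists_continuousOn_pow_eq hsc hJ (g := fun u => stereo (Γ u))
    (fun u hu => ContinuousAt.comp_continuousWithinAt (g := stereo)
      (differentiableAt_stereo (hmem u hu).1).continuousAt (hΓ u hu))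
    (by rintro ⟨u, hu, h0⟩; exact stereo_ne_zero (hmem u hu) h0) two_ne_zero
  obtain ⟨e, he, he0⟩ : ∃ e : ℂ, e ^ 2 = 1 ∧ e * f u₀ = stereo q₀ := by
    have h1 : stereo q₀ ^ 2 = f u₀ ^ 2 := by rw [hf2, ← h, stereo_squareMap hq₀.1]
    rcases sq_eq_sq_iff_eq_or_eq_neg.1 h1 with h2 | h2
    · exact ⟨1, by simp, by simp [h2]⟩
    · exact ⟨-1, by simp, by simp [h2]⟩
  have hsq : ∀ u, (e * f u) ^ 2 = stereo (Γ u) := fun u => by rw [mul_pow, he, one_mul, hf2]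
  have hlt : ∀ u ∈ J, Complex.normSq (e * f u) < 1 := by
    intro u hu
    have h5 := normSq_stereo_lt_one (hmem u hu).1
    rw [← hsq, normSq_sq] at h5
    by_contra hcon
    exact absurd h5 (not_lt.2 (one_le_pow₀ (not_lt.1 hcon)))
  refine ⟨fun u => g.chart (e * f u), fun u hu => ?_, fun u hu => ⟨?_, ?_⟩, ?_⟩
  · exact ContinuousAt.comp_continuousWithinAt (g := g.chart)
      (g.differentiableAt_chart (hlt u hu)).continuousAt (continuousWithinAt_const.mul (hf u hu))
  · refine g.chart_mem_punctured (hlt u hu) fun h0 => stereo_ne_zero (hmem u hu) ?_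
    rw [← hsq, h0]; simp
  · rw [squareMap_chart (hlt u hu), hsq, chart_stereo (hmem u hu).1]
  · simp only [he0, chart_stereo hq₀.1]

theorem exists_related_of_image {g : Geom} {J : Set ℝ} (hJ : IsOpen J) (hJ' : J.OrdConnected)
    {Γ : ℝ → V3} (hΓ : ContinuousOn Γ J) (hmem : ∀ u ∈ J, Γ u ∈ Geom.hyperbolic.punctured) {u₀ : ℝ}
    (hu₀ : u₀ ∈ J) {q₀ : V3} (hq₀ : q₀ ∈ g.punctured) (h : squareMap q₀ = Γ u₀) :
    ∃ I γ τ σ, Related g I J γ Γ τ σ ∧ ∃ t₀ ∈ I, γ t₀ = q₀ ∧ τ t₀ = u₀ := by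
  obtain ⟨δ, hδ, hδ2, hδ0⟩ := exists_lift hJ hJ' hΓ hmem hu₀ hq₀ h
  have hpos : ∀ u ∈ J, 0 < g.factor (δ u) := fun u hu => Geom.factor_pos (hδ2 u hu).1
  obtain ⟨I, σ, τ, hT, hI, -⟩ := exists_timeChange hJ hJ' (L := fun u => (g.factor (δ u))⁻¹)
    (ContinuousOn.inv₀ (fun u hu => ContinuousAt.comp_continuousWithinAt (g := g.factor)
        (Geom.contDiffAt_factor (hδ2 u hu).1.1).continuousAt (hδ u hu))
        fun u hu => (hpos u hu).ne')
    (fun u hu => inv_pos.2 (hpos u hu)) hu₀ 0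
  refine ⟨I, fun t => δ (τ t), τ, σ, ⟨hT.symm.congr fun t ht => by simp, hI, hJ', ?_, ?_, ?_⟩,
    σ u₀, hT.map_source _ hu₀, ?_, hT.left_inv _ hu₀⟩
  · exact hδ.comp (fun t ht => (hT.hasDerivAt_symm t ht).continuousAt.continuousWithinAt)
      hT.map_target
  · exact fun t ht => (hδ2 _ (hT.map_target t ht)).1
  · exact fun t ht => ((hδ2 _ (hT.map_target t ht)).2).symm
  · simp only [hT.left_inv _ hu₀, hδ0]

/-- Twice the kinetic energy, in the chart. -/
theorem form_deriv_self {g : Geom} {γ : ℝ → V3} {t : ℝ}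
    (hγ : ∀ᶠ s in 𝓝 t, γ s ∈ g.surface) (h : DifferentiableAt ℝ (fun s => stereo (γ s)) t) :
    g.form (deriv γ t) (deriv γ t) =
      g.scale (stereo (γ t)) ^ 2 * Complex.normSq (deriv (fun s => stereo (γ s)) t) := by
  rw [(deriv_eq_chartDeriv hγ h).deriv,
    form_chartDeriv g (normSq_stereo_lt_one hγ.self_of_nhds), normSq_eq_dot]

theorem hooke_newtonAt_iff {g : Geom} {f : ℝ} {W : Set (Set V3)} {γ : ℝ → V3} {t : ℝ}
    (hγ : ∀ᶠ s in 𝓝 t, γ s ∈ g.punctured) :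
    (hookeBilliard g f W).NewtonAt γ t ↔
      g.ChartNewtonAt (g.hookeCoeff f) (fun s => stereo (γ s)) t := by
  have h0 := hγ.self_of_nhds
  refine newtonAt_iff (S := hookeBilliard g f W) (hγ.mono fun s hs => hs.1) fun η => ?_
  have := fderiv_hookeForce g f (normSq_stereo_lt_one h0.1) (stereo_ne_zero h0) η
  rwa [chart_stereo h0.1] at this

theorem kepler_newtonAt_iff {m : ℝ} {W : Set (Set V3)} {γ : ℝ → V3} {t : ℝ}
    (hγ : ∀ᶠ s in 𝓝 t, γ s ∈ Geom.hyperbolic.punctured) :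
    (keplerBilliard m W).NewtonAt γ t ↔
      Geom.hyperbolic.ChartNewtonAt (keplerCoeff m) (fun s => stereo (γ s)) t := by
  have h0 := hγ.self_of_nhds
  refine newtonAt_iff (S := keplerBilliard m W) (hγ.mono fun s hs => hs.1) fun η => ?_
  have := fderiv_keplerForce m (normSq_stereo_lt_one h0.1) (stereo_ne_zero h0) η
  rwa [chart_stereo h0.1] at this

theorem hasDerivWithinAt_comp_time {c : ℝ → V3} {v : V3} {α : ℝ → ℝ} {a x : ℝ} {S T : Set ℝ}
    (hc : HasDerivWithinAt c v T (α x)) (hα : HasDerivAt α a x)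
    (h : ∀ᶠ y in 𝓝[S] x, α y ∈ T) : HasDerivWithinAt (fun y => c (α y)) (a • v) S x := by
  have h1 : HasDerivWithinAt (c ∘ α) (a • v) {y | α y ∈ T} x :=
    HasDerivWithinAt.scomp x hc hα.hasDerivWithinAt fun y hy => hy
  exact h1.mono_of_mem_nhdsWithin h

namespace Related

variable {g : Geom} {I J : Set ℝ} {γ Γ : ℝ → V3} {τ σ : ℝ → ℝ}

theorem eq_image (h : Related g I J γ Γ τ σ) {u : ℝ} (hu : u ∈ J) : Γ u = squareMap (γ (σ u)) := by
  rw [← h.apply_eq _ (h.time.map_target u hu), h.time.right_inv u hu]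

theorem mem_image (h : Related g I J γ Γ τ σ) {u : ℝ} (hu : u ∈ J) :
    Γ u ∈ Geom.hyperbolic.punctured := by
  rw [h.eq_image hu]
  exact squareMap_mem_punctured (h.mem _ (h.time.map_target u hu))

theorem continuousOn_image (h : Related g I J γ Γ τ σ) : ContinuousOn Γ J := by
  have h1 : ContinuousOn (fun u => squareMap (γ (σ u))) J := by
    intro u hu
    have hσ := h.time.map_target u hu
    refine ContinuousAt.comp_continuousWithinAt (g := squareMap)
      (differentiableAt_squareMap (h.mem _ hσ).1).continuousAt ?_
    exact (h.continuousOn.comp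
      (fun u hu => (h.time.hasDerivAt_symm u hu).continuousAt.continuousWithinAt)
      h.time.map_target) u hu
  exact h1.congr fun u hu => h.eq_image hu

theorem carries (h : Related g I J γ Γ τ σ) : Carries squareMap g.factor τ I γ J Γ :=
  ⟨⟨h.time.map_source, h.time.strictMonoOn.injOn,
    fun u hu => ⟨σ u, h.time.map_target u hu, h.time.right_inv u hu⟩⟩,
    h.time.hasDerivAt, h.apply_eq⟩

theorem eventually_mem (h : Related g I J γ Γ τ σ) {t : ℝ} (ht : t ∈ I) :
    ∀ᶠ s in 𝓝 t, γ s ∈ g.punctured := by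
  filter_upwards [h.time.isOpen_source.mem_nhds ht] with s hs using h.mem s hs

theorem eventually_mem_image (h : Related g I J γ Γ τ σ) {u : ℝ} (hu : u ∈ J) :
    ∀ᶠ v in 𝓝 u, Γ v ∈ Geom.hyperbolic.punctured := by
  filter_upwards [h.time.isOpen_target.mem_nhds hu] with s hs using h.mem_image hs

theorem newtonAt_iff (h : Related g I J γ Γ τ σ) {t : ℝ} (ht : t ∈ I) (m E : ℝ)
    (W W' : Set (Set V3)) :
    ((hookeBilliard g (E + g.sign * m) W').NewtonAt γ t ∧
      (hookeBilliard g (E + g.sign * m) W').energy (γ t) (deriv γ t) = 2 * m) ↔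
    ((keplerBilliard m W).NewtonAt Γ (τ t) ∧
      (keplerBilliard m W).energy (Γ (τ t)) (deriv Γ (τ t)) = E) := by
  have hu := h.time.map_source t ht
  have h1 := h.eventually_mem ht
  have h2 := h.eventually_mem_image hu
  have key := TimeChange.chartNewton_iff (g := g) (z := fun s => stereo (γ s))
    (w := fun s => stereo (Γ s)) h.time
    (fun s hs => ContinuousAt.comp_continuousWithinAt (g := stereo)
      (differentiableAt_stereo (h.mem s hs).1).continuousAt (h.continuousOn s hs))
    (fun s hs => stereo_ne_zero (h.mem s hs)) (fun s hs => normSq_stereo_lt_one (h.mem s hs).1)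
    (fun s hs => by rw [h.apply_eq s hs, stereo_squareMap (h.mem s hs).1]) ht m E
  rw [hooke_newtonAt_iff h1, kepler_newtonAt_iff h2]
  have e1 : ∀ hd : DifferentiableAt ℝ (fun s => stereo (γ s)) t,
      (hookeBilliard g (E + g.sign * m) W').energy (γ t) (deriv γ t) =
        g.scale (stereo (γ t)) ^ 2 * Complex.normSq (deriv (fun s => stereo (γ s)) t) / 2 -
        (E + g.sign * m) * g.planeFactor (stereo (γ t)) := fun hd => by
    simp only [Billiard.energy, hookeBilliard]
    rw [form_deriv_self (h1.mono fun s hs => hs.1) hd, hookeForce_eq g _ h1.self_of_nhds]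
    rfl
  have e2 : ∀ hd : DifferentiableAt ℝ (fun s => stereo (Γ s)) (τ t),
      (keplerBilliard m W).energy (Γ (τ t)) (deriv Γ (τ t)) =
        Geom.hyperbolic.scale (stereo (Γ (τ t))) ^ 2 *
          Complex.normSq (deriv (fun s => stereo (Γ s)) (τ t)) / 2 -
        m * ((1 + Complex.normSq (stereo (Γ (τ t)))) / (2 * ‖stereo (Γ (τ t))‖)) := fun hd => by
    simp only [Billiard.energy, keplerBilliard]
    rw [form_deriv_self (h2.mono fun s hs => hs.1) hd, keplerForce_eq m h2.self_of_nhds]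
  constructor
  · rintro ⟨h3, h4⟩
    have h5 := key.1 ⟨h3, by rw [← e1 h3.1.self_of_nhds]; exact h4⟩
    exact ⟨h5.1, by rw [e2 h5.1.1.self_of_nhds]; exact h5.2⟩
  · rintro ⟨h3, h4⟩
    have h5 := key.2 ⟨h3, by rw [← e2 h3.1.self_of_nhds]; exact h4⟩
    exact ⟨h5.1, by rw [e1 h5.1.1.self_of_nhds]; exact h5.2⟩

theorem eventually_image_eq (h : Related g I J γ Γ τ σ) {u : ℝ} (hu : u ∈ J) :
    Γ =ᶠ[𝓝 u] fun v => squareMap (γ (σ v)) := by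
  filter_upwards [h.time.isOpen_target.mem_nhds hu] with v hv using h.eq_image hv

/-- One-sided velocities of a curve determine those of its image. The sets `S` and `T` are
the line or half-lines. -/
theorem hasDerivWithinAt_image (h : Related g I J γ Γ τ σ) {t : ℝ} (ht : t ∈ I) {v : V3}
    {S T : Set ℝ} (hv : HasDerivWithinAt γ v T t) (hS : ∀ u ∈ S, u ∈ J → σ u ∈ T) :
    HasDerivWithinAt Γ ((g.factor (γ t))⁻¹ • fderiv ℝ squareMap (γ t) v) S (τ t) := by
  have hu := h.time.map_source t ht
  have h1 := h.time.hasDerivAt_symm _ hu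
  have h2 : HasDerivWithinAt (fun s => squareMap (γ s)) (fderiv ℝ squareMap (γ t) v) T t :=
    (differentiableAt_squareMap (h.mem t ht).1).hasFDerivAt.comp_hasDerivWithinAt t hv
  rw [← h.time.left_inv t ht] at h2
  have h3 := hasDerivWithinAt_comp_time (S := S) h2 h1 (by
    filter_upwards [self_mem_nhdsWithin, mem_nhdsWithin_of_mem_nhds
      (h.time.isOpen_target.mem_nhds hu)] with y hy1 hy2 using hS y hy1 hy2)
  simp only [h.time.left_inv t ht] at h3
  exact h3.congr_of_eventuallyEq (mem_nhdsWithin_of_mem_nhds (h.eventually_image_eq hu))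
    (h.eq_image hu)

theorem hasDerivWithinAt_preimage (h : Related g I J γ Γ τ σ) {t : ℝ} (ht : t ∈ I) {V : V3}
    {S T : Set ℝ} (hV : HasDerivWithinAt Γ V S (τ t)) (hT : ∀ s ∈ T, s ∈ I → τ s ∈ S)
    (htan : V ∈ Geom.hyperbolic.tangent (Γ (τ t))) :
    ∃ v ∈ g.tangent (γ t), HasDerivWithinAt γ v T t ∧
      fderiv ℝ squareMap (γ t) v = g.factor (γ t) • V := by
  have hq := h.mem t ht
  obtain ⟨ψ, hψ⟩ := exists_isSection hq
  rw [h.apply_eq t ht] at htan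
  have h0 := hψ.eventually_fderiv.self_of_nhds (squareMap_mem_punctured hq) V htan
  rw [hψ.apply_eq] at h0
  have hd : HasFDerivAt ψ (fderiv ℝ ψ (squareMap (γ t))) (Γ (τ t)) := by
    rw [h.apply_eq t ht]; exact hψ.differentiableAt.hasFDerivAt
  have h2 := hd.comp_hasDerivWithinAt (τ t) hV
  have h3 := hasDerivWithinAt_comp_time (S := T) h2 (h.time.hasDerivAt t ht) (by
    filter_upwards [self_mem_nhdsWithin, mem_nhdsWithin_of_mem_nhds
      (h.time.isOpen_source.mem_nhds ht)] with y hy1 hy2 using hT y hy1 hy2)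
  have h4 : γ =ᶠ[𝓝 t] fun s => (ψ ∘ Γ) (τ s) := by
    have hc := h.continuousOn.continuousAt (h.time.isOpen_source.mem_nhds ht)
    filter_upwards [hc.eventually hψ.left_inv, h.time.isOpen_source.mem_nhds ht] with s hs1 hs2
    rw [Function.comp_apply, h.apply_eq s hs2, hs1 (h.mem s hs2)]
  refine ⟨_, smul_mem_tangent h0.1 _, h3.congr_of_eventuallyEq (mem_nhdsWithin_of_mem_nhds h4)
    h4.self_of_nhds, ?_⟩
  rw [map_smul, h0.2]

theorem map_Iic (h : Related g I J γ Γ τ σ) {t : ℝ} (ht : t ∈ I) :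
    ∀ s ∈ Set.Iic t, s ∈ I → τ s ∈ Set.Iic (τ t) :=
  fun _ hs hsI => h.time.strictMonoOn.monotoneOn hsI ht hs

theorem map_Ici (h : Related g I J γ Γ τ σ) {t : ℝ} (ht : t ∈ I) :
    ∀ s ∈ Set.Ici t, s ∈ I → τ s ∈ Set.Ici (τ t) :=
  fun _ hs hsI => h.time.strictMonoOn.monotoneOn ht hsI hs

theorem symm_map_Iic (h : Related g I J γ Γ τ σ) {t : ℝ} (ht : t ∈ I) :
    ∀ u ∈ Set.Iic (τ t), u ∈ J → σ u ∈ Set.Iic t := fun u hu huJ => by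
  have := h.time.symm.strictMonoOn.monotoneOn huJ (h.time.map_source t ht) hu
  rwa [h.time.left_inv t ht] at this

theorem symm_map_Ici (h : Related g I J γ Γ τ σ) {t : ℝ} (ht : t ∈ I) :
    ∀ u ∈ Set.Ici (τ t), u ∈ J → σ u ∈ Set.Ici t := fun u hu huJ => by
  have := h.time.symm.strictMonoOn.monotoneOn (h.time.map_source t ht) huJ hu
  rwa [h.time.left_inv t ht] at this

theorem tendsto_punctured (h : Related g I J γ Γ τ σ) {t : ℝ} (ht : t ∈ I) :
    Filter.Tendsto τ (𝓝[≠] t) (𝓝[≠] (τ t)) := by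
  refine tendsto_nhdsWithin_iff.2 ⟨(h.time.hasDerivAt t ht).continuousAt.tendsto.mono_left
    nhdsWithin_le_nhds, ?_⟩
  filter_upwards [self_mem_nhdsWithin, mem_nhdsWithin_of_mem_nhds
    (h.time.isOpen_source.mem_nhds ht)] with s hs1 hs2 hs3
  exact hs1 (h.time.strictMonoOn.injOn hs2 ht hs3)

theorem tendsto_symm_punctured (h : Related g I J γ Γ τ σ) {t : ℝ} (ht : t ∈ I) :
    Filter.Tendsto σ (𝓝[≠] (τ t)) (𝓝[≠] t) := by
  have hu := h.time.map_source t ht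
  have h1 := (h.time.hasDerivAt_symm _ hu).continuousAt.tendsto
  rw [h.time.left_inv t ht] at h1
  refine tendsto_nhdsWithin_iff.2 ⟨h1.mono_left nhdsWithin_le_nhds, ?_⟩
  filter_upwards [self_mem_nhdsWithin, mem_nhdsWithin_of_mem_nhds
    (h.time.isOpen_target.mem_nhds hu)] with s hs1 hs2 hs3
  exact hs1 (by rw [Set.mem_singleton_iff, ← h.time.right_inv s hs2, hs3])

end Related

/-- Curves that avoid the south pole are determined by their preimages. -/
theorem eq_of_preimage_eq {g : Geom} {C C' : Set V3} (hC : C ⊆ Geom.hyperbolic.punctured)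
    (hC' : C' ⊆ Geom.hyperbolic.punctured)
    (h : g.punctured ∩ squareMap ⁻¹' C = g.punctured ∩ squareMap ⁻¹' C') : C = C' := by
  have key : ∀ D ⊆ Geom.hyperbolic.punctured,
      squareMap '' (g.punctured ∩ squareMap ⁻¹' D) = D := by
    intro D hD
    rw [Set.image_inter_preimage]
    exact Set.inter_eq_right.2 (hD.trans (squareMap_surjOn g))
  rw [← key C hC, h, key C' hC']

theorem mem_tangent_of_reflects {g : Geom} {C : Set V3} (hC : C ⊆ g.surface) {q v w : V3}
    (h : g.Reflects C q v w) : v ∈ g.tangent q ∧ w ∈ g.tangent q := by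
  obtain ⟨s, hs, n, hn, -, rfl, rfl⟩ := h
  have := velocities_subset_tangent hC q hs
  exact ⟨add_mem_tangent this hn, sub_mem_tangent this hn⟩

theorem Related.isTrajectory_iff {g : Geom} {I J : Set ℝ} {γ Γ : ℝ → V3} {τ σ : ℝ → ℝ}
    (h : Related g I J γ Γ τ σ) {W : Set (Set V3)} (hW : ∀ C ∈ W, C ⊆ Geom.hyperbolic.punctured)
    (m E : ℝ) :
    (hookeBilliard g (E + g.sign * m) (g.squareRootWalls W)).IsTrajectory (2 * m) I γ ↔
      (keplerBilliard m W).IsTrajectory E J Γ := by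
  have hmem : ∀ t ∈ I, ∀ C, γ t ∈ g.punctured ∩ squareMap ⁻¹' C ↔ Γ (τ t) ∈ C := by
    intro t ht C
    rw [h.apply_eq t ht]
    exact and_iff_right (h.mem t ht)
  have hwall : ∀ C ∈ W, g.punctured ∩ squareMap ⁻¹' C ∈ g.squareRootWalls W :=
    fun C hC => ⟨C, hC, rfl⟩
  have hsub : ∀ C, g.punctured ∩ squareMap ⁻¹' C ⊆ g.surface := fun C x hx => hx.1.1
  constructor
  · rintro ⟨-, -, -, -, h1, h2⟩
    refine ⟨h.time.isOpen_target, h.target_ordConnected, h.continuousOn_image,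
      fun u hu => h.mem_image hu, fun u hu hCu => ?_, fun u hu C hC hCu => ?_⟩
    · have ht := h.time.map_target u hu
      have hnot : ∀ K ∈ g.squareRootWalls W, γ (σ u) ∉ K := by
        rintro _ ⟨C, hC, rfl⟩ hK
        have := (hmem _ ht C).1 hK
        rw [h.time.right_inv u hu] at this
        exact hCu C hC this
      have := (h.newtonAt_iff ht m E W _).1 (h1 _ ht hnot)
      rwa [h.time.right_inv u hu] at this
    · have ht := h.time.map_target u hu
      generalize hσ : σ u = t at ht
      obtain rfl : u = τ t := by rw [← hσ, h.time.right_inv u hu]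
      obtain ⟨ha, hb, v, w, hv, hw, hr⟩ := h2 t ht _ (hwall C hC) ((hmem t ht C).2 hCu)
      refine ⟨fun C' hC' hCu' => ?_, ?_, ?_⟩
      · exact eq_of_preimage_eq (hW C' hC') (hW C hC)
          (ha _ (hwall C' hC') ((hmem t ht C').2 hCu'))
      · filter_upwards [(h.tendsto_symm_punctured ht).eventually hb, mem_nhdsWithin_of_mem_nhds
          (h.time.isOpen_target.mem_nhds hu)] with s hs1 hs2 C' hC' hs3
        refine hs1 _ (hwall C' hC') ((hmem _ (h.time.map_target s hs2) C').2 ?_)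
        rwa [h.time.right_inv s hs2]
      · refine ⟨_, _, h.hasDerivWithinAt_image ht hv (h.symm_map_Iic ht),
          h.hasDerivWithinAt_image ht hw (h.symm_map_Ici ht), ?_⟩
        obtain ⟨hvt, hwt⟩ := mem_tangent_of_reflects (hsub C) hr
        rw [h.apply_eq t ht]
        exact ((reflects_squareMap_iff (hW C hC) (h.mem t ht) hvt hwt).1 hr).smul _
  · rintro ⟨-, -, -, -, h1, h2⟩
    refine ⟨h.time.isOpen_source, h.source_ordConnected, h.continuousOn,
      h.mem, fun t ht hCt => ?_, ?_⟩
    · have hnot : ∀ C ∈ W, Γ (τ t) ∉ C := fun C hC hK =>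
        hCt _ (hwall C hC) ((hmem t ht C).2 hK)
      exact (h.newtonAt_iff ht m E W _).2 (h1 _ (h.time.map_source t ht) hnot)
    · rintro t ht _ ⟨C, hC, rfl⟩ hCt
      obtain ⟨ha, hb, V, V', hV, hV', hr⟩ :=
        h2 (τ t) (h.time.map_source t ht) C hC ((hmem t ht C).1 hCt)
      refine ⟨?_, ?_, ?_⟩
      · rintro _ ⟨C', hC', rfl⟩ hCt'
        rw [ha C' hC' ((hmem t ht C').1 hCt')]
      · filter_upwards [(h.tendsto_punctured ht).eventually hb, mem_nhdsWithin_of_mem_nhds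
          (h.time.isOpen_source.mem_nhds ht)] with s hs1 hs2
        rintro _ ⟨C', hC', rfl⟩ hs3
        exact hs1 C' hC' ((hmem s hs2 C').1 hs3)
      · obtain ⟨hVt, hVt'⟩ := mem_tangent_of_reflects (fun x hx => (hW C hC hx).1) hr
        obtain ⟨v, hvt, hv, hv2⟩ :=
          h.hasDerivWithinAt_preimage ht hV (h.map_Iic ht) hVt
        obtain ⟨w, hwt, hw, hw2⟩ :=
          h.hasDerivWithinAt_preimage ht hV' (h.map_Ici ht) hVt'
        refine ⟨v, w, hv, hw, (reflects_squareMap_iff (hW C hC) (h.mem t ht) hvt hwt).2 ?_⟩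
        rw [hv2, hw2, ← h.apply_eq t ht]
        exact hr.smul _

theorem isConformalTransformation_squareMap (g : Geom) {W : Set (Set V3)}
    (hW : ∀ C ∈ W, C ⊆ Geom.hyperbolic.punctured) (m E : ℝ) :
    IsConformalTransformation squareMap (hookeBilliard g (E + g.sign * m) (g.squareRootWalls W))
      (keplerBilliard m W) (2 * m) E := by
  refine ⟨fun q hq => squareMap_mem_punctured hq, squareMap_surjOn g, fun q hq =>
    ⟨contDiffAt_squareMap hq.1, fun u hu => fderiv_squareMap_mem_tangent hq.1 hu, g.factor q,
      Geom.factor_pos hq, fun u hu v hv => form_fderiv_squareMap hq.1 hu hv⟩, rfl,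
    fun C hC q hq _ v hv w hw => reflects_squareMap_iff (hW C hC) hq hv hw, g.factor,
    fun q hq => (Geom.contDiffAt_factor hq.1).contDiffWithinAt, fun q hq => Geom.factor_pos hq,
    fun I γ hγ => ?_, fun J Γ hΓ t₀ ht₀ q₀ hq₀ h => ?_⟩
  · obtain ⟨J, Γ, τ, σ, h⟩ := exists_related_of_curve hγ.1 hγ.2.1 hγ.2.2.1 hγ.2.2.2.1
    exact ⟨J, Γ, τ, (h.isTrajectory_iff hW m E).1 hγ, h.carries⟩
  · obtain ⟨I, γ, τ, σ, h, hs⟩ :=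
      exists_related_of_image hΓ.1 hΓ.2.1 hΓ.2.2.1 hΓ.2.2.2.1 ht₀ hq₀ h
    exact ⟨I, γ, τ, (h.isTrajectory_iff hW m E).2 hΓ, h.carries, hs⟩

/-! ### Lifts of points of the phase space -/

theorem stereo_halfTurn (q : V3) : stereo (halfTurn q) = -stereo q := by
  apply Complex.ext <;> simp [stereo, halfTurn, neg_div]

theorem halfTurn_mem_surface {g : Geom} {q : V3} (hq : q ∈ g.surface) :
    halfTurn q ∈ g.surface := by
  refine ⟨?_, hq.2⟩
  rw [← hq.1]
  simp [Geom.form, halfTurn]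

theorem halfTurn_mem_punctured {g : Geom} {q : V3} (hq : q ∈ g.punctured) :
    halfTurn q ∈ g.punctured :=
  ⟨halfTurn_mem_surface hq.1, fun h => stereo_ne_zero hq (by
    rw [← neg_neg (stereo q), ← stereo_halfTurn, h, stereo_southPole, neg_zero])⟩

theorem squareMap_halfTurn (q : V3) : squareMap (halfTurn q) = squareMap q := by
  rw [squareMap_eq, squareMap_eq, stereo_halfTurn, neg_sq]

theorem factor_halfTurn (g : Geom) (q : V3) : g.factor (halfTurn q) = g.factor q := by
  simp [Geom.factor, stereo_halfTurn]

theorem contDiff_halfTurn : ContDiff ℝ ∞ halfTurn := by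
  unfold halfTurn
  fun_prop

theorem hasDerivAt_halfTurn {c : ℝ → V3} {v : V3} {t : ℝ} (h : HasDerivAt c v t) :
    HasDerivAt (fun s => halfTurn (c s)) (halfTurn v) t :=
  (hasDerivAt_fst h).fun_neg.prodMk
    ((hasDerivAt_fst (hasDerivAt_snd h)).fun_neg.prodMk (hasDerivAt_snd (hasDerivAt_snd h)))

theorem halfTurn_mem_tangent {g : Geom} {q v : V3} (hv : v ∈ g.tangent q) :
    halfTurn v ∈ g.tangent (halfTurn q) := by
  have h : g.form q v = 0 := hv
  show g.form (halfTurn q) (halfTurn v) = 0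
  rw [← h]
  simp [Geom.form, halfTurn]

theorem fderiv_squareMap_halfTurn {g : Geom} {q v : V3} (hq : q ∈ g.punctured)
    (hv : v ∈ g.tangent q) :
    fderiv ℝ squareMap (halfTurn q) (halfTurn v) = fderiv ℝ squareMap q v := by
  rw [← velocities_punctured hq] at hv
  obtain ⟨c, rfl, hc, hd⟩ := hv
  have h1 := hasDerivAt_squareMap_comp (g := g) hq.1 hd
  have h2 := hasDerivAt_squareMap_comp (g := g) (halfTurn_mem_surface hq.1) (hasDerivAt_halfTurn hd)
  simp only [squareMap_halfTurn] at h2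
  exact h2.unique h1

/-- The phase point `x` on the Hooke side lies above the phase point `X` on the Kepler side; the
velocities are those with respect to the respective times. -/
def IsLift (g : Geom) (x X : V3 × V3) : Prop :=
  x.1 ∈ g.punctured ∧ x.2 ∈ g.tangent x.1 ∧ squareMap x.1 = X.1 ∧
    fderiv ℝ squareMap x.1 x.2 = g.factor x.1 • X.2

/-- The phase point below `x`. -/
def project (g : Geom) (x : V3 × V3) : V3 × V3 :=
  (squareMap x.1, (g.factor x.1)⁻¹ • fderiv ℝ squareMap x.1 x.2)

/-- The lift of phase points that belongs to a local section `ψ` of the square mapping. -/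
def liftBy (g : Geom) (ψ : V3 → V3) (X : V3 × V3) : V3 × V3 :=
  (ψ X.1, g.factor (ψ X.1) • fderiv ℝ ψ X.1 X.2)

/-- The half turn, acting on phase points. -/
def phaseTurn (x : V3 × V3) : V3 × V3 := (halfTurn x.1, halfTurn x.2)

theorem contDiff_phaseTurn : ContDiff ℝ ∞ phaseTurn :=
  (contDiff_halfTurn.comp contDiff_fst).prodMk (contDiff_halfTurn.comp contDiff_snd)

theorem phaseTurn_phaseTurn (x : V3 × V3) : phaseTurn (phaseTurn x) = x := by
  simp [phaseTurn, halfTurn]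

theorem isLift_project {g : Geom} {x : V3 × V3} (h1 : x.1 ∈ g.punctured)
    (h2 : x.2 ∈ g.tangent x.1) : IsLift g x (project g x) :=
  ⟨h1, h2, rfl, by rw [project, smul_inv_smul₀ (Geom.factor_pos h1).ne']⟩

theorem IsLift.project_eq {g : Geom} {x X : V3 × V3} (h : IsLift g x X) : project g x = X := by
  refine Prod.ext h.2.2.1 ?_
  rw [project, h.2.2.2, inv_smul_smul₀ (Geom.factor_pos h.1).ne']

theorem IsLift.mem_punctured {g : Geom} {x X : V3 × V3} (h : IsLift g x X) :
    X.1 ∈ Geom.hyperbolic.punctured := h.2.2.1 ▸ squareMap_mem_punctured h.1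

theorem IsLift.mem_tangent {g : Geom} {x X : V3 × V3} (h : IsLift g x X) :
    X.2 ∈ Geom.hyperbolic.tangent X.1 := by
  rw [← h.project_eq]
  exact smul_mem_tangent (fderiv_squareMap_mem_tangent h.1.1 h.2.1) _

theorem IsLift.phaseTurn {g : Geom} {x X : V3 × V3} (h : IsLift g x X) :
    IsLift g (phaseTurn x) X :=
  ⟨halfTurn_mem_punctured h.1, halfTurn_mem_tangent h.2.1, by
    rw [← h.2.2.1]; exact squareMap_halfTurn _, by
    simp only [ConicBilliards.phaseTurn]
    rw [fderiv_squareMap_halfTurn h.1 h.2.1, h.2.2.2, factor_halfTurn]⟩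

theorem IsLift.eq_of_fst_eq {g : Geom} {x y X : V3 × V3} (hx : IsLift g x X) (hy : IsLift g y X)
    (h : y.1 = x.1) : y = x := by
  refine Prod.ext h (fderiv_squareMap_injOn hx.1 (h ▸ hy.2.1) hx.2.1 ?_)
  rw [hx.2.2.2, ← h, hy.2.2.2]

theorem IsLift.eq_or_eq {g : Geom} {x y X : V3 × V3} (hx : IsLift g x X) (hy : IsLift g y X) :
    y = x ∨ y = ConicBilliards.phaseTurn x := by
  have h1 : stereo y.1 ^ 2 = stereo x.1 ^ 2 := by
    rw [← stereo_squareMap hx.1.1, ← stereo_squareMap hy.1.1, hx.2.2.1, hy.2.2.1]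
  rcases sq_eq_sq_iff_eq_or_eq_neg.1 h1 with h | h
  · exact Or.inl (hx.eq_of_fst_eq hy (by rw [← chart_stereo hx.1.1, ← h, chart_stereo hy.1.1]))
  · refine Or.inr (hx.phaseTurn.eq_of_fst_eq hy ?_)
    rw [← chart_stereo hx.phaseTurn.1.1, ← chart_stereo hy.1.1, h]
    exact congrArg g.chart (stereo_halfTurn _).symm

theorem contDiffAt_project {g : Geom} {x : V3 × V3} (h : x.1 ∈ g.punctured) :
    ContDiffAt ℝ ∞ (project g) x := by
  have h1 := contDiffAt_squareMap h.1
  have h2 := Geom.contDiffAt_factor h.1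
  have h3 : ContDiffAt ℝ ∞ (fderiv ℝ squareMap) x.1 := h1.fderiv_right (by simp)
  exact (h1.comp x contDiffAt_fst).prodMk
    (((h2.inv (Geom.factor_pos h).ne').comp x contDiffAt_fst).smul
      ((h3.comp x contDiffAt_fst).clm_apply contDiffAt_snd))

theorem IsSection.contDiffAt_liftBy {g : Geom} {q V : V3} {ψ : V3 → V3} (h : IsSection g q ψ)
    (hq : q ∈ g.punctured) : ContDiffAt ℝ ∞ (liftBy g ψ) (squareMap q, V) := by
  have h1 := h.contDiffAt
  have h2 : ContDiffAt ℝ ∞ g.factor (ψ (squareMap q)) := by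
    rw [h.apply_eq]; exact Geom.contDiffAt_factor hq.1
  have h3 : ContDiffAt ℝ ∞ (fderiv ℝ ψ) (squareMap q) := h1.fderiv_right (by simp)
  have h4 : ContDiffAt ℝ ∞ (fun X : V3 × V3 => ψ X.1) (squareMap q, V) :=
    ContDiffAt.comp (g := ψ) (squareMap q, V) h1 contDiffAt_fst
  refine h4.prodMk ((ContDiffAt.comp (g := g.factor) (squareMap q, V) h2 h4).smul
    (ContDiffAt.clm_apply (ContDiffAt.comp (g := fderiv ℝ ψ) (squareMap q, V) h3 contDiffAt_fst)
    contDiffAt_snd))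

theorem IsSection.eventually_isLift {g : Geom} {q V : V3} {ψ : V3 → V3} (h : IsSection g q ψ) :
    ∀ᶠ X in 𝓝 (squareMap q, V), X.1 ∈ Geom.hyperbolic.punctured →
      X.2 ∈ Geom.hyperbolic.tangent X.1 → IsLift g (liftBy g ψ X) X := by
  have h1 : Filter.Tendsto Prod.fst (𝓝 (squareMap q, V)) (𝓝 (squareMap q)) :=
    continuousAt_fst
  filter_upwards [h1.eventually h.right_inv, h1.eventually h.eventually_fderiv] with X h1 h2 h3 h4
  have h5 := h2 h3 _ h4
  refine ⟨(h1 h3).1, smul_mem_tangent h5.1 _, (h1 h3).2, ?_⟩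
  simp only [liftBy]
  rw [map_smul, h5.2]

theorem IsLift.liftBy_eq {g : Geom} {x X : V3 × V3} (h : IsLift g x X) {ψ : V3 → V3}
    (hψ : IsSection g x.1 ψ) : liftBy g ψ X = x := by
  have h1 := (hψ.eventually_isLift (V := X.2)).self_of_nhds
  rw [h.2.2.1] at h1
  refine h.eq_of_fst_eq (h1 h.mem_punctured h.mem_tangent) ?_
  simp only [liftBy, ← h.2.2.1, hψ.apply_eq]

theorem exists_isLift {g : Geom} {X : V3 × V3} (h1 : X.1 ∈ Geom.hyperbolic.punctured)
    (h2 : X.2 ∈ Geom.hyperbolic.tangent X.1) : ∃ x, IsLift g x X := by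
  obtain ⟨q, hq, h⟩ := squareMap_surjOn g h1
  obtain ⟨ψ, hψ⟩ := exists_isSection hq
  have h3 := (hψ.eventually_isLift (V := X.2)).self_of_nhds
  rw [h] at h3
  exact ⟨_, h3 h1 h2⟩

/-- The relation between the force functions that makes the Jacobi metrics coincide; note that
`Geom.factor` is the Hooke force function with factor `1`. -/
theorem factor_mul_keplerForce {g : Geom} {q : V3} (hq : q ∈ g.punctured) (m : ℝ) :
    g.factor q * keplerForce m (squareMap q) = 2 * m + g.sign * m * g.factor q := by
  have h1 := stereo_ne_zero hq
  have h2 := (g.one_sub_pos (normSq_stereo_lt_one hq.1)).ne'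
  have h3 : ‖stereo q ^ 2‖ = Complex.normSq (stereo q) := by
    rw [norm_pow, Complex.normSq_eq_norm_sq]
  have h4 := (Complex.normSq_pos.2 h1).ne'
  rw [keplerForce_eq m (squareMap_mem_punctured hq), stereo_squareMap hq.1, h3, normSq_sq,
    Geom.factor]
  have hs := g.sign_sq
  generalize Complex.normSq (stereo q) = n at *
  generalize hM : 1 - g.sign * n = M at *
  field_simp
  subst hM
  linear_combination (-m * n ^ 2 * 4) * hs

/-- Corresponding phase points lie on corresponding energy hypersurfaces. -/
theorem IsLift.mem_level_iff {g : Geom} {x X : V3 × V3} (h : IsLift g x X) (m E : ℝ)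
    (W W' : Set (Set V3)) :
    x ∈ (hookeBilliard g (E + g.sign * m) W').level (2 * m) ↔ X ∈ (keplerBilliard m W).level E := by
  have hl := (Geom.factor_pos h.1).ne'
  have h1 : g.factor x.1 * Geom.hyperbolic.form X.2 X.2 = g.form x.2 x.2 := by
    have h2 := form_fderiv_squareMap h.1.1 h.2.1 h.2.1
    rw [h.2.2.2, smul_form, form_smul] at h2
    exact mul_left_cancel₀ hl h2
  have h2 := factor_mul_keplerForce h.1 m
  rw [h.2.2.1] at h2
  have h3 : (hookeBilliard g (E + g.sign * m) W').energy x.1 x.2 - 2 * m =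
      g.factor x.1 * ((keplerBilliard m W).energy X.1 X.2 - E) := by
    simp only [Billiard.energy, hookeBilliard, keplerBilliard]
    rw [hookeForce_eq g _ h.1, ← h1]
    linear_combination h2
  have h4 : (hookeBilliard g (E + g.sign * m) W').energy x.1 x.2 = 2 * m ↔
      (keplerBilliard m W).energy X.1 X.2 = E := by
    rw [← sub_eq_zero, h3, mul_eq_zero, or_iff_right hl, sub_eq_zero]
  exact ⟨fun hx => ⟨h.mem_punctured, h.mem_tangent, h4.1 hx.2.2⟩,
    fun hX => ⟨h.1, h.2.1, h4.2 hX.2.2⟩⟩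

theorem phaseTurn_mem_level {g : Geom} {x : V3 × V3} {m E : ℝ} {W : Set (Set V3)}
    (h : x ∈ (hookeBilliard g (E + g.sign * m) W).level (2 * m)) :
    phaseTurn x ∈ (hookeBilliard g (E + g.sign * m) W).level (2 * m) := by
  have h1 := isLift_project h.1 h.2.1
  exact (h1.phaseTurn.mem_level_iff m E ∅ W).2 ((h1.mem_level_iff m E ∅ W).1 h)

/-! ### Correspondence of the motions -/

theorem Related.isMotion_iff {g : Geom} {I J : Set ℝ} {γ Γ : ℝ → V3} {τ σ : ℝ → ℝ}
    (h : Related g I J γ Γ τ σ) (m E : ℝ) (W W' : Set (Set V3)) :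
    (hookeBilliard g (E + g.sign * m) W').IsMotion (2 * m) I γ ↔
      (keplerBilliard m W).IsMotion E J Γ := by
  constructor
  · rintro ⟨-, -, h1⟩
    refine ⟨h.time.isOpen_target, h.target_ordConnected, fun u hu => ⟨h.mem_image hu, ?_⟩⟩
    have ht := h.time.map_target u hu
    have := (h.newtonAt_iff ht m E W W').1 (h1 _ ht).2
    rwa [h.time.right_inv u hu] at this
  · rintro ⟨-, -, h1⟩
    exact ⟨h.time.isOpen_source, h.source_ordConnected, fun t ht => ⟨h.mem t ht,
      (h.newtonAt_iff ht m E W W').2 (h1 _ (h.time.map_source t ht)).2⟩⟩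

theorem Related.isLift_deriv {g : Geom} {I J : Set ℝ} {γ Γ : ℝ → V3} {τ σ : ℝ → ℝ}
    (h : Related g I J γ Γ τ σ) {t : ℝ} (ht : t ∈ I) (hd : DifferentiableAt ℝ γ t) :
    IsLift g (γ t, deriv γ t) (Γ (τ t), deriv Γ (τ t)) := by
  refine ⟨h.mem t ht, mem_tangent_of_hasDerivAt hd.hasDerivAt
    ((h.eventually_mem ht).mono fun _ hs => hs.1), (h.apply_eq t ht).symm, ?_⟩
  have h1 := h.hasDerivWithinAt_image ht (hd.hasDerivAt.hasDerivWithinAt (s := Set.univ))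
    (S := Set.univ) (fun _ _ _ => Set.mem_univ _)
  rw [hasDerivWithinAt_univ] at h1
  simp only [h1.deriv]
  rw [smul_inv_smul₀ (Geom.factor_pos (h.mem t ht)).ne']

theorem Related.halfTurn {g : Geom} {I J : Set ℝ} {γ Γ : ℝ → V3} {τ σ : ℝ → ℝ}
    (h : Related g I J γ Γ τ σ) : Related g I J (fun t => halfTurn (γ t)) Γ τ σ where
  time := h.time.congr fun t _ => factor_halfTurn g (γ t)
  source_ordConnected := h.source_ordConnected
  target_ordConnected := h.target_ordConnected
  continuousOn := contDiff_halfTurn.continuous.comp_continuousOn h.continuousOn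
  mem t ht := halfTurn_mem_punctured (h.mem t ht)
  apply_eq t ht := by rw [squareMap_halfTurn]; exact h.apply_eq t ht

theorem Billiard.IsMotion.differentiableAt {S : Billiard} {e : ℝ} {I : Set ℝ} {γ : ℝ → V3}
    (h : S.IsMotion e I γ) {t : ℝ} (ht : t ∈ I) : DifferentiableAt ℝ γ t :=
  (h.2.2 t ht).2.1.1.self_of_nhds

theorem Billiard.IsMotion.continuousOn {S : Billiard} {e : ℝ} {I : Set ℝ} {γ : ℝ → V3}
    (h : S.IsMotion e I γ) : ContinuousOn γ I :=
  fun _ ht => (h.differentiableAt ht).continuousAt.continuousWithinAt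

/-! ### From Kepler to Hooke: first integrals pull back -/

/-- The Hooke billiards of the family, with parameters `(m, E)`. -/
abbrev hookeFamily (g : Geom) (W : Set (Set V3)) (p : ℝ × ℝ) : Billiard :=
  hookeBilliard g (p.2 + g.sign * p.1) (g.squareRootWalls W)

theorem isIntegrable_hooke_of_kepler (g : Geom) {W : Set (Set V3)}
    (hW : ∀ C ∈ W, C ⊆ Geom.hyperbolic.punctured) {T : Set (ℝ × ℝ)}
    (h : IsIntegrable T (fun p => keplerBilliard p.1 W) (fun p => p.2)) :
    IsIntegrable T (hookeFamily g W) (fun p => 2 * p.1) := by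
  obtain ⟨F, hF, hmot, hrefl, hdense⟩ := h
  have hlev : ∀ p x, x ∈ (hookeFamily g W p).level (2 * p.1) →
      project g x ∈ (keplerBilliard p.1 W).level p.2 := fun p x hx =>
    ((isLift_project hx.1 hx.2.1).mem_level_iff p.1 p.2 W _).1 hx
  refine ⟨fun x => F (x.1, project g x.2), ?_, ?_, ?_, ?_⟩
  · intro x hx
    have h1 : ContDiffAt ℝ ∞ (fun x : (ℝ × ℝ) × V3 × V3 => (x.1, project g x.2)) x :=
      contDiffAt_fst.prodMk (ContDiffAt.comp x (contDiffAt_project hx.2.1) contDiffAt_snd)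
    exact ContDiffWithinAt.comp (g := F) x (hF _ ⟨hx.1, hlev _ _ hx.2⟩) h1.contDiffWithinAt
      fun y hy => ⟨hy.1, hlev _ _ hy.2⟩
  · intro p hp I γ hγ s hs t ht
    obtain ⟨J, Γ, τ, σ, hR⟩ := exists_related_of_curve hγ.1 hγ.2.1 (hγ.continuousOn)
      fun t ht => (hγ.2.2 t ht).1
    have h1 := (hR.isMotion_iff p.1 p.2 W _).1 hγ
    have h2 := hmot p hp J Γ h1 _ (hR.time.map_source s hs) _ (hR.time.map_source t ht)
    simp only [(hR.isLift_deriv hs (hγ.differentiableAt hs)).project_eq,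
      (hR.isLift_deriv ht (hγ.differentiableAt ht)).project_eq]
    exact h2
  · rintro p hp _ ⟨C, hC, rfl⟩ q hq v w hv hr
    obtain ⟨hvt, hwt⟩ := mem_tangent_of_reflects (g := g) (fun x hx => hx.1.1) hr
    have hr' := ((reflects_squareMap_iff (hW C hC) hq.1 hvt hwt).1 hr).smul (g.factor q)⁻¹
    exact hrefl p hp C hC (squareMap q) hq.2 ((g.factor q)⁻¹ • fderiv ℝ squareMap q v)
      ((g.factor q)⁻¹ • fderiv ℝ squareMap q w) (hlev p (q, v) hv) hr'
  · intro x hx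
    rw [mem_closure_iff_nhds]
    intro U hU
    have hL := isLift_project hx.2.1 hx.2.2.1
    obtain ⟨ψ, hψ⟩ := exists_isSection hx.2.1
    have hsm : ContDiffAt ℝ ∞ (liftBy g ψ) (project g x.2) := hψ.contDiffAt_liftBy hx.2.1
    have hcont : ContinuousAt (fun y : (ℝ × ℝ) × V3 × V3 => (y.1, liftBy g ψ y.2))
        (x.1, project g x.2) :=
      continuousAt_fst.prodMk (ContinuousAt.comp (g := liftBy g ψ) hsm.continuousAt continuousAt_snd)
    have hx0 : (x.1, liftBy g ψ (project g x.2)) = x := by rw [hL.liftBy_eq hψ]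
    have hsnd : Filter.Tendsto Prod.snd (𝓝 (x.1, project g x.2)) (𝓝 (project g x.2)) :=
      continuousAt_snd
    have hev := (hcont.eventually (p := fun y => y ∈ U) (by simp only [hx0]; exact hU)).and
      (hsnd.eventually (((hsm.of_le (show (1 : WithTop ℕ∞) ≤ ∞ by norm_cast)).eventually
        (by simp)).and hψ.eventually_isLift.eventually_nhds))
    have hx1 : (x.1, project g x.2) ∈
        familyLevel T (fun p => keplerBilliard p.1 W) (fun p => p.2) := ⟨hx.1, hlev _ _ hx.2⟩
    obtain ⟨Y, ⟨hYU, hYd, hYl⟩, hYX, c, hc0, hc, hcd, hcF⟩ :=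
      mem_closure_iff_nhds.1 (hdense hx1) _ hev
    have hlift : ∀ᶠ t in 𝓝 (0 : ℝ), IsLift g (liftBy g ψ (c t)) (c t) := by
      have h1 := hcd.continuousAt.eventually (p := fun X => X.1 ∈ Geom.hyperbolic.punctured →
        X.2 ∈ Geom.hyperbolic.tangent X.1 → IsLift g (liftBy g ψ X) X) (by rw [hc0]; exact hYl)
      filter_upwards [h1, hc] with t h1 h2 using h1 h2.1 h2.2.1
    have hY : IsLift g (liftBy g ψ Y.2) Y.2 := by
      have := hlift.self_of_nhds
      rwa [hc0] at this
    refine ⟨(Y.1, liftBy g ψ Y.2), hYU, ⟨hYX.1, (hY.mem_level_iff Y.1.1 Y.1.2 W _).2 hYX.2⟩,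
      fun t => liftBy g ψ (c t), by simp only [hc0], ?_, ?_, ?_⟩
    · filter_upwards [hlift, hc] with t h1 h2 using (h1.mem_level_iff _ _ W _).2 h2
    · exact DifferentiableAt.comp (g := liftBy g ψ) 0
        (by rw [hc0]; exact hYd.differentiableAt (by simp)) hcd
    · have h1 : (fun t => F (Y.1, project g (liftBy g ψ (c t)))) =ᶠ[𝓝 0] fun t => F (Y.1, c t) := by
        filter_upwards [hlift] with t ht
        rw [ht.project_eq]
      rw [h1.deriv_eq]
      exact hcF

/-! ### Functions that are not locally constant on the energy hypersurfaces -/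

/-- The restriction of `f` to `X` is constant near `x`. -/
def LocallyConstantAt {E : Type*} [TopologicalSpace E] (f : E → ℝ) (X : Set E) (x : E) : Prop :=
  ∀ᶠ y in 𝓝[X] x, f y = f x

theorem RegularAt.not_locallyConstantAt {F : V3 × V3 → ℝ} {X : Set (V3 × V3)} {x : V3 × V3}
    (h : RegularAt F X x) : ¬ LocallyConstantAt F X x := by
  obtain ⟨c, rfl, hc, hd, hF⟩ := h
  intro hcon
  have h1 : Filter.Tendsto c (𝓝 0) (𝓝[X] (c 0)) :=
    tendsto_nhdsWithin_iff.2 ⟨hd.continuousAt, hc⟩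
  have h2 : (fun t => F (c t)) =ᶠ[𝓝 0] fun _ => F (c 0) := h1.eventually hcon
  exact hF (by rw [h2.deriv_eq, deriv_const])

/-- If `X` is near `x` the set of fixed points of a differentiable retraction onto `X`, then a
differentiable function that is not locally constant at `x` is regular at points nearby: it
changes along the image of a segment, by the mean value theorem. -/
theorem exists_regularAt_of_retraction {X : Set (V3 × V3)} {F : V3 × V3 → ℝ} {x : V3 × V3}
    {ρ : V3 × V3 → V3 × V3} (hx : x ∈ X)
    (h1 : ∀ᶠ y in 𝓝 x, DifferentiableAt ℝ ρ y ∧ ρ y ∈ X) (h2 : ∀ᶠ y in 𝓝 x, y ∈ X → ρ y = y)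
    (hF : ∀ y ∈ X, DifferentiableWithinAt ℝ F X y) (hn : ¬ LocallyConstantAt F X x)
    {U : Set (V3 × V3)} (hU : U ∈ 𝓝 x) : ∃ y ∈ U, y ∈ X ∧ RegularAt F X y := by
  have hρx : ρ x = x := h2.self_of_nhds hx
  have hρU : ∀ᶠ y in 𝓝 x, ρ y ∈ U := h1.self_of_nhds.1.continuousAt.eventually (by rwa [hρx])
  obtain ⟨r, hr, hball⟩ := Metric.eventually_nhds_iff_ball.1 (h1.and (h2.and hρU))
  obtain ⟨y, hyF, hyX, hyr⟩ : ∃ y, F y ≠ F x ∧ y ∈ X ∧ y ∈ Metric.ball x r := by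
    by_contra! hcon
    refine hn ?_
    filter_upwards [self_mem_nhdsWithin, mem_nhdsWithin_of_mem_nhds (Metric.ball_mem_nhds x hr)]
      with y hy1 hy2
    by_contra h
    exact hcon y h hy1 hy2
  have hseg : ∀ t ∈ Set.Icc (0 : ℝ) 1, x + t • (y - x) ∈ Metric.ball x r := by
    intro t ht
    rw [mem_ball_iff_norm] at hyr ⊢
    rw [add_sub_cancel_left, norm_smul, Real.norm_of_nonneg ht.1]
    exact lt_of_le_of_lt (mul_le_of_le_one_left (norm_nonneg _) ht.2) hyr
  have hc : ∀ t ∈ Set.Icc (0 : ℝ) 1, DifferentiableAt ℝ (fun t : ℝ => ρ (x + t • (y - x))) t ∧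
      ∀ᶠ s in 𝓝 t, ρ (x + s • (y - x)) ∈ X := by
    intro t ht
    have hl := hasDerivAt_line x (y - x) t
    refine ⟨DifferentiableAt.comp (g := ρ) t (hball _ (hseg t ht)).1.1 hl.differentiableAt, ?_⟩
    filter_upwards [hl.continuousAt.eventually (Metric.isOpen_ball.mem_nhds (hseg t ht))] with s hs
      using (hball _ hs).1.2
  have hFc : ∀ t ∈ Set.Icc (0 : ℝ) 1,
      DifferentiableAt ℝ (fun t : ℝ => F (ρ (x + t • (y - x)))) t := by
    intro t ht
    have h3 : DifferentiableWithinAt ℝ (fun t : ℝ => F (ρ (x + t • (y - x))))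
        {s : ℝ | ρ (x + s • (y - x)) ∈ X} t :=
      DifferentiableWithinAt.comp (g := F) (f := fun t : ℝ => ρ (x + t • (y - x))) t
        (hF _ (hc t ht).2.self_of_nhds) (hc t ht).1.differentiableWithinAt fun s hs => hs
    exact h3.differentiableAt (hc t ht).2
  obtain ⟨t, ht, hslope⟩ := exists_deriv_eq_slope (fun t : ℝ => F (ρ (x + t • (y - x))))
    zero_lt_one (fun t ht => (hFc t ht).continuousAt.continuousWithinAt)
    fun t ht => (hFc t (Set.Ioo_subset_Icc_self ht)).differentiableWithinAt
  have ht' := Set.Ioo_subset_Icc_self ht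
  refine ⟨_, (hball _ (hseg t ht')).2.2, (hball _ (hseg t ht')).1.2,
    fun s => ρ (x + (t + s) • (y - x)), by simp, ?_, ?_, ?_⟩
  · have h3 : Filter.Tendsto (fun s => t + s) (𝓝 0) (𝓝 t) := by
      have : ContinuousAt (fun s : ℝ => t + s) 0 := by fun_prop
      simpa [ContinuousAt] using this
    exact h3.eventually (hc t ht').2
  · refine DifferentiableAt.comp (g := fun t : ℝ => ρ (x + t • (y - x))) (f := fun s => t + s) 0 ?_
      (by fun_prop)
    simpa using (hc t ht').1
  · have h3 := deriv_comp_const_add (f := fun t : ℝ => F (ρ (x + t • (y - x)))) t 0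
    rw [h3, add_zero, hslope]
    simpa [hρx, h2.self_of_nhds hx, (hball _ hyr).2.1 hyX, sub_eq_zero] using hyF

/-- Of two functions `A` and `B` such that at a dense set of points not both are locally constant,
a suitable combination `A + c B²` has a dense set of points where it is not locally constant:
each point of a countable dense set excludes at most one value of `c`. -/
theorem exists_add_mul_sq_not_locallyConstantAt {P E : Type*} [TopologicalSpace P]
    [TopologicalSpace E] [SecondCountableTopology P] [SecondCountableTopology E]
    [TopologicalSpace.PseudoMetrizableSpace P] [TopologicalSpace.PseudoMetrizableSpace E]
    {X : Set (P × E)} {L : P → Set E} {A B : P → E → ℝ}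
    (hB : ∀ x ∈ X, ContinuousWithinAt (B x.1) (L x.1) x.2)
    (hd : X ⊆ closure {x | x ∈ X ∧
      ¬ (LocallyConstantAt (A x.1) (L x.1) x.2 ∧ LocallyConstantAt (B x.1) (L x.1) x.2)}) :
    ∃ c : ℝ, X ⊆ closure {x | x ∈ X ∧
      ¬ LocallyConstantAt (fun y => A x.1 y + c * B x.1 y ^ 2) (L x.1) x.2} := by
  obtain ⟨t, htD, htc, hDt⟩ := (TopologicalSpace.IsSeparable.of_separableSpace
    {x | x ∈ X ∧ ¬ (LocallyConstantAt (A x.1) (L x.1) x.2 ∧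
      LocallyConstantAt (B x.1) (L x.1) x.2)}).exists_countable_dense_subset
  have hbad : (⋃ x ∈ t, {c : ℝ |
      LocallyConstantAt (fun y => A x.1 y + c * B x.1 y ^ 2) (L x.1) x.2}).Countable := by
    refine htc.biUnion fun x hx => Set.Subsingleton.countable fun c hc c' hc' => ?_
    by_contra hne
    refine (htD hx).2 ?_
    have hsq : ∀ᶠ y in 𝓝[L x.1] x.2, B x.1 y ^ 2 = B x.1 x.2 ^ 2 := by
      filter_upwards [hc, hc'] with y h1 h2
      have h3 : (c - c') * (B x.1 y ^ 2 - B x.1 x.2 ^ 2) = 0 := by linear_combination h1 - h2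
      rcases mul_eq_zero.1 h3 with h4 | h4
      · exact absurd (sub_eq_zero.1 h4) hne
      · linarith
    refine ⟨?_, ?_⟩
    · filter_upwards [hc, hsq] with y h1 h2
      rw [h2] at h1
      linarith
    · -- the sign of `B` cannot jump, by continuity
      by_cases h0 : B x.1 x.2 = 0
      · filter_upwards [hsq] with y h1
        rw [h0] at h1 ⊢
        simpa using h1
      · have h3 : ∀ᶠ y in 𝓝[L x.1] x.2, B x.1 y + B x.1 x.2 ≠ 0 :=
          ((hB x (htD hx).1).add continuousWithinAt_const).eventually_ne
            (by simpa [← two_mul] using h0)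
        filter_upwards [hsq, h3] with y h1 h2
        rcases sq_eq_sq_iff_eq_or_eq_neg.1 h1 with h4 | h4
        · exact h4
        · exact absurd (by rw [h4]; ring) h2
  obtain ⟨c, hc⟩ := (hbad.dense_compl ℝ).nonempty
  refine ⟨c, hd.trans (closure_minimal (hDt.trans (closure_mono fun x hx => ?_)) isClosed_closure)⟩
  refine ⟨(htD hx).1, fun h => hc ?_⟩
  exact Set.mem_biUnion hx h

/-! ### The energy hypersurfaces of the Hooke problem -/

theorem fderiv_stereo_chartDeriv (g : Geom) {ζ : ℂ} (h : Complex.normSq ζ < 1) (ξ : ℂ) :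
    fderiv ℝ stereo (g.chart ζ) (g.chartDeriv ζ ξ) = ξ := by
  have h1 := hasDerivAt_line ζ ξ 0
  have h0 : ζ + (0 : ℝ) • ξ = ζ := by simp
  have h2 := g.hasDerivAt_chart h1 (by simpa using h)
  have h3 := hasDerivAt_comp_curve (f := stereo)
    (by simpa using differentiableAt_stereo (g.chart_mem_surface h)) h2
  simp only [h0] at h3
  refine h3.unique (h1.congr_of_eventuallyEq ?_)
  filter_upwards [h1.continuousAt.eventually (eventually_normSq_lt (by simpa using h))] with s hs
  exact stereo_chart g hs

/-- Positions and velocities in the chart. -/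
def planePhase (x : V3 × V3) : ℂ × ℂ := (stereo x.1, fderiv ℝ stereo x.1 x.2)

/-- Phase points from positions and velocities in the chart. -/
def Geom.phase (g : Geom) (x : ℂ × ℂ) : V3 × V3 := (g.chart x.1, fderiv ℝ g.chart x.1 x.2)

theorem phase_planePhase {g : Geom} {x : V3 × V3} (h1 : x.1 ∈ g.surface)
    (h2 : x.2 ∈ g.tangent x.1) : g.phase (planePhase x) = x := by
  have hlt := normSq_stereo_lt_one h1
  obtain ⟨ξ, hξ⟩ := (mem_tangent_iff h1).1 h2
  have h3 := fderiv_stereo_chartDeriv g hlt ξ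
  rw [chart_stereo h1, hξ] at h3
  simp only [Geom.phase, planePhase, chart_stereo h1]
  rw [g.fderiv_chart hlt, h3, hξ]

theorem contDiffAt_phase (g : Geom) {x : ℂ × ℂ} (h : Complex.normSq x.1 < 1) :
    ContDiffAt ℝ ∞ g.phase x := by
  have h1 := g.contDiffAt_chart h
  have h3 : ContDiffAt ℝ ∞ (fderiv ℝ g.chart) x.1 := h1.fderiv_right (by simp)
  exact (h1.comp x contDiffAt_fst).prodMk ((h3.comp x contDiffAt_fst).clm_apply contDiffAt_snd)

theorem contDiffAt_planePhase {x : V3 × V3} (h : 1 - x.1.2.2 ≠ 0) :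
    ContDiffAt ℝ ∞ planePhase x := by
  have h1 := contDiffAt_stereo h
  have h3 : ContDiffAt ℝ ∞ (fderiv ℝ stereo) x.1 := h1.fderiv_right (by simp)
  exact (h1.comp x contDiffAt_fst).prodMk ((h3.comp x contDiffAt_fst).clm_apply contDiffAt_snd)

/-- The squared Euclidean speed in the chart that is determined by the energy `e`. -/
def Geom.speedSq (g : Geom) (f e : ℝ) (ζ : ℂ) : ℝ :=
  (e + f * g.planeFactor ζ) * (1 + g.sign * Complex.normSq ζ) ^ 2 / 2

theorem differentiableAt_normSq (ζ : ℂ) : DifferentiableAt ℝ Complex.normSq ζ := by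
  have h : (Complex.normSq : ℂ → ℝ) = fun z => z.re * z.re + z.im * z.im :=
    funext Complex.normSq_apply
  rw [show (⇑Complex.normSq) = fun z : ℂ => z.re * z.re + z.im * z.im from h]
  exact (Complex.reCLM.differentiableAt.mul Complex.reCLM.differentiableAt).add
    (Complex.imCLM.differentiableAt.mul Complex.imCLM.differentiableAt)

theorem Geom.differentiableAt_speedSq (g : Geom) (f e : ℝ) {ζ : ℂ} (h : Complex.normSq ζ < 1) :
    DifferentiableAt ℝ (g.speedSq f e) ζ := by
  have h1 := differentiableAt_normSq ζ
  have h2 : DifferentiableAt ℝ g.planeFactor ζ := by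
    unfold Geom.planeFactor
    simp only [div_eq_mul_inv]
    exact (h1.const_mul 4).fun_mul
      ((((h1.const_mul g.sign).const_sub 1).fun_pow 2).fun_inv (pow_ne_zero 2 (g.one_sub_pos h).ne'))
  unfold Geom.speedSq
  simp only [div_eq_mul_inv]
  exact (((h2.const_mul f).const_add e).fun_mul
    (((h1.const_mul g.sign).const_add 1).fun_pow 2)).mul_const _

theorem phase_mem_level_iff (g : Geom) (f e : ℝ) (W : Set (Set V3)) {x : ℂ × ℂ}
    (h : Complex.normSq x.1 < 1) (h0 : x.1 ≠ 0) :
    g.phase x ∈ (hookeBilliard g f W).level e ↔ Complex.normSq x.2 = g.speedSq f e x.1 := by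
  have h1 := g.chart_mem_punctured h h0
  have hD := (g.one_add_pos h).ne'
  have h2 : (hookeBilliard g f W).energy (g.phase x).1 (g.phase x).2 = e ↔
      Complex.normSq x.2 = g.speedSq f e x.1 := by
    simp only [Billiard.energy, hookeBilliard, Geom.phase]
    rw [hookeForce_eq g f h1, g.fderiv_chart h, form_chartDeriv g h,
      show g.factor (g.chart x.1) = g.planeFactor x.1 by
        rw [Geom.factor, stereo_chart g h, Geom.planeFactor], ← normSq_eq_dot, Geom.speedSq,
      Geom.scale]
    generalize g.planeFactor x.1 = l
    constructor <;> intro h3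
    · rw [← h3]; field_simp; ring
    · rw [h3]; field_simp; ring
  refine ⟨fun h3 => h2.1 h3.2.2, fun h3 => ⟨h1, ?_, h2.2 h3⟩⟩
  simp only [Geom.phase, hookeBilliard]
  rw [g.fderiv_chart h]
  exact chartDeriv_mem_tangent g h _

/-- In the chart, the energy hypersurface is a differentiable retract near each of its points
with nonzero velocity: the direction of the velocity is kept, its length is adjusted. If `e` and
`f` vanish, then all velocities are zero. -/
theorem exists_chart_retraction (g : Geom) {f e : ℝ} {x : ℂ × ℂ} (h : Complex.normSq x.1 < 1)
    (hx : Complex.normSq x.2 = g.speedSq f e x.1) (hv : x.2 ≠ 0 ∨ (e = 0 ∧ f = 0)) :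
    ∃ R : ℂ × ℂ → ℂ × ℂ, ∀ᶠ w in 𝓝 x, DifferentiableAt ℝ R w ∧ (R w).1 = w.1 ∧
      Complex.normSq (R w).2 = g.speedSq f e w.1 ∧
      (Complex.normSq w.2 = g.speedSq f e w.1 → R w = w) := by
  rcases hv with hv | ⟨rfl, rfl⟩
  · have hpos : 0 < g.speedSq f e x.1 := by rw [← hx]; exact Complex.normSq_pos.2 hv
    have hfst : Filter.Tendsto Prod.fst (𝓝 x) (𝓝 x.1) := continuousAt_fst
    have hsnd : Filter.Tendsto Prod.snd (𝓝 x) (𝓝 x.2) := continuousAt_snd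
    refine ⟨fun w => (w.1, (√(g.speedSq f e w.1) / ‖w.2‖) • w.2), ?_⟩
    filter_upwards [hfst.eventually (eventually_normSq_lt h),
      hfst.eventually ((g.differentiableAt_speedSq f e h).continuousAt.eventually
        (lt_mem_nhds hpos)), hsnd.eventually (eventually_ne_nhds hv)] with w h1 h2 h3
    have h4 := norm_pos_iff.2 h3
    refine ⟨?_, rfl, ?_, fun h5 => ?_⟩
    · have h5 : DifferentiableAt ℝ (fun w : ℂ × ℂ => √(g.speedSq f e w.1)) w :=
        (DifferentiableAt.comp (g := g.speedSq f e) w (g.differentiableAt_speedSq f e h1)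
          differentiableAt_fst).sqrt h2.ne'
      have h6 : DifferentiableAt ℝ (fun w : ℂ × ℂ => ‖w.2‖) w :=
        differentiableAt_snd.norm ℝ h3
      simp only [div_eq_mul_inv]
      exact differentiableAt_fst.prodMk ((h5.fun_mul (h6.fun_inv h4.ne')).fun_smul
        differentiableAt_snd)
    · rw [Complex.normSq_eq_norm_sq, norm_smul, Real.norm_of_nonneg (by positivity),
        div_mul_cancel₀ _ h4.ne', Real.sq_sqrt h2.le]
    · rw [← h5, Complex.normSq_eq_norm_sq, Real.sqrt_sq h4.le, div_self h4.ne', one_smul]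
  · have h0 : ∀ ζ, g.speedSq 0 0 ζ = 0 := fun ζ => by simp [Geom.speedSq]
    refine ⟨fun w => (w.1, 0), Filter.Eventually.of_forall fun w => ⟨?_, rfl, by simp [h0], ?_⟩⟩
    · exact differentiableAt_fst.prodMk (differentiableAt_const _)
    · rw [h0, Complex.normSq_eq_zero]
      intro h
      exact Prod.ext rfl h.symm

theorem hooke_exists_retraction {g : Geom} {f e : ℝ} {W : Set (Set V3)} {x : V3 × V3}
    (hx : x ∈ (hookeBilliard g f W).level e) (hv : x.2 ≠ 0 ∨ (e = 0 ∧ f = 0)) :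
    ∃ ρ : V3 × V3 → V3 × V3,
      (∀ᶠ y in 𝓝 x, DifferentiableAt ℝ ρ y ∧ ρ y ∈ (hookeBilliard g f W).level e) ∧
      ∀ᶠ y in 𝓝 x, y ∈ (hookeBilliard g f W).level e → ρ y = y := by
  have hx1 : x.1 ∈ g.punctured := hx.1
  have hlt := normSq_stereo_lt_one hx1.1
  have h0 := stereo_ne_zero hx1
  have hph := phase_planePhase hx1.1 hx.2.1
  have hz : 1 - x.1.2.2 ≠ 0 := (one_sub_height_pos hx1.1).ne'
  have hkin : Complex.normSq (planePhase x).2 = g.speedSq f e (planePhase x).1 :=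
    (phase_mem_level_iff g f e W (x := planePhase x) hlt h0).1 (by rw [hph]; exact hx)
  obtain ⟨R, hR⟩ := exists_chart_retraction g (x := planePhase x) hlt hkin
    (hv.imp_left fun h h1 => h (by
    have := congrArg Prod.snd hph
    simp only [Geom.phase, h1, map_zero] at this
    exact this.symm))
  have hcont : ContinuousAt planePhase x := (contDiffAt_planePhase hz).continuousAt
  have hfst : ContinuousAt (fun y : V3 × V3 => stereo y.1) x :=
    ContinuousAt.comp (g := stereo) (differentiableAt_stereo hx1.1).continuousAt continuousAt_fst
  have hz' : ∀ᶠ y : V3 × V3 in 𝓝 x, 1 - y.1.2.2 ≠ 0 :=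
    ContinuousAt.eventually_ne (g := fun y : V3 × V3 => 1 - y.1.2.2) (by fun_prop) hz
  refine ⟨fun y => g.phase (R (planePhase y)), ?_, ?_⟩
  · filter_upwards [hcont.eventually hR, hfst.eventually (eventually_normSq_lt hlt),
      hfst.eventually_ne h0, hz'] with y h1 h2 h3 h4
    have h5 : Complex.normSq (R (planePhase y)).1 < 1 := by rw [h1.2.1]; exact h2
    refine ⟨?_, ?_⟩
    · exact DifferentiableAt.comp (g := g.phase) y
        ((contDiffAt_phase g h5).differentiableAt (by simp))
        (DifferentiableAt.comp (g := R) y h1.1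
          ((contDiffAt_planePhase h4).differentiableAt (by simp)))
    · refine (phase_mem_level_iff g f e W h5 (by rw [h1.2.1]; exact h3)).2 ?_
      rw [h1.2.2.1, h1.2.1]
  · filter_upwards [hcont.eventually hR] with y h1 hy
    have hy1 : y.1 ∈ g.punctured := hy.1
    have hph' := phase_planePhase hy1.1 hy.2.1
    have := (phase_mem_level_iff g f e W (x := planePhase y) (normSq_stereo_lt_one hy1.1)
      (stereo_ne_zero hy1)).1 (by rw [hph']; exact hy)
    rw [h1.2.2.2 this, hph']

/-- Unless `e` and `f` vanish, points of rest are limits of moving points of the same energy: the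
kinetic energy becomes positive if the position is moved in the radial direction where the
force function increases. -/
theorem hooke_exists_moving {g : Geom} {f e : ℝ} {W : Set (Set V3)} {x : V3 × V3}
    (hx : x ∈ (hookeBilliard g f W).level e) (hv : x.2 = 0) (hef : ¬ (e = 0 ∧ f = 0))
    {U : Set (V3 × V3)} (hU : U ∈ 𝓝 x) :
    ∃ y ∈ U, y ∈ (hookeBilliard g f W).level e ∧ y.2 ≠ 0 := by
  have hx1 : x.1 ∈ g.punctured := hx.1
  have hlt := normSq_stereo_lt_one hx1.1
  have h0 := stereo_ne_zero hx1
  have hD := g.one_add_pos hlt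
  have hM := g.one_sub_pos hlt
  have hn := Complex.normSq_pos.2 h0
  have he : e + f * g.planeFactor (stereo x.1) = 0 := by
    have h1 : (hookeBilliard g f W).energy x.1 x.2 = e := hx.2.2
    simp only [Billiard.energy, hookeBilliard, hv] at h1
    rw [hookeForce_eq g f hx1] at h1
    have h2 : g.form (0 : V3) 0 = 0 := by simp [Geom.form]
    rw [h2] at h1
    rw [← h1]
    simp [Geom.factor, Geom.planeFactor]
  have hf : f ≠ 0 := fun hf => hef ⟨by simpa [hf] using he, hf⟩
  have hline := hasDerivAt_line (stereo x.1) ((f : ℂ) * stereo x.1) 0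
  have hline0 : stereo x.1 + (0 : ℝ) • ((f : ℂ) * stereo x.1) = stereo x.1 := by simp
  have hder := ((g.hasDerivAt_planeFactor hline (by simpa using hlt)).const_mul f).const_add e
  simp only [hline0] at hder
  have hdpos : 0 < f * (8 * dot (stereo x.1) ((f : ℂ) * stereo x.1) *
      (1 + g.sign * Complex.normSq (stereo x.1)) /
        (1 - g.sign * Complex.normSq (stereo x.1)) ^ 3) := by
    have h1 : dot (stereo x.1) ((f : ℂ) * stereo x.1) = f * Complex.normSq (stereo x.1) := by
      rw [normSq_eq_dot]
      simp only [dot, Complex.re_ofReal_mul, Complex.im_ofReal_mul]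
      ring
    have h2 : 0 < f ^ 2 := by positivity
    rw [h1, show f * (8 * (f * Complex.normSq (stereo x.1)) *
      (1 + g.sign * Complex.normSq (stereo x.1)) /
        (1 - g.sign * Complex.normSq (stereo x.1)) ^ 3) = f ^ 2 * (8 * Complex.normSq (stereo x.1) *
      (1 + g.sign * Complex.normSq (stereo x.1)) /
        (1 - g.sign * Complex.normSq (stereo x.1)) ^ 3) by ring]
    positivity
  have hgt : ∀ᶠ t in 𝓝[>] (0 : ℝ),
      0 < e + f * g.planeFactor (stereo x.1 + t • ((f : ℂ) * stereo x.1)) := by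
    have h1 := (hasDerivAt_iff_tendsto_slope.1 hder).mono_left
      (nhdsWithin_mono (0 : ℝ) fun t (ht : 0 < t) => ht.ne')
    filter_upwards [h1.eventually (lt_mem_nhds hdpos), self_mem_nhdsWithin] with t ht1 ht2
    rw [slope_def_field, sub_zero, hline0, he, sub_zero] at ht1
    exact (div_pos_iff_of_pos_right ht2).1 ht1
  -- positions on a radial segment, with the speed prescribed by the energy
  have hcurve : ContinuousAt (fun t : ℝ => g.phase (stereo x.1 + t • ((f : ℂ) * stereo x.1),
      (√(g.speedSq f e (stereo x.1 + t • ((f : ℂ) * stereo x.1))) : ℂ))) 0 := by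
    refine ContinuousAt.comp (g := g.phase)
      (contDiffAt_phase g (by simpa using hlt)).continuousAt (hline.continuousAt.prodMk ?_)
    refine Complex.continuous_ofReal.continuousAt.comp (Real.continuous_sqrt.continuousAt.comp ?_)
    exact ContinuousAt.comp (g := g.speedSq f e)
      (g.differentiableAt_speedSq f e (by simpa using hlt)).continuousAt hline.continuousAt
  have hspeed0 : g.speedSq f e (stereo x.1) = 0 := by rw [Geom.speedSq, he]; simp
  have hcurve0 : g.phase (stereo x.1 + (0 : ℝ) • ((f : ℂ) * stereo x.1),
      (√(g.speedSq f e (stereo x.1 + (0 : ℝ) • ((f : ℂ) * stereo x.1))) : ℂ)) = x := by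
    rw [hline0, hspeed0]
    refine Prod.ext (chart_stereo hx1.1) ?_
    simp [Geom.phase, hv]
  have hev := ((hcurve.eventually (p := fun y => y ∈ U) (by simp only [hcurve0]; exact hU)).and
      ((hline.continuousAt.eventually (eventually_normSq_lt (by simpa using hlt))).and
        (hline.continuousAt.eventually_ne (y := 0) (by simpa using h0)))).filter_mono
    (nhdsWithin_le_nhds (s := Set.Ioi (0 : ℝ)))
  obtain ⟨t, ht1, ht2, ht3, ht4⟩ := (hgt.and hev).exists
  have hkpos : 0 < g.speedSq f e (stereo x.1 + t • ((f : ℂ) * stereo x.1)) := by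
    have := g.one_add_pos ht3
    unfold Geom.speedSq
    positivity
  have hmem := (phase_mem_level_iff g f e W (x := (stereo x.1 + t • ((f : ℂ) * stereo x.1),
      (√(g.speedSq f e (stereo x.1 + t • ((f : ℂ) * stereo x.1))) : ℂ))) ht3 ht4).2 (by
    rw [Complex.normSq_ofReal, Real.mul_self_sqrt hkpos.le])
  refine ⟨_, ht2, hmem, fun hzero => ?_⟩
  simp only [Geom.phase] at hzero
  rw [g.fderiv_chart ht3] at hzero
  have h5 := form_chartDeriv g ht3 (√(g.speedSq f e (stereo x.1 + t • ((f : ℂ) * stereo x.1))) : ℂ)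
    (√(g.speedSq f e (stereo x.1 + t • ((f : ℂ) * stereo x.1))) : ℂ)
  rw [hzero, ← normSq_eq_dot, Complex.normSq_ofReal, Real.mul_self_sqrt hkpos.le] at h5
  have h6 := mul_pos (pow_pos (g.scale_pos ht3) 2) hkpos
  rw [← h5] at h6
  simp [Geom.form] at h6

/-- On the energy hypersurfaces of the Hooke problem, density of the points where a smooth function
is not locally constant implies density of its regular points. -/
theorem hooke_regularAt_dense {g : Geom} {W : Set (Set V3)} {T : Set (ℝ × ℝ)}
    {F : (ℝ × ℝ) × V3 × V3 → ℝ}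
    (hF : ContDiffOn ℝ ∞ F (familyLevel T (hookeFamily g W) fun p => 2 * p.1))
    (hd : familyLevel T (hookeFamily g W) (fun p => 2 * p.1) ⊆
      closure {x | x ∈ familyLevel T (hookeFamily g W) (fun p => 2 * p.1) ∧
        ¬ LocallyConstantAt (fun y => F (x.1, y)) ((hookeFamily g W x.1).level (2 * x.1.1)) x.2}) :
    familyLevel T (hookeFamily g W) (fun p => 2 * p.1) ⊆
      closure {x | x ∈ familyLevel T (hookeFamily g W) (fun p => 2 * p.1) ∧
        RegularAt (fun y => F (x.1, y)) ((hookeFamily g W x.1).level (2 * x.1.1)) x.2} := by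
  intro x hx
  rw [mem_closure_iff]
  intro U hU hxU
  have hslice : ∀ y : (ℝ × ℝ) × V3 × V3, y ∈ U → {z : V3 × V3 | (y.1, z) ∈ U} ∈ 𝓝 y.2 := fun y hy =>
    (hU.preimage (Continuous.prodMk_right y.1)).mem_nhds hy
  obtain ⟨y, hyU, hyX, hyn, hyv⟩ : ∃ y ∈ U,
      y ∈ familyLevel T (hookeFamily g W) (fun p => 2 * p.1) ∧
      ¬ LocallyConstantAt (fun z => F (y.1, z)) ((hookeFamily g W y.1).level (2 * y.1.1)) y.2 ∧
      (y.2.2 ≠ 0 ∨ (2 * y.1.1 = 0 ∧ y.1.2 + g.sign * y.1.1 = 0)) := by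
    by_cases hmov : ∃ z ∈ U, z ∈ familyLevel T (hookeFamily g W) (fun p => 2 * p.1) ∧ z.2.2 ≠ 0
    · obtain ⟨z, hzU, hzX, hzv⟩ := hmov
      have hopen : IsOpen (U ∩ {z | z.2.2 ≠ 0}) :=
        hU.inter (isOpen_ne_fun (by fun_prop) (by fun_prop))
      obtain ⟨y, hy1, hy2⟩ := mem_closure_iff.1 (hd hzX) _ hopen ⟨hzU, hzv⟩
      exact ⟨y, hy1.1, hy2.1, hy2.2, Or.inl hy1.2⟩
    · push Not at hmov
      obtain ⟨y, hyU, hyX, hyn⟩ := mem_closure_iff.1 (hd hx) U hU hxU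
      refine ⟨y, hyU, hyX, hyn, Or.inr ?_⟩
      by_contra hcon
      obtain ⟨z, hz1, hz2, hz3⟩ := hooke_exists_moving hyX.2 (hmov y hyU hyX) hcon (hslice y hyU)
      exact hz3 (hmov (y.1, z) hz1 ⟨hyX.1, hz2⟩)
  obtain ⟨ρ, hρ1, hρ2⟩ := hooke_exists_retraction hyX.2 hyv
  have hFd : ∀ z ∈ (hookeFamily g W y.1).level (2 * y.1.1), DifferentiableWithinAt ℝ
      (fun z => F (y.1, z)) ((hookeFamily g W y.1).level (2 * y.1.1)) z := by
    intro z hz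
    have h1 : DifferentiableWithinAt ℝ F _ (y.1, z) :=
      (hF (y.1, z) ⟨hyX.1, hz⟩).differentiableWithinAt (by simp)
    exact DifferentiableWithinAt.comp (g := F) (f := fun z => (y.1, z)) z h1
      ((differentiableAt_const _).prodMk differentiableAt_id).differentiableWithinAt
      fun z hz => ⟨hyX.1, hz⟩
  obtain ⟨z, hz1, hz2, hz3⟩ := exists_regularAt_of_retraction hyX.2 hρ1 hρ2 hFd hyn (hslice y hyU)
  exact ⟨(y.1, z), hz1, ⟨hyX.1, hz2⟩, hz3⟩

/-! ### From Hooke to Kepler: first integrals are symmetrized and descend -/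

/-- The conditions on the function `F` in the definition of integrability. -/
def IsFirstIntegral (T : Set (ℝ × ℝ)) (S : ℝ × ℝ → Billiard) (e : ℝ × ℝ → ℝ)
    (F : (ℝ × ℝ) × V3 × V3 → ℝ) : Prop :=
  ContDiffOn ℝ ∞ F (familyLevel T S e) ∧
    (∀ p ∈ T, ∀ (I : Set ℝ) (γ : ℝ → V3), (S p).IsMotion (e p) I γ →
      ∀ s ∈ I, ∀ t ∈ I, F (p, γ s, deriv γ s) = F (p, γ t, deriv γ t)) ∧
    (∀ p ∈ T, ∀ C ∈ (S p).walls, ∀ q ∈ C, ∀ v w : V3, (q, v) ∈ (S p).level (e p) →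
      (S p).geom.Reflects C q v w → F (p, q, v) = F (p, q, w)) ∧
    familyLevel T S e ⊆ closure {x | x ∈ familyLevel T S e ∧
      RegularAt (fun y => F (x.1, y)) ((S x.1).level (e x.1)) x.2}

theorem hooke_isMotion_halfTurn {g : Geom} {m E : ℝ} {W : Set (Set V3)} {I : Set ℝ} {γ : ℝ → V3}
    (h : (hookeBilliard g (E + g.sign * m) W).IsMotion (2 * m) I γ) :
    (hookeBilliard g (E + g.sign * m) W).IsMotion (2 * m) I (fun t => halfTurn (γ t)) := by
  obtain ⟨J, Γ, τ, σ, hR⟩ := exists_related_of_curve (g := g) h.1 h.2.1 (h.continuousOn)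
    fun t ht => (h.2.2 t ht).1
  exact (hR.halfTurn.isMotion_iff m E ∅ W).2 ((hR.isMotion_iff m E ∅ W).1 h)

theorem reflects_halfTurn {g : Geom} {C : Set V3} (hC : C ⊆ Geom.hyperbolic.punctured)
    {q v w : V3} (hq : q ∈ g.punctured) (h : g.Reflects (g.punctured ∩ squareMap ⁻¹' C) q v w) :
    g.Reflects (g.punctured ∩ squareMap ⁻¹' C) (halfTurn q) (halfTurn v) (halfTurn w) := by
  obtain ⟨hv, hw⟩ := mem_tangent_of_reflects (fun x hx => hx.1.1) h
  have h1 := (reflects_squareMap_iff hC hq hv hw).1 h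
  refine (reflects_squareMap_iff hC (halfTurn_mem_punctured hq) (halfTurn_mem_tangent hv)
    (halfTurn_mem_tangent hw)).2 ?_
  rwa [squareMap_halfTurn, fderiv_squareMap_halfTurn hq hv, fderiv_squareMap_halfTurn hq hw]

/-- A first integral of the Hooke billiards can be chosen invariant under the half turn: with its
even part `A` and its odd part `B` (up to a factor `2`), some combination `A + c B²` is
independent of the energy. -/
theorem exists_isFirstIntegral_invariant {g : Geom} {W : Set (Set V3)}
    (hW : ∀ C ∈ W, C ⊆ Geom.hyperbolic.punctured) {T : Set (ℝ × ℝ)}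
    {F : (ℝ × ℝ) × V3 × V3 → ℝ}
    (h : IsFirstIntegral T (hookeFamily g W) (fun p => 2 * p.1) F) :
    ∃ G, IsFirstIntegral T (hookeFamily g W) (fun p => 2 * p.1) G ∧
      ∀ p x, G (p, phaseTurn x) = G (p, x) := by
  obtain ⟨hF, hmot, hrefl, hdense⟩ := h
  have hturn : ContDiffOn ℝ ∞ (fun x : (ℝ × ℝ) × V3 × V3 => F (x.1, phaseTurn x.2))
      (familyLevel T (hookeFamily g W) fun p => 2 * p.1) := by
    refine hF.comp (g := F) (f := fun x : (ℝ × ℝ) × V3 × V3 => (x.1, phaseTurn x.2))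
      (contDiff_fst.prodMk (contDiff_phaseTurn.comp contDiff_snd)).contDiffOn ?_
    exact fun x hx => ⟨hx.1, phaseTurn_mem_level hx.2⟩
  obtain ⟨c, hc⟩ := exists_add_mul_sq_not_locallyConstantAt
    (X := familyLevel T (hookeFamily g W) fun p => 2 * p.1)
    (L := fun p => (hookeFamily g W p).level (2 * p.1))
    (A := fun p x => F (p, x) + F (p, phaseTurn x))
    (B := fun p x => F (p, x) - F (p, phaseTurn x))
    (fun x hx => by
      have h1 : ContinuousWithinAt (fun x : (ℝ × ℝ) × V3 × V3 => F x - F (x.1, phaseTurn x.2)) _ x :=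
        (hF.continuousOn.sub hturn.continuousOn) x hx
      exact ContinuousWithinAt.comp (f := fun y : V3 × V3 => (x.1, y)) (x := x.2) h1
        (Continuous.prodMk_right x.1).continuousWithinAt fun y hy => ⟨hx.1, hy⟩)
    (hdense.trans (closure_mono fun x hx => ⟨hx.1, fun hcon => hx.2.not_locallyConstantAt (by
      filter_upwards [hcon.1, hcon.2] with y h1 h2
      linarith)⟩))
  refine ⟨fun x => (F x + F (x.1, phaseTurn x.2)) + c * (F x - F (x.1, phaseTurn x.2)) ^ 2,
    ⟨?_, ?_, ?_, ?_⟩, fun p x => ?_⟩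
  · exact (hF.add hturn).add (contDiffOn_const.mul ((hF.sub hturn).pow 2))
  · intro p hp I γ hγ s hs t ht
    have h1 := hmot p hp I γ hγ s hs t ht
    have h2 := hmot p hp I _ (hooke_isMotion_halfTurn hγ) s hs t ht
    have h3 : ∀ t ∈ I, deriv (fun t => halfTurn (γ t)) t = halfTurn (deriv γ t) := fun t ht =>
      (hasDerivAt_halfTurn (hγ.differentiableAt ht).hasDerivAt).deriv
    rw [h3 s hs, h3 t ht] at h2
    simp only [phaseTurn]
    rw [h1, h2]
  · rintro p hp _ ⟨C, hC, rfl⟩ q hq v w hv hr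
    have h1 := hrefl p hp _ ⟨C, hC, rfl⟩ q hq v w hv hr
    have h2 := hrefl p hp _ ⟨C, hC, rfl⟩ (halfTurn q)
      ⟨halfTurn_mem_punctured hq.1, by
        show squareMap (halfTurn q) ∈ C
        rw [squareMap_halfTurn]; exact hq.2⟩ (halfTurn v) (halfTurn w)
      (phaseTurn_mem_level hv) (reflects_halfTurn (hW C hC) hq.1 hr)
    simp only [phaseTurn]
    rw [h1, h2]
  · refine hooke_regularAt_dense (F := fun x => (F x + F (x.1, phaseTurn x.2)) +
      c * (F x - F (x.1, phaseTurn x.2)) ^ 2) ?_ hc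
    exact (hF.add hturn).add (contDiffOn_const.mul ((hF.sub hturn).pow 2))
  · simp only [phaseTurn_phaseTurn]
    ring

open Classical in
/-- The function on the Kepler side whose value at a phase point is the value of `G` at a lift of
this point, and `0` where there is no lift. -/
def descend (g : Geom) (G : (ℝ × ℝ) × V3 × V3 → ℝ) (X : (ℝ × ℝ) × V3 × V3) : ℝ :=
  if h : ∃ x, IsLift g x X.2 then G (X.1, h.choose) else 0

theorem IsLift.descend_eq {g : Geom} {G : (ℝ × ℝ) × V3 × V3 → ℝ} {x X : V3 × V3}
    (h : IsLift g x X) (hG : ∀ p x, G (p, ConicBilliards.phaseTurn x) = G (p, x)) (p : ℝ × ℝ) :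
    descend g G (p, X) = G (p, x) := by
  have hex : ∃ x, IsLift g x X := ⟨x, h⟩
  rw [descend, dif_pos hex]
  rcases h.eq_or_eq hex.choose_spec with h1 | h1
  · rw [h1]
  · rw [h1, hG]

theorem isIntegrable_kepler_of_hooke (g : Geom) {W : Set (Set V3)}
    (hW : ∀ C ∈ W, C ⊆ Geom.hyperbolic.punctured) {T : Set (ℝ × ℝ)}
    (h : IsIntegrable T (hookeFamily g W) (fun p => 2 * p.1)) :
    IsIntegrable T (fun p => keplerBilliard p.1 W) (fun p => p.2) := by
  obtain ⟨F, hF⟩ := h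
  obtain ⟨G, ⟨hG, hmot, hrefl, hdense⟩, hinv⟩ := exists_isFirstIntegral_invariant hW hF
  refine ⟨descend g G, ?_, ?_, ?_, ?_⟩
  · rintro ⟨p, X⟩ ⟨hp, hX⟩
    obtain ⟨x, hx⟩ := exists_isLift (g := g) hX.1 hX.2.1
    obtain ⟨ψ, hψ⟩ := exists_isSection hx.1
    have hsm : ContDiffAt ℝ ∞ (liftBy g ψ) X := by
      have := hψ.contDiffAt_liftBy (V := X.2) hx.1
      rwa [hx.2.2.1] at this
    have hlift : ∀ᶠ Y in 𝓝 X, Y.1 ∈ Geom.hyperbolic.punctured →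
        Y.2 ∈ Geom.hyperbolic.tangent Y.1 → IsLift g (liftBy g ψ Y) Y := by
      have := hψ.eventually_isLift (V := X.2)
      rwa [hx.2.2.1] at this
    have hsnd : Filter.Tendsto Prod.snd (𝓝 (p, X)) (𝓝 X) := continuousAt_snd
    have hmap : ContDiffAt ℝ ∞ (fun Y : (ℝ × ℝ) × V3 × V3 => (Y.1, liftBy g ψ Y.2)) (p, X) :=
      contDiffAt_fst.prodMk (ContDiffAt.comp (g := liftBy g ψ) (p, X) hsm contDiffAt_snd)
    -- the points near `X` whose lift by `ψ` is defined
    set N : Set ((ℝ × ℝ) × V3 × V3) := {Y | Y.2.1 ∈ Geom.hyperbolic.punctured →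
        Y.2.2 ∈ Geom.hyperbolic.tangent Y.2.1 → IsLift g (liftBy g ψ Y.2) Y.2} with hN
    have hNmem : N ∈ 𝓝 (p, X) := hsnd.eventually hlift
    refine (contDiffWithinAt_inter (t := N) hNmem).1 ?_
    have hbase : (p, liftBy g ψ X) ∈ familyLevel T (hookeFamily g W) fun p => 2 * p.1 := by
      rw [hx.liftBy_eq hψ]
      exact ⟨hp, (hx.mem_level_iff p.1 p.2 W _).2 hX⟩
    have hcomp := ContDiffWithinAt.comp (g := G)
      (f := fun Y : (ℝ × ℝ) × V3 × V3 => (Y.1, liftBy g ψ Y.2))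
      (s := familyLevel T (fun p => keplerBilliard p.1 W) (fun p => p.2) ∩ N) (p, X)
      (hG _ hbase) hmap.contDiffWithinAt fun Y hY => ⟨hY.1.1,
        ((hY.2 hY.1.2.1 hY.1.2.2.1).mem_level_iff Y.1.1 Y.1.2 W _).2 hY.1.2⟩
    exact hcomp.congr
      (fun Y hY => (hY.2 hY.1.2.1 hY.1.2.2.1).descend_eq hinv Y.1)
      ((hlift.self_of_nhds hX.1 hX.2.1).descend_eq hinv p)
  · intro p hp J Γ hΓ s hs t ht
    have hmem : ∀ u ∈ J, Γ u ∈ Geom.hyperbolic.punctured := fun u hu => (hΓ.2.2 u hu).1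
    obtain ⟨q, hq, hqs⟩ := squareMap_surjOn g (hmem s hs)
    obtain ⟨I, γ, τ, σ, hR, -⟩ := exists_related_of_image hΓ.1 hΓ.2.1 (hΓ.continuousOn)
      hmem hs hq hqs
    have hγ := (hR.isMotion_iff p.1 p.2 W (g.squareRootWalls W)).2 hΓ
    have hl : ∀ u ∈ J, IsLift g (γ (σ u), deriv γ (σ u)) (Γ u, deriv Γ u) := by
      intro u hu
      have hu' := hR.time.map_target u hu
      have := hR.isLift_deriv hu' (hγ.differentiableAt hu')
      rwa [hR.time.right_inv u hu] at this
    rw [(hl s hs).descend_eq hinv, (hl t ht).descend_eq hinv]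
    exact hmot p hp I γ hγ _ (hR.time.map_target s hs) _ (hR.time.map_target t ht)
  · intro p hp C hC Q hQ V V' hV hr
    obtain ⟨-, hV't⟩ := mem_tangent_of_reflects (fun x hx => (hW C hC hx).1) hr
    obtain ⟨x, hx⟩ := exists_isLift (g := g) (X := (Q, V)) hV.1 hV.2.1
    have hxQ : squareMap x.1 = Q := hx.2.2.1
    obtain ⟨v', hv't, hv'⟩ := fderiv_squareMap_surjOn hx.1
      (show g.factor x.1 • V' ∈ Geom.hyperbolic.tangent (squareMap x.1) by
        rw [hxQ]; exact smul_mem_tangent hV't _)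
    have hx' : IsLift g (x.1, v') (Q, V') := ⟨hx.1, hv't, hxQ, hv'⟩
    have hr' : g.Reflects (g.punctured ∩ squareMap ⁻¹' C) x.1 x.2 v' := by
      refine (reflects_squareMap_iff (hW C hC) hx.1 hx.2.1 hv't).2 ?_
      rw [hx.2.2.2, hv', hxQ]
      exact hr.smul _
    rw [hx.descend_eq hinv, hx'.descend_eq hinv]
    exact hrefl p hp _ ⟨C, hC, rfl⟩ x.1 ⟨hx.1, by show squareMap x.1 ∈ C; rwa [hxQ]⟩ x.2 v'
      ((hx.mem_level_iff p.1 p.2 W _).2 hV) hr'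
  · rintro ⟨p, X⟩ ⟨hp, hX⟩
    rw [mem_closure_iff_nhds]
    intro U hU
    obtain ⟨x, hx⟩ := exists_isLift (g := g) hX.1 hX.2.1
    have hmap : ContinuousAt (fun y : (ℝ × ℝ) × V3 × V3 => (y.1, project g y.2)) (p, x) :=
      continuousAt_fst.prodMk (ContinuousAt.comp (g := project g)
        (contDiffAt_project hx.1).continuousAt continuousAt_snd)
    obtain ⟨y, hyU, hyX, c, hc0, hc, hcd, hcG⟩ := mem_closure_iff_nhds.1
      (hdense (show (p, x) ∈ _ from ⟨hp, (hx.mem_level_iff p.1 p.2 W _).2 hX⟩)) _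
      (hmap.preimage_mem_nhds (t := U) (by simp only [hx.project_eq]; exact hU))
    have hlev : ∀ z, z ∈ (hookeFamily g W y.1).level (2 * y.1.1) →
        project g z ∈ (keplerBilliard y.1.1 W).level y.1.2 := fun z hz =>
      ((isLift_project hz.1 hz.2.1).mem_level_iff y.1.1 y.1.2 W _).1 hz
    refine ⟨(y.1, project g y.2), hyU, ⟨hyX.1, hlev _ hyX.2⟩, fun t => project g (c t),
      by simp only [hc0], hc.mono fun t ht => hlev _ ht, ?_, ?_⟩
    · exact DifferentiableAt.comp (g := project g) 0
        (by rw [hc0]; exact (contDiffAt_project hyX.2.1).differentiableAt (by simp)) hcd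
    · have h1 : (fun t => descend g G (y.1, project g (c t))) =ᶠ[𝓝 0] fun t => G (y.1, c t) := by
        filter_upwards [hc] with t ht
        exact (isLift_project ht.1 ht.2.1).descend_eq hinv y.1
      rw [h1.deriv_eq]
      exact hcG

/-! ### Distances in the chart -/

theorem sign_mul_form_chart (g : Geom) {ζ a : ℂ} (hζ : Complex.normSq ζ < 1)
    (ha : Complex.normSq a < 1) :
    g.sign * g.form (g.chart ζ) (g.chart a) = 1 - 2 * g.sign * Complex.normSq (ζ - a) /
      ((1 + g.sign * Complex.normSq ζ) * (1 + g.sign * Complex.normSq a)) := by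
  have h1 := (g.one_add_pos hζ).ne'
  have h2 := (g.one_add_pos ha).ne'
  have h3 : Complex.normSq (ζ - a) =
      Complex.normSq ζ + Complex.normSq a - 2 * (ζ.re * a.re + ζ.im * a.im) := by
    simp only [Complex.normSq_apply, Complex.sub_re, Complex.sub_im]
    ring
  have hs := g.sign_sq
  rw [h3]
  simp only [Geom.form, Geom.chart]
  generalize Complex.normSq ζ = n at *
  generalize Complex.normSq a = α at *
  field_simp
  linear_combination (1 - g.sign * n) * (1 - g.sign * α) * hs

theorem normSq_sub_le (ζ a : ℂ) :
    Complex.normSq (ζ - a) ≤ (1 + Complex.normSq ζ) * (1 + Complex.normSq a) := by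
  simp only [Complex.normSq_apply, Complex.sub_re, Complex.sub_im]
  nlinarith [sq_nonneg (1 + (ζ.re * a.re + ζ.im * a.im)), sq_nonneg (ζ.re * a.im - ζ.im * a.re)]

theorem Geom.angle_of_mem (g : Geom) {p q : V3} (hp : p ∈ g.surface) (hq : q ∈ g.surface) :
    g.angle p q = match g with
      | .spherical => Real.arccos (g.sign * g.form p q)
      | .hyperbolic => Real.arcosh (g.sign * g.form p q) := by
  have h1 := hp.1
  have h2 := hq.1
  cases g <;> simp only [Geom.angle, h1, h2] <;> simp [Geom.sign]

theorem angle_comm (g : Geom) (p q : V3) : g.angle p q = g.angle q p := by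
  cases g <;> simp only [Geom.angle, form_comm _ p q, mul_comm (Geom.form _ p p)]

theorem angle_self (g : Geom) {p : V3} (hp : p ∈ g.surface) : g.angle p p = 0 := by
  have h1 := hp.1
  rw [g.angle_of_mem hp hp, h1, g.sign_mul_self]
  cases g <;> simp

theorem cos_spherical_angle {ζ a : ℂ} (hζ : Complex.normSq ζ < 1) (ha : Complex.normSq a < 1) :
    Real.cos (Geom.spherical.angle (Geom.spherical.chart ζ) (Geom.spherical.chart a)) =
      1 - 2 * Geom.spherical.sign * Complex.normSq (ζ - a) /
        ((1 + Geom.spherical.sign * Complex.normSq ζ) *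
          (1 + Geom.spherical.sign * Complex.normSq a)) := by
  have h1 := sign_mul_form_chart .spherical hζ ha
  have h2 := mul_pos (Geom.spherical.one_add_pos hζ) (Geom.spherical.one_add_pos ha)
  have h3 := normSq_sub_le ζ a
  have h4 := Complex.normSq_nonneg (ζ - a)
  rw [Geom.angle_of_mem _ (Geom.chart_mem_surface _ hζ) (Geom.chart_mem_surface _ ha)]
  simp only
  rw [h1]
  simp only [Geom.sign, mul_one, one_mul] at h2 ⊢
  refine Real.cos_arccos ?_ ?_
  · have : 2 * Complex.normSq (ζ - a) / ((1 + Complex.normSq ζ) * (1 + Complex.normSq a)) ≤ 2 := by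
      rw [div_le_iff₀ h2]; linarith
    linarith
  · have : 0 ≤ 2 * Complex.normSq (ζ - a) / ((1 + Complex.normSq ζ) * (1 + Complex.normSq a)) := by
      positivity
    linarith

theorem one_le_hyperbolic_arg {ζ a : ℂ} (hζ : Complex.normSq ζ < 1) (ha : Complex.normSq a < 1) :
    1 ≤ Geom.hyperbolic.sign *
      Geom.hyperbolic.form (Geom.hyperbolic.chart ζ) (Geom.hyperbolic.chart a) := by
  rw [sign_mul_form_chart .hyperbolic hζ ha]
  have h2 := mul_pos (Geom.hyperbolic.one_add_pos hζ) (Geom.hyperbolic.one_add_pos ha)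
  have h4 := Complex.normSq_nonneg (ζ - a)
  rw [le_sub_self_iff]
  refine div_nonpos_of_nonpos_of_nonneg ?_ h2.le
  simp only [Geom.sign]
  linarith

theorem cosh_hyperbolic_angle {ζ a : ℂ} (hζ : Complex.normSq ζ < 1) (ha : Complex.normSq a < 1) :
    Real.cosh (Geom.hyperbolic.angle (Geom.hyperbolic.chart ζ) (Geom.hyperbolic.chart a)) =
      1 - 2 * Geom.hyperbolic.sign * Complex.normSq (ζ - a) /
        ((1 + Geom.hyperbolic.sign * Complex.normSq ζ) *
          (1 + Geom.hyperbolic.sign * Complex.normSq a)) := by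
  rw [Geom.angle_of_mem _ (Geom.chart_mem_surface _ hζ) (Geom.chart_mem_surface _ ha)]
  simp only
  rw [Real.cosh_arcosh (one_le_hyperbolic_arg hζ ha), sign_mul_form_chart _ hζ ha]

theorem angle_nonneg (g : Geom) {p q : V3} (hp : p ∈ g.surface) (hq : q ∈ g.surface) :
    0 ≤ g.angle p q := by
  cases g
  · exact Real.arccos_nonneg _
  · rw [Geom.angle_of_mem _ hp hq]
    simp only
    rw [← chart_stereo hp, ← chart_stereo hq]
    exact Real.arcosh_nonneg
      (one_le_hyperbolic_arg (normSq_stereo_lt_one hp) (normSq_stereo_lt_one hq))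

theorem southPole_mem_surface (g : Geom) : southPole ∈ g.surface := by
  constructor <;> simp [Geom.form, southPole]

theorem eq_log_of_cosh_eq {x r : ℝ} (hx : 0 ≤ x) (hr : 1 ≤ r) (h : Real.cosh x = (r + r⁻¹) / 2) :
    x = Real.log r := by
  rw [← Real.cosh_log (by linarith)] at h
  exact Real.cosh_strictMonoOn.injOn hx (Real.log_nonneg hr) h

theorem hyperbolic_angle_chart_southPole {ζ : ℂ} (h : Complex.normSq ζ < 1) :
    Geom.hyperbolic.angle (Geom.hyperbolic.chart (ζ ^ 2)) southPole =
      Real.log ((1 + Complex.normSq ζ) / (1 - Complex.normSq ζ)) := by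
  have h0 := normSq_sq_lt_one h
  have hn := Complex.normSq_nonneg ζ
  have hm : 0 < 1 - Complex.normSq ζ := by linarith
  refine eq_log_of_cosh_eq (angle_nonneg _ (Geom.chart_mem_surface _ h0)
    (southPole_mem_surface _)) (by rw [le_div_iff₀ hm]; linarith) ?_
  rw [← Geom.hyperbolic.chart_zero, cosh_hyperbolic_angle h0 (by simp)]
  simp only [sub_zero, normSq_sq, Geom.sign, map_zero, mul_zero, add_zero, mul_one]
  rw [normSq_sq] at h0
  generalize Complex.normSq ζ = n at *
  have h1 : 1 + n ≠ 0 := by positivity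
  have h3 := hm.ne'
  rw [inv_div, show 1 + -1 * n ^ 2 = (1 + n) * (1 - n) by ring]
  field_simp
  ring

/-! ### Confocal conic sections -/

/-- Twice the logarithm of the hyperbolic cosine, respectively of the secant: the function by
which distances between the preimages determine sums of distances below. -/
def Geom.excess (g : Geom) (t : ℝ) : ℝ :=
  match g with
  | .spherical => -(2 * Real.log (Real.cos t))
  | .hyperbolic => 2 * Real.log (Real.cosh t)

/-- The interval on which `Geom.excess` is defined and strictly increasing: its values at half the
sums of distances occur, and on the sphere these sums stay below `π`. -/
def Geom.range (g : Geom) : Set ℝ :=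
  match g with
  | .spherical => Set.Ico 0 (Real.pi / 2)
  | .hyperbolic => Set.Ici 0

theorem Geom.excess_strictMonoOn (g : Geom) : StrictMonoOn g.excess g.range := by
  cases g
  · intro s hs t ht hst
    have h1 : 0 < Real.cos t :=
      Real.cos_pos_of_mem_Ioo ⟨by linarith [ht.1, Real.pi_pos], ht.2⟩
    have h2 : Real.cos t < Real.cos s := Real.strictAntiOn_cos
      ⟨hs.1, by linarith [hs.2, Real.pi_pos]⟩ ⟨ht.1, by linarith [ht.2, Real.pi_pos]⟩ hst
    have := Real.log_lt_log h1 h2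
    simp only [Geom.excess]
    linarith
  · intro s hs t ht hst
    have := Real.log_lt_log (Real.cosh_pos s) (Real.cosh_strictMonoOn hs ht hst)
    simp only [Geom.excess]
    linarith

theorem Geom.exists_excess_eq (g : Geom) {k : ℝ} (hk : 0 ≤ k) : ∃ t ∈ g.range, g.excess t = k := by
  cases g
  · have h1 : Real.exp (-(k / 2)) ≤ 1 := Real.exp_le_one_iff.2 (by linarith)
    have h2 := Real.exp_pos (-(k / 2))
    refine ⟨Real.arccos (Real.exp (-(k / 2))), ⟨Real.arccos_nonneg _,
      Real.arccos_lt_pi_div_two.2 h2⟩, ?_⟩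
    simp only [Geom.excess]
    rw [Real.cos_arccos (by linarith) h1, Real.log_exp]
    ring
  · have h1 : 1 ≤ Real.exp (k / 2) := Real.one_le_exp (by linarith)
    refine ⟨Real.arcosh (Real.exp (k / 2)), Real.arcosh_nonneg h1, ?_⟩
    simp only [Geom.excess]
    rw [Real.cosh_arcosh h1, Real.log_exp]
    ring

theorem Geom.zero_mem_range (g : Geom) : (0 : ℝ) ∈ g.range := by
  cases g
  · exact ⟨le_rfl, by positivity⟩
  · exact Set.self_mem_Ici

theorem Geom.excess_zero (g : Geom) : g.excess 0 = 0 := by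
  cases g <;> simp [Geom.excess]

theorem halfTurn_chart (g : Geom) (a : ℂ) : halfTurn (g.chart a) = g.chart (-a) := by
  simp [Geom.chart, halfTurn, neg_div]

/-- The algebraic relations between the (hyperbolic) cosines `U`, `V` of the distances from a
point `ζ` to `a` and to `-a` and the distances below. -/
theorem cosine_relations (g : Geom) {ζ a : ℂ} (hζ : Complex.normSq ζ < 1)
    (ha : Complex.normSq a < 1) {U V : ℝ}
    (hU : U = 1 - 2 * g.sign * Complex.normSq (ζ - a) /
      ((1 + g.sign * Complex.normSq ζ) * (1 + g.sign * Complex.normSq a)))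
    (hV : V = 1 - 2 * g.sign * Complex.normSq (ζ - -a) /
      ((1 + g.sign * Complex.normSq ζ) * (1 + g.sign * Complex.normSq (-a)))) :
    (U + V) / 2 = (1 - g.sign * Complex.normSq ζ) / (1 + g.sign * Complex.normSq ζ) *
        ((1 - g.sign * Complex.normSq a) / (1 + g.sign * Complex.normSq a)) ∧
      1 + U * V = (U + V) * Real.cosh (Geom.hyperbolic.angle (Geom.hyperbolic.chart (ζ ^ 2))
        (Geom.hyperbolic.chart (a ^ 2))) := by
  have h1 := g.one_add_pos hζ
  have h2 := g.one_add_pos ha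
  have h3 := g.one_sub_pos hζ
  have h4 := g.one_sub_pos ha
  have h5 : ζ ^ 2 - a ^ 2 = (ζ - a) * (ζ - -a) := by ring
  have h6 : Complex.normSq (ζ - -a) =
      2 * (Complex.normSq ζ + Complex.normSq a) - Complex.normSq (ζ - a) := by
    simp only [Complex.normSq_apply, Complex.sub_re, Complex.sub_im, Complex.neg_re,
      Complex.neg_im]
    ring
  have hs := g.sign_sq
  have h7 : (1 + -1 * Complex.normSq ζ ^ 2) =
      (1 + g.sign * Complex.normSq ζ) * (1 - g.sign * Complex.normSq ζ) := by
    linear_combination Complex.normSq ζ ^ 2 * hs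
  have h8 : (1 + -1 * Complex.normSq a ^ 2) =
      (1 + g.sign * Complex.normSq a) * (1 - g.sign * Complex.normSq a) := by
    linear_combination Complex.normSq a ^ 2 * hs
  rw [cosh_hyperbolic_angle (normSq_sq_lt_one hζ) (normSq_sq_lt_one ha), h5, map_mul, normSq_sq,
    normSq_sq]
  simp only [Geom.sign.eq_2]
  rw [h7, h8]
  rw [Complex.normSq_neg, h6] at hV
  rw [h6]
  generalize Complex.normSq (ζ - a) = N at *
  generalize Complex.normSq ζ = n at *
  generalize Complex.normSq a = α at *
  generalize hε : g.sign = ε at *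
  have h1' := h1.ne'
  have h2' := h2.ne'
  have h3' := h3.ne'
  have h4' := h4.ne'
  have hsum : (U + V) / 2 = (1 - ε * n) / (1 + ε * n) * ((1 - ε * α) / (1 + ε * α)) := by
    rw [hU, hV]
    field_simp
    ring
  refine ⟨hsum, ?_⟩
  rw [show U + V = 2 * ((U + V) / 2) by ring, hsum, hU, hV]
  field_simp
  linear_combination 4 * N * (2 * (n + α) - N) * hs

theorem two_mul_log_eq {s d A B y : ℝ} (hd : 0 < d) (hds : d ≤ s) (hA : 0 < A) (hB : 0 < B)
    (hy : 0 ≤ y) (h1 : s * d = A * B) (h2 : s ^ 2 + d ^ 2 = 2 * (s * d) * Real.cosh y) :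
    2 * Real.log s = Real.log A + Real.log B + y ∧
      2 * Real.log d = Real.log A + Real.log B - y := by
  have hs : 0 < s := by linarith
  have h3 : y = Real.log (s / d) := by
    refine eq_log_of_cosh_eq hy (by rwa [one_le_div hd]) ?_
    have : Real.cosh y = (s ^ 2 + d ^ 2) / (2 * (s * d)) := by
      rw [h2]; field_simp
    rw [this]
    field_simp
  have h4 := congrArg Real.log h1
  rw [Real.log_mul hs.ne' hd.ne', Real.log_mul hA.ne' hB.ne'] at h4
  rw [Real.log_div hs.ne' hd.ne'] at h3
  constructor <;> linarith

theorem one_add_cos_mul_cos (u v : ℝ) : 1 + Real.cos u * Real.cos v =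
    Real.cos ((u + v) / 2) ^ 2 + Real.cos (|u - v| / 2) ^ 2 := by
  obtain ⟨s, d, rfl, rfl⟩ : ∃ s d, u = s + d ∧ v = s - d :=
    ⟨(u + v) / 2, (u - v) / 2, by ring, by ring⟩
  rw [show (s + d + (s - d)) / 2 = s by ring, show s + d - (s - d) = 2 * d by ring, abs_mul,
    abs_two, mul_div_cancel_left₀ _ two_ne_zero, Real.cos_abs, Real.cos_add, Real.cos_sub]
  linear_combination (-1 + Real.cos s ^ 2) * Real.sin_sq_add_cos_sq d -
    Real.sin d ^ 2 * Real.sin_sq_add_cos_sq s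

theorem one_add_cosh_mul_cosh (u v : ℝ) : 1 + Real.cosh u * Real.cosh v =
    Real.cosh ((u + v) / 2) ^ 2 + Real.cosh (|u - v| / 2) ^ 2 := by
  obtain ⟨s, d, rfl, rfl⟩ : ∃ s d, u = s + d ∧ v = s - d :=
    ⟨(u + v) / 2, (u - v) / 2, by ring, by ring⟩
  rw [show (s + d + (s - d)) / 2 = s by ring, show s + d - (s - d) = 2 * d by ring, abs_mul,
    abs_two, mul_div_cancel_left₀ _ two_ne_zero, Real.cosh_abs, Real.cosh_add, Real.cosh_sub]
  linear_combination (Real.cosh s ^ 2 - 1) * Real.cosh_sq d + Real.sinh d ^ 2 * Real.cosh_sq s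

theorem cos_mul_cos_half (u v : ℝ) :
    Real.cos ((u + v) / 2) * Real.cos (|u - v| / 2) = (Real.cos u + Real.cos v) / 2 := by
  rw [Real.cos_add_cos, ← Real.cos_abs ((u - v) / 2), abs_div, abs_two]
  ring

theorem cosh_mul_cosh_half (u v : ℝ) :
    Real.cosh ((u + v) / 2) * Real.cosh (|u - v| / 2) = (Real.cosh u + Real.cosh v) / 2 := by
  obtain ⟨s, d, rfl, rfl⟩ : ∃ s d, u = s + d ∧ v = s - d :=
    ⟨(u + v) / 2, (u - v) / 2, by ring, by ring⟩
  rw [show (s + d + (s - d)) / 2 = s by ring, show s + d - (s - d) = 2 * d by ring, abs_mul,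
    abs_two, mul_div_cancel_left₀ _ two_ne_zero, Real.cosh_abs, Real.cosh_add, Real.cosh_sub]
  ring

/-- Distances `u`, `v` from a point to two opposite points, and the distances `x`, `y` from its
image to the images, that is, to `O` and to a point at distance `c` from `O`: the sum and the
difference of `u` and `v` determine `x + y` and `x - y`. -/
theorem excess_chart (g : Geom) {ζ a : ℂ} (hζ : Complex.normSq ζ < 1)
    (ha : Complex.normSq a < 1) {u v x y c : ℝ}
    (hu : u = g.angle (g.chart ζ) (g.chart a)) (hv : v = g.angle (g.chart ζ) (g.chart (-a)))
    (hx : x = Geom.hyperbolic.angle (Geom.hyperbolic.chart (ζ ^ 2)) southPole)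
    (hy : y = Geom.hyperbolic.angle (Geom.hyperbolic.chart (ζ ^ 2)) (Geom.hyperbolic.chart (a ^ 2)))
    (hc : c = Geom.hyperbolic.angle (Geom.hyperbolic.chart (a ^ 2)) southPole) :
    ((u + v) / 2 ∈ g.range ∧ g.excess ((u + v) / 2) = x + c + y) ∧
      |u - v| / 2 ∈ g.range ∧ g.excess (|u - v| / 2) = x + c - y := by
  have ha' : Complex.normSq (-a) < 1 := by rwa [Complex.normSq_neg]
  have hζm := g.chart_mem_surface hζ
  have hu0 : 0 ≤ u := hu ▸ angle_nonneg g hζm (g.chart_mem_surface ha)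
  have hv0 : 0 ≤ v := hv ▸ angle_nonneg g hζm (g.chart_mem_surface ha')
  have hy0 : 0 ≤ y := hy ▸ angle_nonneg .hyperbolic
    (Geom.chart_mem_surface _ (normSq_sq_lt_one hζ)) (Geom.chart_mem_surface _ (normSq_sq_lt_one ha))
  have habs : |u - v| ≤ u + v := abs_sub_le_iff.2 ⟨by linarith, by linarith⟩
  have hn := Complex.normSq_nonneg ζ
  have hα := Complex.normSq_nonneg a
  have hA : 0 < (1 + Complex.normSq ζ) / (1 - Complex.normSq ζ) := by
    have : 0 < 1 - Complex.normSq ζ := by linarith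
    positivity
  have hB : 0 < (1 + Complex.normSq a) / (1 - Complex.normSq a) := by
    have : 0 < 1 - Complex.normSq a := by linarith
    positivity
  rw [hyperbolic_angle_chart_southPole hζ] at hx
  rw [hyperbolic_angle_chart_southPole ha] at hc
  cases g
  · have hcu := cos_spherical_angle hζ ha
    have hcv := cos_spherical_angle hζ ha'
    rw [← hu] at hcu
    rw [← hv] at hcv
    obtain ⟨h1, h2⟩ := cosine_relations .spherical hζ ha hcu hcv
    rw [← hy] at h2
    have hu1 : u ≤ Real.pi := hu ▸ Real.arccos_le_pi _
    have hv1 : v ≤ Real.pi := hv ▸ Real.arccos_le_pi _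
    simp only [Geom.sign, one_mul] at h1
    have hprod : Real.cos ((u + v) / 2) * Real.cos (|u - v| / 2) =
        ((1 + Complex.normSq ζ) / (1 - Complex.normSq ζ) *
          ((1 + Complex.normSq a) / (1 - Complex.normSq a)))⁻¹ := by
      rw [mul_inv, inv_div, inv_div, ← h1, cos_mul_cos_half]
    have hpos : 0 < Real.cos ((u + v) / 2) * Real.cos (|u - v| / 2) := by
      rw [hprod]; positivity
    have hd0 : 0 ≤ Real.cos (|u - v| / 2) := by
      refine Real.cos_nonneg_of_mem_Icc ⟨by linarith [abs_nonneg (u - v), Real.pi_pos], ?_⟩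
      have : |u - v| ≤ Real.pi := abs_sub_le_iff.2 ⟨by linarith, by linarith⟩
      linarith
    have hd : 0 < Real.cos (|u - v| / 2) := lt_of_le_of_ne hd0 fun h => by
      rw [← h, mul_zero] at hpos; exact hpos.false
    have hs : 0 < Real.cos ((u + v) / 2) := pos_of_mul_pos_left hpos hd0
    have hle : Real.cos ((u + v) / 2) ≤ Real.cos (|u - v| / 2) :=
      Real.strictAntiOn_cos.antitoneOn ⟨by positivity, by linarith [abs_nonneg (u - v)]⟩
        ⟨by positivity, by linarith⟩ (by linarith)
    have hrange : (u + v) / 2 ∈ Geom.spherical.range := by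
      refine ⟨by positivity, ?_⟩
      by_contra! hcon
      exact hs.not_ge (Real.cos_nonpos_of_pi_div_two_le_of_le hcon (by linarith [Real.pi_pos]))
    have hsq := one_add_cos_mul_cos u v
    have h12 : Real.cos u + Real.cos v =
        2 * (Real.cos ((u + v) / 2) * Real.cos (|u - v| / 2)) := by
      rw [cos_mul_cos_half]; ring
    have hlog := two_mul_log_eq (s := (Real.cos ((u + v) / 2))⁻¹)
      (d := (Real.cos (|u - v| / 2))⁻¹) (inv_pos.2 hd) (inv_anti₀ hs hle) hA hB hy0
      (by rw [← mul_inv, hprod, inv_inv]) (by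
        rw [hsq, h12] at h2
        field_simp
        linear_combination h2)
    rw [Real.log_inv, Real.log_inv, ← hx, ← hc] at hlog
    simp only [Geom.excess]
    exact ⟨⟨hrange, by linarith [hlog.1]⟩, ⟨by positivity, by linarith [hrange.2]⟩,
      by linarith [hlog.2]⟩
  · have hcu := cosh_hyperbolic_angle hζ ha
    have hcv := cosh_hyperbolic_angle hζ ha'
    rw [← hu] at hcu
    rw [← hv] at hcv
    obtain ⟨h1, h2⟩ := cosine_relations .hyperbolic hζ ha hcu hcv
    rw [← hy] at h2
    simp only [Geom.sign, neg_mul, one_mul, sub_neg_eq_add, ← sub_eq_add_neg] at h1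
    rw [← cosh_mul_cosh_half] at h1
    have hsq := one_add_cosh_mul_cosh u v
    have h12 : Real.cosh u + Real.cosh v =
        2 * (Real.cosh ((u + v) / 2) * Real.cosh (|u - v| / 2)) := by
      rw [cosh_mul_cosh_half]; ring
    have hle : Real.cosh (|u - v| / 2) ≤ Real.cosh ((u + v) / 2) := by
      rw [Real.cosh_le_cosh, abs_of_nonneg (a := |u - v| / 2) (by positivity),
        abs_of_nonneg (a := (u + v) / 2) (by positivity)]
      linarith
    have hlog := two_mul_log_eq (Real.cosh_pos (|u - v| / 2)) hle hA hB hy0 h1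
      (by rw [← hsq, h2, h12])
    rw [← hx, ← hc] at hlog
    simp only [Geom.excess]
    exact ⟨⟨Set.mem_Ici.2 (by positivity), hlog.1⟩, Set.mem_Ici.2 (by positivity), hlog.2⟩

theorem excess_angle {g : Geom} {q P : V3} (hq : q ∈ g.surface) (hP : P ∈ g.surface) :
    ((g.angle q P + g.angle q (halfTurn P)) / 2 ∈ g.range ∧
      g.excess ((g.angle q P + g.angle q (halfTurn P)) / 2) =
        Geom.hyperbolic.angle (squareMap q) southPole +
          Geom.hyperbolic.angle southPole (squareMap P) +
            Geom.hyperbolic.angle (squareMap q) (squareMap P)) ∧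
    |g.angle q P - g.angle q (halfTurn P)| / 2 ∈ g.range ∧
      g.excess (|g.angle q P - g.angle q (halfTurn P)| / 2) =
        Geom.hyperbolic.angle (squareMap q) southPole +
          Geom.hyperbolic.angle southPole (squareMap P) -
            Geom.hyperbolic.angle (squareMap q) (squareMap P) := by
  have h := excess_chart g (normSq_stereo_lt_one hq) (normSq_stereo_lt_one hP) rfl rfl rfl rfl rfl
  rwa [← halfTurn_chart, chart_stereo hq, chart_stereo hP, ← squareMap_eq, ← squareMap_eq,
    angle_comm _ (squareMap P)] at h

theorem excess_focal_angle {g : Geom} {P : V3} (hP : P ∈ g.surface) :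
    g.angle P (halfTurn P) / 2 ∈ g.range ∧ g.excess (g.angle P (halfTurn P) / 2) =
      2 * Geom.hyperbolic.angle southPole (squareMap P) := by
  have h := (excess_angle hP hP).1
  rw [angle_self g hP, angle_self _ (squareMap_mem_surface hP), zero_add,
    angle_comm _ (squareMap P)] at h
  exact ⟨h.1, by rw [h.2]; ring⟩

theorem IsFocusedBranch.subset_punctured {Z : V3} {C : Set V3} (h : IsFocusedBranch Z C) :
    C ⊆ Geom.hyperbolic.punctured := by
  have h0 := angle_self _ (southPole_mem_surface .hyperbolic)
  rcases h with ⟨k, hk, rfl⟩ | ⟨k, hk, rfl⟩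
  · rintro q ⟨hq, hqk⟩
    refine ⟨hq, ?_⟩
    rintro rfl
    linarith
  · rintro q ⟨hq, hqk⟩
    refine ⟨hq, ?_⟩
    rintro rfl
    rw [← hqk, h0, zero_sub, abs_neg] at hk
    exact hk.not_ge (le_abs_self _)

theorem exists_squareMap_eq (g : Geom) {Z : V3} (hZ : Z ∈ Geom.hyperbolic.surface) :
    ∃ P ∈ g.surface, squareMap P = Z := by
  by_cases h : Z = southPole
  · refine ⟨southPole, southPole_mem_surface g, ?_⟩
    rw [h, squareMap_eq, stereo_southPole, zero_pow two_ne_zero, Geom.chart_zero]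
  · obtain ⟨P, hP, hPZ⟩ := squareMap_surjOn g (show Z ∈ Geom.hyperbolic.punctured from ⟨hZ, h⟩)
    exact ⟨P, hP.1, hPZ⟩

/-- Sums of distances `k > c` and differences `|k| < c` below correspond to `2t` above, where
`g.excess t = k + c`. The south pole, which is missing in the preimage, does not lie on the conic
sections. -/
theorem isCentredConic_preimage {g : Geom} {P : V3} (hP : P ∈ g.surface) {C : Set V3}
    (h : IsFocusedBranch (squareMap P) C) :
    g.IsCentredConic P (g.punctured ∩ squareMap ⁻¹' C) := by
  have hc := excess_focal_angle hP
  have hC := h.subset_punctured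
  have hsub : ∀ q, q ∈ g.punctured ∩ squareMap ⁻¹' C ↔ q ∈ g.surface ∧ squareMap q ∈ C := by
    refine fun q => ⟨fun hq => ⟨hq.1.1, hq.2⟩, fun hq => ⟨⟨hq.1, ?_⟩, hq.2⟩⟩
    rintro rfl
    have := (hC hq.2).2
    rw [squareMap_eq, stereo_southPole, zero_pow two_ne_zero, Geom.chart_zero] at this
    exact this rfl
  rcases h with ⟨k, hk, rfl⟩ | ⟨k, hk, rfl⟩
  · have hc0 := angle_nonneg .hyperbolic (southPole_mem_surface _) (squareMap_mem_surface hP)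
    obtain ⟨t, ht, htk⟩ := g.exists_excess_eq
      (k := k + Geom.hyperbolic.angle southPole (squareMap P)) (by linarith)
    have hlt := (g.excess_strictMonoOn.lt_iff_lt hc.1 ht).1 (by rw [hc.2, htk]; linarith)
    refine Or.inl ⟨2 * t, by linarith, Set.ext fun q => (hsub q).trans ?_⟩
    refine and_congr_right fun hq => ?_
    have he := (excess_angle hq hP).1
    have hiff := g.excess_strictMonoOn.injOn.eq_iff he.1 ht
    rw [he.2, htk] at hiff
    refine Iff.trans ⟨fun h => ?_, fun h => ?_⟩ (hiff.trans ⟨fun h => ?_, fun h => ?_⟩)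
    · linarith [h.2]
    · exact ⟨squareMap_mem_surface hq, by linarith⟩
    · linarith
    · linarith
  · obtain ⟨hk1, hk2⟩ := abs_lt.1 hk
    obtain ⟨t, ht, htk⟩ := g.exists_excess_eq
      (k := k + Geom.hyperbolic.angle southPole (squareMap P)) (by linarith)
    have hlt := (g.excess_strictMonoOn.lt_iff_lt ht hc.1).1 (by rw [hc.2, htk]; linarith)
    have hpos := (g.excess_strictMonoOn.lt_iff_lt g.zero_mem_range ht).1
      (by rw [g.excess_zero, htk]; linarith)
    refine Or.inr ⟨2 * t, by linarith, by linarith, Set.ext fun q => (hsub q).trans ?_⟩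
    refine and_congr_right fun hq => ?_
    have he := (excess_angle hq hP).2
    have hiff := g.excess_strictMonoOn.injOn.eq_iff he.1 ht
    rw [he.2, htk] at hiff
    refine Iff.trans ⟨fun h => ?_, fun h => ?_⟩ (hiff.trans ⟨fun h => ?_, fun h => ?_⟩)
    · linarith [h.2]
    · exact ⟨squareMap_mem_surface hq, by linarith⟩
    · linarith
    · linarith

end ConicBilliards

end

theorem mainTheorem7
    (g : Geom) (Z : V3) (hZ : Z ∈ Geom.hyperbolic.surface)
    (W : Set (Set V3)) (hfin : W.Finite) (hW : ∀ C ∈ W, IsFocusedBranch Z C) :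
    (∃ P ∈ g.surface, squareMap P = Z ∧ ∀ K ∈ g.squareRootWalls W, g.IsCentredConic P K) ∧
    (∀ m E : ℝ, IsConformalTransformation squareMap
      (hookeBilliard g (E + g.sign * m) (g.squareRootWalls W)) (keplerBilliard m W)
      (2 * m) E) ∧
    (∀ T : Set (ℝ × ℝ),
      IsIntegrable T (fun p => keplerBilliard p.1 W) (fun p => p.2) ↔
        IsIntegrable T
          (fun p => hookeBilliard g (p.2 + g.sign * p.1) (g.squareRootWalls W))
          (fun p => 2 * p.1)) := by
  have hsub : ∀ C ∈ W, C ⊆ Geom.hyperbolic.punctured := fun C hC => (hW C hC).subset_punctured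
  refine ⟨?_, fun m E => isConformalTransformation_squareMap g hsub m E, fun T =>
    ⟨isIntegrable_hooke_of_kepler g hsub, isIntegrable_kepler_of_hooke g hsub⟩⟩
  obtain ⟨P, hP, rfl⟩ := exists_squareMap_eq g hZ
  refine ⟨P, hP, rfl, ?_⟩
  rintro _ ⟨C, hC, rfl⟩
  exact isCentredConic_preimage hP (hW C hC)
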